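/- Fix $\alpha$ with $0<\alpha<1/4$. For $x,y\in\mathbb Z$ and $\zeta,\eta\in\{+1,-1\}$, let $C_H(x,y,\zeta,\eta)$ be the polygonal line with successive vertices $(x+\alpha,y+\zeta\alpha)$, $(x+2\alpha,y)$, $(x+1-2\alpha,y)$, $(x+1-\alpha,y+\eta\alpha)$, and let $C_V(x,y,\zeta,\eta)$ be the polygonal line with successive vertices $(x+\zeta\alpha,y+\alpha)$, $(x,y+2\alpha)$, $(x,y+1-2\alpha)$, $(x+\eta\alpha,y+1-\alpha)$. Their supports are $[(x,y),(x+1,y)]$ and $[(x,y),(x,y+1)]$ respectively. A segment of curve is one of these lines with one of its two orientations; its endpoints (initial and terminal point) are the two ends of its support, in the order given by the orientation. Two segments are consecutive if they have exactly one common point and the first one ends where the second one begins. A complete curve is a sequence $C=(C_i)_{i\in\mathbb Z}$ of segments with pairwise distinct supports such that $C_i$ and $C_{i+1}$ are consecutive for each $i$; we also write $C$ for the union of the $C_i$ in $\mathbb R^2$. The vertices of $C$ are the endpoints of its segments. Its associated sequence is $(\eta_i)_{i\in\mathbb Z}$, where $\eta_i=+1$ if one turns left and $\eta_i=-1$ if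 one turns right when passing from $C_i$ to $C_{i+1}$. The only $0$-folding sequence is the empty one, and the $(n+1)$-folding sequences are the sequences $(-a_m,\dots,-a_1,\varepsilon,a_1,\dots,a_m)$ with $\varepsilon\in\{+1,-1\}$ and $(a_1,\dots,a_m)$ an $n$-folding sequence, $m=2^n-1$ (these are the crease sequences of a strip of paper folded in two $n+1$ times). A complete folding sequence is a sequence $(a_k)_{k\in\mathbb Z}$ in $\{+1,-1\}$ each of whose finite subwords (blocks of consecutive terms) is a subword of an $n$-folding sequence for some $n$. A complete folding curve is a complete curve whose associated sequence is a complete folding sequence. Let $\mathrm{Ext}(C)$ be the set of points of $\mathbb Z^2$ that are not vertices of $C$. A connected component of $\mathrm{Ext}(C)$ is a nonempty subset $K$ of $\mathrm{Ext}(C)$ which is maximal for the property that any two points of $K$ are joined by a finite sequence of points of $K$ in which successive points are at Euclidean distance $1$. **Theorem 2.4.** Let $C$ be a complete folding curve. Then $\mathrm{Ext}(C)$ is the union of its connected components; there are $0$, $1$ or $2$ of them, and each of them is infinite. Moreover, $\mathbb R^2-C$ has exactly $2$ connected components, and each connected component of $\mathrm{Ext}(C)$ is the intersection of $\mathrm{Ext}(C)$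 with one of them. -/

import Mathlib

/-- The sequence `(-aₙ, …, -a₁)` associated with `(a₁, …, aₙ)`; the set `{+1, -1}` is `ℤˣ`. -/
def foldBar (S : List ℤˣ) : List ℤˣ := (S.map fun a => -a).reverse

/-- `IsNFolding n S`: `S` is the sequence of creases of a strip of paper folded `n` times in two.
The first fold puts a crease `ε` in the middle; the folded (double) strip is then folded `n` more
times, which prints some `n`-folding sequence `S` on the right half, and on the left half, which was
turned over, the same creases in the reverse order and with the opposite shapes. -/
inductive IsNFolding : ℕ → List ℤˣ → Prop
  | zero : IsNFolding 0 []
  | succ (n : ℕ) (S : List ℤˣ) (ε : ℤˣ) (h : IsNFolding n S) :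
      IsNFolding (n + 1) (foldBar S ++ ε :: S)

/-- A finite folding sequence is a subword (of consecutive terms) of some `n`-folding sequence. -/
def IsFiniteFolding (T : List ℤˣ) : Prop := ∃ n S, IsNFolding n S ∧ T <:+: S

/-- A complete folding sequence: all the finite subwords `(a_{m}, …, a_{m+n-1})` are finite folding
sequences. -/
def IsCompleteFoldingSequence (a : ℤ → ℤˣ) : Prop :=
  ∀ (m : ℤ) (n : ℕ), IsFiniteFolding (List.ofFn fun k : Fin n => a (m + (k : ℕ)))

/-- The data `(x, y, ζ, η)` of a segment of curve `C_H(x, y, ζ, η)` (if `horizontal`) or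
`C_V(x, y, ζ, η)` (otherwise), together with its orientation: `positive` means from left to right,
respectively from bottom to top. -/
structure OrientedSegment where
  horizontal : Bool
  positive : Bool
  x : ℤ
  y : ℤ
  ζ : ℤˣ
  η : ℤˣ

namespace OrientedSegment

/-- The real number `±1` given by a sign. -/
def sgn (ε : ℤˣ) : ℝ := ((ε : ℤ) : ℝ)

/-- The point of the segment near its left (bottom) lattice point, where the segment stops. -/
noncomputable def lowEnd (α : ℝ) (s : OrientedSegment) : ℝ × ℝ :=
  if s.horizontal then (s.x + α, s.y + sgn s.ζ * α) else (s.x + sgn s.ζ * α, s.y + α)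

/-- The left (bottom) end of the straight middle part of the segment. -/
noncomputable def lowBend (α : ℝ) (s : OrientedSegment) : ℝ × ℝ :=
  if s.horizontal then (s.x + 2 * α, s.y) else (s.x, s.y + 2 * α)

/-- The right (top) end of the straight middle part of the segment. -/
noncomputable def highBend (α : ℝ) (s : OrientedSegment) : ℝ × ℝ :=
  if s.horizontal then (s.x + 1 - 2 * α, s.y) else (s.x, s.y + 1 - 2 * α)

/-- The point of the segment near its right (top) lattice point, where the segment stops. -/
noncomputable def highEnd (α : ℝ) (s : OrientedSegment) : ℝ × ℝ :=
  if s.horizontal then (s.x + 1 - α, s.y + sgn s.η * α) else (s.x + sgn s.η * α, s.y + 1 - α)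

/-- The segment of curve, as a subset of the plane. -/
def carrier (α : ℝ) (s : OrientedSegment) : Set (ℝ × ℝ) :=
  segment ℝ (s.lowEnd α) (s.lowBend α) ∪ segment ℝ (s.lowBend α) (s.highBend α) ∪
    segment ℝ (s.highBend α) (s.highEnd α)

/-- The point where the oriented segment of curve begins. -/
noncomputable def beginning (α : ℝ) (s : OrientedSegment) : ℝ × ℝ :=
  if s.positive then s.lowEnd α else s.highEnd α

/-- The point where the oriented segment of curve ends. -/
noncomputable def ending (α : ℝ) (s : OrientedSegment) : ℝ × ℝ :=
  if s.positive then s.highEnd α else s.lowEnd α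

/-- The left (bottom) lattice point of the support. -/
def lowVertex (s : OrientedSegment) : ℤ × ℤ := (s.x, s.y)

/-- The right (top) lattice point of the support. -/
def highVertex (s : OrientedSegment) : ℤ × ℤ :=
  if s.horizontal then (s.x + 1, s.y) else (s.x, s.y + 1)

/-- The initial point (a lattice point: an end of the support). -/
def initialPoint (s : OrientedSegment) : ℤ × ℤ :=
  if s.positive then s.lowVertex else s.highVertex

/-- The terminal point (a lattice point: an end of the support). -/
def terminalPoint (s : OrientedSegment) : ℤ × ℤ :=
  if s.positive then s.highVertex else s.lowVertex

end OrientedSegment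

/-- The inclusion of `ℤ²` in `ℝ²`. -/
def latticePoint (P : ℤ × ℤ) : ℝ × ℝ := ((P.1 : ℝ), (P.2 : ℝ))

namespace OrientedSegment

/-- The support `[(x, y), (x + 1, y)]` or `[(x, y), (x, y + 1)]` of a segment of curve. -/
def support (s : OrientedSegment) : Set (ℝ × ℝ) :=
  segment ℝ (latticePoint s.lowVertex) (latticePoint s.highVertex)

/-- Two segments of curves are consecutive if they have just one common point and the end of the
first one is the beginning of the second one. -/
def Consecutive (α : ℝ) (s t : OrientedSegment) : Prop :=
  (∃ p, s.carrier α ∩ t.carrier α = {p}) ∧ s.ending α = t.beginning α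

/-- The determinant of the directions of `s` and `t`. If `s`, `t` are consecutive, it is `+1` if one
turns left when passing from `s` to `t`, and `-1` if one turns right. -/
def turn (s t : OrientedSegment) : ℤ :=
  (s.terminalPoint.1 - s.initialPoint.1) * (t.terminalPoint.2 - t.initialPoint.2) -
    (s.terminalPoint.2 - s.initialPoint.2) * (t.terminalPoint.1 - t.initialPoint.1)

end OrientedSegment

/-- A complete curve: a sequence, indexed by `ℤ`, of consecutive segments which all have distinct
supports. -/
def IsCompleteCurve (α : ℝ) (C : ℤ → OrientedSegment) : Prop :=
  (∀ i, (C i).Consecutive α (C (i + 1))) ∧ Function.Injective fun i => (C i).support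

/-- A complete folding curve: a complete curve whose sequence of turns is a complete folding
sequence. -/
def IsCompleteFoldingCurve (α : ℝ) (C : ℤ → OrientedSegment) : Prop :=
  IsCompleteCurve α C ∧ ∃ a : ℤ → ℤˣ, IsCompleteFoldingSequence a ∧
    ∀ i, ((a i : ℤˣ) : ℤ) = (C i).turn (C (i + 1))

/-- The curve as a subset of the plane. -/
def curveSet (α : ℝ) (C : ℤ → OrientedSegment) : Set (ℝ × ℝ) := ⋃ i, (C i).carrier α

/-- The vertices of a curve are the endpoints of its segments. -/
def curveVertices (C : ℤ → OrientedSegment) : Set (ℤ × ℤ) :=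
  {P | ∃ i, P = (C i).initialPoint ∨ P = (C i).terminalPoint}

/-- The exterior of a curve: the points of `ℤ²` which are not vertices of it. -/
def latticeExt (C : ℤ → OrientedSegment) : Set (ℤ × ℤ) := (curveVertices C)ᶜ

/-- Any two points of `K` are connected by a path `(X₀, …, Xₙ)`, with steps of Euclidean length `1`,
which only contains points of `K`. -/
def IsPathConnectedLattice (K : Set (ℤ × ℤ)) : Prop :=
  ∀ P ∈ K, ∀ Q ∈ K, ∃ (n : ℕ) (X : ℕ → ℤ × ℤ), X 0 = P ∧ X n = Q ∧
    (∀ i < n, ((X (i + 1)).1 - (X i).1) ^ 2 + ((X (i + 1)).2 - (X i).2) ^ 2 = 1) ∧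
    ∀ i ≤ n, X i ∈ K

/-- The connected components of a subset `E` of `ℤ²`: the nonempty subsets of `E` which are maximal
among those whose points are connected by paths inside them. -/
def latticeComponents (E : Set (ℤ × ℤ)) : Set (Set (ℤ × ℤ)) :=
  {K | K.Nonempty ∧ Maximal (fun L => L ⊆ E ∧ IsPathConnectedLattice L) K}

/-- The (topological) connected components of a subset of the plane. -/
def planeComponents (A : Set (ℝ × ℝ)) : Set (Set (ℝ × ℝ)) :=
  {U | ∃ p ∈ A, U = connectedComponentIn A p}

/-! ### Complete folding sequences are Toeplitz sequences -/

/-! The creases of the last fold alternate along the strip, and undoing that fold leaves a strip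
folded once less. So a complete folding sequence alternates on one class of indices modulo 2 and
restricts to a complete folding sequence on the other (`IsCompleteFoldingSequence.exists_class`).
Geometrically, pairs of steps add up to the steps of a coarser folding curve on a copy of (1 + i)ℤ².
This extends the turns of the curve to a turning rule on all of ℤ² with `n` levels of the same
structure (`exists_isFoldingRule`), whose closed orbits have lengths divisible by `2 ^ n`
(`IsFoldingRule.two_pow_dvd`). A limit along an ultrafilter is a rule `t` which the curve follows
and which has no closed orbit at all (`exists_aperiodic_rule`). The orbits of `t` on the alternately
oriented edges cover the lattice and touch at lattice points without crossing; the curve is one of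
them.

Jordan-type arguments use colourings modulo 2: a set of edges with even degree everywhere is the
boundary of a set of squares, bounded if the edges are finitely many. An infinite orbit that avoids
such a finite set lies outside (`color_eq_zero`). An orbit off the curve touches it from one side
only, hence always with the same turn; four such contacts in succession would close a unit square,
so the orbit keeps meeting exterior points. Consecutive ones are connected (`conn_firstExit`, whose
delicate case is `false_of_loop`), so components are infinite. Exterior points reached from the same
side of the curve are connected (`conn_of_side`), because the closed loops of the curve can be
skipped; so there are at most two components.

In the plane, squares with cut corners and tilted squares around lattice points form a tiling.
Passages through midpoints of unused edges and corners link each point off the curve to one of its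
two sides (`exists_linked_side`), and the colouring separates these sides (`color_eq_of_linked`). -/

/-- The list `x, T₀, -x, T₁, x, …` obtained by inserting alternating signs around the terms
of `T`. -/
def interleave : ℤˣ → List ℤˣ → List ℤˣ
  | x, [] => [x]
  | x, t :: T => x :: t :: interleave (-x) T

theorem interleave_append (x ε : ℤˣ) (T U : List ℤˣ) :
    interleave x (T ++ ε :: U) =
      interleave x T ++ ε :: interleave ((-1) ^ (T.length + 1) * x) U := by
  induction T generalizing x with
  | nil => simp [interleave]
  | cons t T ih => simp [interleave, ih, pow_succ]

theorem foldBar_cons (t : ℤˣ) (T : List ℤˣ) : foldBar (t :: T) = foldBar T ++ [-t] := by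
  simp [foldBar]

theorem length_foldBar (T : List ℤˣ) : (foldBar T).length = T.length := by
  simp [foldBar]

/-- The last inserted sign is `(-1) ^ T.length * x`; reversal puts it first and negation changes it.
-/
theorem foldBar_interleave (x : ℤˣ) (T : List ℤˣ) :
    foldBar (interleave x T) = interleave ((-1) ^ (T.length + 1) * x) (foldBar T) := by
  induction T generalizing x with
  | nil => simp [interleave, foldBar]
  | cons t T ih =>
    rw [interleave, foldBar_cons, foldBar_cons, ih, foldBar_cons, interleave_append, length_foldBar]
    have h : ((-1 : ℤˣ) ^ (T.length + 1)) * (-1) ^ (T.length + 1) = 1 := by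
      rw [← mul_pow]; simp
    simp only [interleave, List.length_cons, List.append_assoc, List.cons_append, List.nil_append]
    rw [pow_succ (-1 : ℤˣ) (T.length + 1)]
    congr 2
    · simp
    · congr 2
      rw [← mul_assoc, ← mul_assoc, h]; simp

/-- The inserted signs are the creases of the last fold. In the induction the two halves fit around
`ε` because the powers of `-1` from `foldBar_interleave` and `interleave_append` cancel. -/
theorem IsNFolding.exists_interleave {n : ℕ} {S : List ℤˣ} (h : IsNFolding (n + 1) S) :
    ∃ x T, IsNFolding n T ∧ S = interleave x T := by
  induction n generalizing S with
  | zero =>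
    cases h with
    | succ n S ε h =>
      cases h
      exact ⟨ε, [], .zero, by simp [interleave, foldBar]⟩
  | succ n ih =>
    cases h with
    | succ n S ε h =>
      obtain ⟨x, T, hT, rfl⟩ := ih h
      refine ⟨(-1) ^ (T.length + 1) * x, foldBar T ++ ε :: T, .succ n T ε hT, ?_⟩
      rw [interleave_append, foldBar_interleave, length_foldBar, ← mul_assoc, ← mul_pow]
      simp

theorem getElem?_interleave_odd (x : ℤˣ) (T : List ℤˣ) (j : ℕ) :
    (interleave x T)[2 * j + 1]? = T[j]? := by
  induction T generalizing x j with
  | nil => simp [interleave]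
  | cons t T ih =>
    cases j with
    | zero => simp [interleave]
    | succ j => simpa [interleave, mul_add] using ih (-x) j

theorem getElem?_interleave_even (x : ℤˣ) (T : List ℤˣ) (j : ℕ) (hj : j ≤ T.length) :
    (interleave x T)[2 * j]? = some ((-1) ^ j * x) := by
  induction T generalizing x j with
  | nil => simp at hj; subst hj; simp [interleave]
  | cons t T ih =>
    cases j with
    | zero => simp [interleave]
    | succ j =>
      have := ih (-x) j (by simpa using hj)
      simpa [interleave, mul_add, pow_succ] using this

theorem length_interleave (x : ℤˣ) (T : List ℤˣ) :
    (interleave x T).length = 2 * T.length + 1 := by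
  induction T generalizing x with
  | nil => simp [interleave]
  | cons t T ih => simp [interleave, ih]; ring

theorem ofFn_isInfix_iff {n : ℕ} (b : Fin n → ℤˣ) (S : List ℤˣ) :
    List.ofFn b <:+: S ↔ (∃ p, p + n ≤ S.length ∧ ∀ k : Fin n, S[p + k]? = some (b k)) := by
  constructor
  · rintro ⟨U, W, rfl⟩
    refine ⟨U.length, by simp, fun k => ?_⟩
    rw [List.append_assoc, List.getElem?_append_right (by simp), List.getElem?_append_left (by simp)]
    simp
  · rintro ⟨p, hp, h⟩
    have : List.ofFn b = (S.drop p).take n := by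
      apply List.ext_getElem?
      intro i
      by_cases hi : i < n
      · simp [hi, List.getElem?_drop, h ⟨i, hi⟩]
      · simp [hi]
    rw [this]
    exact (List.take_prefix _ _).isInfix.trans (List.drop_suffix _ _).isInfix

/-- `IsToeplitz n a`: `n` times in a row, the sequence alternates on one of the two classes modulo
`2`, and may be replaced by its restriction to the other class. -/
def IsToeplitz : ℕ → (ℤ → ℤˣ) → Prop
  | 0, _ => True
  | n + 1, a => ∃ r : ℤ, (∀ k, a (r + 2 * k + 1) = -a (r + 2 * k - 1)) ∧
      IsToeplitz n fun k => a (r + 2 * k)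

/-- On the interval `[-M, M]`, the sequence `a` alternates outside of the class of `r`, and its
restriction to the class of `r` consists of finite folding sequences. -/
def FoldsOn (a : ℤ → ℤˣ) (r : ℤ) (M : ℕ) : Prop :=
  (∀ k : ℤ, -M ≤ r + 2 * k - 1 → r + 2 * k + 1 ≤ M → a (r + 2 * k + 1) = -a (r + 2 * k - 1)) ∧
  ∀ (m : ℤ) (n : ℕ), -M ≤ r + 2 * m - 1 → r + 2 * (m + n) + 1 ≤ M →
    IsFiniteFolding (List.ofFn fun k : Fin n => a (r + 2 * (m + (k : ℕ))))

/-- A window of `a` is a block of some interleaving, and the parity of its position tells which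
class of indices carries the inserted signs. -/
theorem IsCompleteFoldingSequence.foldsOn {a : ℤ → ℤˣ} (ha : IsCompleteFoldingSequence a) (M : ℕ) :
    ∃ r : ℤ, (r = 0 ∨ r = 1) ∧ FoldsOn a r M := by
  obtain ⟨n, S, hS, hinf⟩ := ha (-M) (2 * M + 1)
  obtain ⟨p, hp, h⟩ := (ofFn_isInfix_iff _ _).1 hinf
  cases n with
  | zero => cases hS; simp at hp
  | succ n =>
  obtain ⟨x, T, hT, rfl⟩ := hS.exists_interleave
  rw [length_interleave] at hp
  have key : ∀ i : ℤ, -M ≤ i → i ≤ M →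
      (interleave x T)[(p + M + i).toNat]? = some (a i) := by
    intro i h1 h2
    have := h ⟨(i + M).toNat, by omega⟩
    rw [show (p + M + i).toNat = p + (i + M).toNat by omega, this]
    simp only [Option.some.injEq]
    congr 1
    omega
  -- Index `i` sits at position `p + M + i`; the class of `r` must fall on the odd positions, those
  -- of `T`.
  refine ⟨(p + M + 1) % 2, by omega, ?_, ?_⟩
  · intro k h1 h2
    generalize hr : ((p : ℤ) + M + 1) % 2 = r at *
    have e1 := key _ h1 (by omega)
    have e2 := key _ (by omega) h2
    obtain ⟨j, hj⟩ : ∃ j : ℕ, (p + M + (r + 2 * k - 1)).toNat = 2 * j :=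
      ⟨(p + M + (r + 2 * k - 1)).toNat / 2, by omega⟩
    rw [hj, getElem?_interleave_even _ _ _ (by omega)] at e1
    rw [show (p + M + (r + 2 * k + 1)).toNat = 2 * (j + 1) by omega,
      getElem?_interleave_even _ _ _ (by omega)] at e2
    simp only [Option.some.injEq] at e1 e2
    rw [← e1, ← e2, pow_succ]; simp
  · intro m l h1 h2
    generalize hr : ((p : ℤ) + M + 1) % 2 = r at *
    refine ⟨n, T, hT, (ofFn_isInfix_iff _ _).2 ?_⟩
    obtain ⟨j, hj⟩ : ∃ j : ℕ, (p + M + (r + 2 * m)).toNat = 2 * j + 1 :=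
      ⟨(p + M + (r + 2 * m)).toNat / 2, by omega⟩
    refine ⟨j, by omega, fun k => ?_⟩
    have hk := k.2
    have e := key (r + 2 * (m + (k : ℕ))) (by omega) (by omega)
    rwa [show (p + M + (r + 2 * (m + (k : ℕ)))).toNat = 2 * (j + k) + 1 by omega,
      getElem?_interleave_odd] at e

theorem FoldsOn.mono {a : ℤ → ℤˣ} {r : ℤ} {M N : ℕ} (h : FoldsOn a r N) (hMN : M ≤ N) :
    FoldsOn a r M :=
  ⟨fun k h1 h2 => h.1 k (by omega) (by omega), fun m n h1 h2 => h.2 m n (by omega) (by omega)⟩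

/-- Compactness with two candidates: if each class failed on some window, both would fail on the
larger one, against `foldsOn`. -/
theorem IsCompleteFoldingSequence.exists_class {a : ℤ → ℤˣ} (ha : IsCompleteFoldingSequence a) :
    ∃ r : ℤ, (∀ k, a (r + 2 * k + 1) = -a (r + 2 * k - 1)) ∧
      IsCompleteFoldingSequence fun k => a (r + 2 * k) := by
  obtain ⟨r, hr⟩ : ∃ r : ℤ, ∀ M, FoldsOn a r M := by
    by_contra! hcon
    obtain ⟨M, hM⟩ := hcon 0
    obtain ⟨N, hN⟩ := hcon 1
    obtain ⟨r, rfl | rfl, h⟩ := ha.foldsOn (max M N)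
    · exact hM (h.mono (le_max_left _ _))
    · exact hN (h.mono (le_max_right _ _))
  refine ⟨r, fun k => ?_, fun m n => ?_⟩
  · exact (hr ((r + 2 * k).natAbs + 1)).1 k (by omega) (by omega)
  · exact (hr ((r + 2 * m).natAbs + 2 * n + 1)).2 m n (by omega) (by omega)

theorem IsCompleteFoldingSequence.isToeplitz {a : ℤ → ℤˣ} (ha : IsCompleteFoldingSequence a)
    (n : ℕ) : IsToeplitz n a := by
  induction n generalizing a with
  | zero => trivial
  | succ n ih =>
    obtain ⟨r, h1, h2⟩ := ha.exists_class
    exact ⟨r, h1, ih h2⟩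

/-! ### Darts of the square lattice and turning rules -/

/-- A dart `(z, d)` is the unit step from `z` to `z + d`. -/
abbrev Dart := (ℤ × ℤ) × (ℤ × ℤ)

/-- The four unit directions. -/
def IsDir (d : ℤ × ℤ) : Prop := d = (1, 0) ∨ d = (0, 1) ∨ d = (-1, 0) ∨ d = (0, -1)

/-- The end of a dart. -/
def head (x : Dart) : ℤ × ℤ := x.1 + x.2

/-- The dart which follows `x` after a left turn (`s = 1`) or a right turn (`s = -1`). -/
def turnStep (s : ℤˣ) (x : Dart) : Dart := (x.1 + x.2, (-(s * x.2.2), s * x.2.1))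

/-- The dart which follows `x` when the turns at the lattice points are prescribed by `t`. -/
def step (t : ℤ × ℤ → ℤˣ) (x : Dart) : Dart := turnStep (t (head x)) x

theorem isDir_turnStep {x : Dart} (hx : IsDir x.2) (s : ℤˣ) : IsDir (turnStep s x).2 := by
  obtain ⟨z, d⟩ := x
  rcases hx with h | h | h | h <;> rcases Int.units_eq_one_or s with rfl | rfl <;>
    simp_all [IsDir, turnStep]

theorem isDir_step {x : Dart} (hx : IsDir x.2) (t : ℤ × ℤ → ℤˣ) : IsDir (step t x).2 :=
  isDir_turnStep hx _

theorem turnStep_fst (s : ℤˣ) (x : Dart) : (turnStep s x).1 = head x := rfl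

theorem step_fst (t : ℤ × ℤ → ℤˣ) (x : Dart) : (step t x).1 = head x := rfl

theorem head_turnStep_turnStep {x : Dart} (hx : IsDir x.2) (σ τ : ℤˣ) :
    ((head (turnStep τ (turnStep σ x))).1 = (head x).1 + 1 ∨
      (head (turnStep τ (turnStep σ x))).1 = (head x).1 - 1) ∧
    ((head (turnStep τ (turnStep σ x))).2 = (head x).2 + 1 ∨
      (head (turnStep τ (turnStep σ x))).2 = (head x).2 - 1) := by
  obtain ⟨⟨a, b⟩, d⟩ := x
  rcases hx with h | h | h | h <;> rcases Int.units_eq_one_or σ with rfl | rfl <;>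
    rcases Int.units_eq_one_or τ with rfl | rfl <;> simp at h <;> subst h <;>
    simp [turnStep, head] <;> omega

theorem turnStep_injective (s : ℤˣ) : Function.Injective (turnStep s) := by
  rintro ⟨⟨a, b⟩, c, d⟩ ⟨⟨a', b'⟩, c', d'⟩ h
  rcases Int.units_eq_one_or s with rfl | rfl <;> simp [turnStep] at h ⊢ <;> omega

theorem step_injective (t : ℤ × ℤ → ℤˣ) : Function.Injective (step t) := by
  intro x y h
  have h' : head x = head y := congrArg Prod.fst h
  unfold step at h
  rw [h'] at h
  exact turnStep_injective _ h

/-! ### Renormalisation of turning rules by the sublattice (1 + i)ℤ² -/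

/-- The inclusion of a sublattice of index two, `w ↦ c + (1 + i) w` in complex notation. -/
def dilate (c : ℤ) (w : ℤ × ℤ) : ℤ × ℤ := (c + w.1 - w.2, w.1 + w.2)

theorem dilate_injective (c : ℤ) : Function.Injective (dilate c) := by
  rintro ⟨a, b⟩ ⟨a', b'⟩ h
  simp [dilate] at h ⊢
  omega

/-- The inverse of `dilate c` on its image. -/
def contract (c : ℤ) (z : ℤ × ℤ) : ℤ × ℤ := ((z.1 + z.2 - c) / 2, (z.2 - z.1 + c) / 2)

theorem contract_dilate (c : ℤ) (w : ℤ × ℤ) : contract c (dilate c w) = w := by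
  obtain ⟨a, b⟩ := w
  simp [contract, dilate]
  omega

theorem dilate_contract {c : ℤ} {z : ℤ × ℤ} (h : (z.1 + z.2 - c) % 2 = 0) :
    dilate c (contract c z) = z := by
  obtain ⟨a, b⟩ := z
  simp [contract, dilate] at h ⊢
  omega

/-- In complex notation with `d = x.2`, the dilated coarse step is `(1 + σi)d`. After the turns `σ`
and `τ` the direction is `-στd`, and `(1 - σi)(-στd) = τi(1 + σi)d`: as the next inserted turn is
`-σ`, the coarse step turns by `τ`. -/
theorem dilate_turnStep {c : ℤ} {x y : Dart} {σ τ : ℤˣ} (h₁ : x.1 = dilate c y.1)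
    (h₂ : x.2 + (turnStep σ x).2 = dilate 0 y.2) :
    (turnStep τ (turnStep σ x)).1 = dilate c (turnStep τ y).1 ∧
    (turnStep τ (turnStep σ x)).2 + (turnStep (-σ) (turnStep τ (turnStep σ x))).2 =
      dilate 0 (turnStep τ y).2 := by
  obtain ⟨⟨a, b⟩, d, e⟩ := x
  obtain ⟨⟨a', b'⟩, d', e'⟩ := y
  rcases Int.units_eq_one_or σ with rfl | rfl <;> rcases Int.units_eq_one_or τ with rfl | rfl <;>
    simp [turnStep, dilate] at h₁ h₂ ⊢ <;> omega

/-- On the lattice points which are not in the image of `dilate c`, `t` takes opposite values at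
diagonal neighbours. -/
def FlipsOff (c : ℤ) (t : ℤ × ℤ → ℤˣ) : Prop :=
  ∀ z : ℤ × ℤ, (z.1 + z.2 - c) % 2 = 1 →
    t (z.1 + 1, z.2 + 1) = -t z ∧ t (z.1 + 1, z.2 - 1) = -t z

theorem FlipsOff.eq_neg {c : ℤ} {t : ℤ × ℤ → ℤˣ} (h : FlipsOff c t) {z w : ℤ × ℤ}
    (hz : (z.1 + z.2 - c) % 2 = 1) (h₁ : w.1 = z.1 + 1 ∨ w.1 = z.1 - 1)
    (h₂ : w.2 = z.2 + 1 ∨ w.2 = z.2 - 1) : t w = -t z := by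
  obtain ⟨a, b⟩ := z
  obtain ⟨a', b'⟩ := w
  have hw : (a' + b' - c) % 2 = 1 := by simp at hz h₁ h₂; omega
  have A := h (a, b) hz
  have B := h (a', b') hw
  simp only at h₁ h₂ A B
  rcases h₁ with rfl | rfl <;> rcases h₂ with rfl | rfl
  · exact A.1
  · exact A.2
  · rw [← neg_eq_iff_eq_neg, ← B.2]; congr 2 <;> ring
  · rw [← neg_eq_iff_eq_neg, ← B.1]; congr 2 <;> ring

/-- The two-dimensional analogue of `IsToeplitz`, for turning rules. -/
def IsFoldingRule : ℕ → (ℤ × ℤ → ℤˣ) → Prop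
  | 0, _ => True
  | n + 1, t => ∃ c : ℤ, FlipsOff c t ∧ IsFoldingRule n fun w => t (dilate c w)

/-- The image of `dilate c` is one parity class. The head of `x` is off it, so the turn there is
reversed two steps later; the next head is in it and supplies the coarse turn. -/
theorem two_step_dilate {c : ℤ} {t : ℤ × ℤ → ℤˣ} (ht : FlipsOff c t) {x y : Dart}
    (hx : IsDir x.2) (h₁ : x.1 = dilate c y.1) (h₂ : x.2 + (step t x).2 = dilate 0 y.2) :
    (step t (step t x)).1 = dilate c (step (fun w => t (dilate c w)) y).1 ∧
    (step t (step t x)).2 + (step t (step t (step t x))).2 =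
      dilate 0 (step (fun w => t (dilate c w)) y).2 := by
  have hd : head (step t x) = dilate c (head y) := by
    have e1 := congrArg Prod.fst h₁
    have e2 := congrArg Prod.snd h₁
    have e3 := congrArg Prod.fst h₂
    have e4 := congrArg Prod.snd h₂
    have e5 := congrArg Prod.fst (step_fst t x)
    have e6 := congrArg Prod.snd (step_fst t x)
    apply Prod.ext <;> simp [dilate, head] at * <;> omega
  have h3 : t (head (step t (step t x))) = -t (head x) := by
    apply ht.eq_neg
    · have e1 := congrArg Prod.fst h₁
      have e2 := congrArg Prod.snd h₁
      rcases hx with h | h | h | h <;> simp [dilate, head, h] at * <;> omega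
    · exact (head_turnStep_turnStep hx _ _).1
    · exact (head_turnStep_turnStep hx _ _).2
  have key := dilate_turnStep (c := c) (x := x) (y := y) (σ := t (head x))
    (τ := t (dilate c (head y))) h₁ h₂
  have e2 : step t (step t x) = turnStep (t (dilate c (head y))) (turnStep (t (head x)) x) := by
    rw [← hd]; rfl
  have e3 : step t (step t (step t x)) = turnStep (-t (head x)) (step t (step t x)) := by
    rw [← h3]; rfl
  have e4 : step (fun w => t (dilate c w)) y = turnStep (t (dilate c (head y))) y := rfl
  rw [e3, e2, e4]
  exact key

theorem iterate_two_step_dilate {c : ℤ} {t : ℤ × ℤ → ℤˣ} (ht : FlipsOff c t) (m : ℕ) {x y : Dart}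
    (hx : IsDir x.2) (h₁ : x.1 = dilate c y.1) (h₂ : x.2 + (step t x).2 = dilate 0 y.2) :
    ((step t)^[2 * m] x).1 = dilate c ((step fun w => t (dilate c w))^[m] y).1 ∧
    ((step t)^[2 * m] x).2 + (step t ((step t)^[2 * m] x)).2 =
      dilate 0 ((step fun w => t (dilate c w))^[m] y).2 := by
  induction m generalizing x y with
  | zero => exact ⟨h₁, h₂⟩
  | succ m ih =>
    obtain ⟨k1, k2⟩ := two_step_dilate ht hx h₁ h₂
    have := ih (isDir_step (isDir_step hx t) t) k1 k2
    rwa [show 2 * (m + 1) = 2 * m + 1 + 1 by ring, Function.iterate_succ_apply,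
      Function.iterate_succ_apply, Function.iterate_succ_apply]

theorem iterate_step_parity (t : ℤ × ℤ → ℤˣ) (k : ℕ) {x : Dart} (hx : IsDir x.2) :
    (((step t)^[k] x).1.1 + ((step t)^[k] x).1.2 - (x.1.1 + x.1.2) - k) % 2 = 0 := by
  induction k generalizing x with
  | zero => simp
  | succ k ih =>
    have := ih (isDir_step hx t)
    rw [Function.iterate_succ_apply]
    rw [step_fst] at this
    rcases hx with h | h | h | h <;> simp [head, h] at this ⊢ <;> omega

theorem IsDir.exists_contract {x : Dart} (hx : IsDir x.2) (s : ℤˣ) :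
    x.2 + (turnStep s x).2 = dilate 0 (contract 0 (x.2 + (turnStep s x).2)) ∧
      IsDir (contract 0 (x.2 + (turnStep s x).2)) := by
  obtain ⟨z, d⟩ := x
  rcases hx with h | h | h | h <;> rcases Int.units_eq_one_or s with rfl | rfl <;>
    simp at h <;> subst h <;> simp [IsDir, turnStep, dilate, contract]

/-- A closed orbit has even length by parity. Started at a point of the sublattice, its steps group
in pairs into a closed orbit of half the length for the coarse rule. -/
theorem IsFoldingRule.two_pow_dvd {n : ℕ} {t : ℤ × ℤ → ℤˣ} (ht : IsFoldingRule n t) {x : Dart}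
    (hx : IsDir x.2) {k : ℕ} (hk : (step t)^[k] x = x) : 2 ^ n ∣ k := by
  induction n generalizing t x k with
  | zero => simp
  | succ n ih =>
    obtain ⟨c, hc, ht'⟩ := ht
    obtain ⟨m, rfl⟩ : ∃ m, k = 2 * m := by
      have := iterate_step_parity t k hx
      rw [hk] at this
      exact ⟨k / 2, by omega⟩
    obtain ⟨x', hx', hk', hpar⟩ : ∃ x' : Dart, IsDir x'.2 ∧ (step t)^[2 * m] x' = x' ∧
        (x'.1.1 + x'.1.2 - c) % 2 = 0 := by
      rcases Int.emod_two_eq_zero_or_one (x.1.1 + x.1.2 - c) with h | h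
      · exact ⟨x, hx, hk, h⟩
      · refine ⟨step t x, isDir_step hx t, ?_, ?_⟩
        · rw [← Function.iterate_succ_apply, Function.iterate_succ_apply', hk]
        · rw [step_fst]
          rcases hx with h' | h' | h' | h' <;> simp [head, h'] <;> omega
    obtain ⟨e1, e2⟩ := hx'.exists_contract (t (head x'))
    obtain ⟨k1, k2⟩ := iterate_two_step_dilate hc m (x := x')
      (y := (contract c x'.1, contract 0 (x'.2 + (step t x').2))) hx' (dilate_contract hpar).symm e1
    rw [hk'] at k1 k2
    rw [pow_succ, mul_comm]
    refine mul_dvd_mul_left 2 (ih ht' (x := (contract c x'.1, contract 0 (x'.2 + (step t x').2)))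
      e2 (k := m) ?_)
    refine Prod.ext (dilate_injective c ?_) (dilate_injective 0 ?_)
    · rw [← k1, dilate_contract hpar]
    · rw [← k2]; exact e1

/-- Parity changes at each step, so the heads with index in the class of `r` lie in one parity class
of the lattice. There the turns are those of a coarser curve, and induction gives the rule. On the
other class they alternate in time, which is converted into a formula in space. -/
theorem exists_isFoldingRule (n : ℕ) {a : ℤ → ℤˣ} (ha : IsToeplitz n a) {C : ℤ → Dart}
    (hC : ∀ i, C (i + 1) = turnStep (a i) (C i)) (hd : ∀ i, IsDir (C i).2)
    (hcons : ∀ i j, head (C i) = head (C j) → a i = a j) :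
    ∃ t, IsFoldingRule n t ∧ ∀ i, t (head (C i)) = a i := by
  induction n generalizing a C with
  | zero =>
    classical
    -- By `hcons` the turn is the same at all visits of a point; the value `1` off the curve is
    -- arbitrary.
    refine ⟨fun z => if h : ∃ i, head (C i) = z then a h.choose else 1, trivial, fun i => ?_⟩
    have h : ∃ j, head (C j) = head (C i) := ⟨i, rfl⟩
    simp only [h, dite_true]
    exact hcons _ _ h.choose_spec
  | succ n ih =>
    obtain ⟨r, halt, ha'⟩ := ha
    have hfst : ∀ i, (C (i + 1)).1 = head (C i) := fun i => by rw [hC]; rfl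
    set c : ℤ := (head (C r)).1 + (head (C r)).2 with hc
    have hpar1 : ∀ i, ((head (C (i + 1))).1 + (head (C (i + 1))).2
        - ((head (C i)).1 + (head (C i)).2)) % 2 = 1 := by
      intro i
      have := hfst i
      have e1 := congrArg Prod.fst this
      have e2 := congrArg Prod.snd this
      rcases hd (i + 1) with h | h | h | h <;> simp [head, h] at e1 e2 ⊢ <;> omega
    have hpar : ∀ k : ℤ, ((head (C (r + 2 * k))).1 + (head (C (r + 2 * k))).2 - c) % 2 = 0 := by
      intro k
      induction k using Int.induction_on with
      | zero => simp [hc]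
      | succ k ih =>
        have h1 := hpar1 (r + 2 * k)
        have h2 := hpar1 (r + 2 * k + 1)
        rw [show r + 2 * (k : ℤ) + 1 + 1 = r + 2 * (k + 1) by ring] at h2
        omega
      | pred k ih =>
        have h1 := hpar1 (r + 2 * (-k - 1))
        have h2 := hpar1 (r + 2 * (-k - 1) + 1)
        rw [show r + 2 * (-(k : ℤ) - 1) + 1 + 1 = r + 2 * (-k) by ring] at h2
        omega
    have hodd : ∀ k : ℤ,
        ((head (C (r + 2 * k + 1))).1 + (head (C (r + 2 * k + 1))).2 - c) % 2 = 1 := by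
      intro k
      have h1 := hpar1 (r + 2 * k)
      have h2 := hpar k
      omega
    set D : ℤ → Dart := fun k => (contract c (C (r + 2 * k - 1)).1,
      contract 0 ((C (r + 2 * k - 1)).2 + (turnStep (a (r + 2 * k - 1)) (C (r + 2 * k - 1))).2))
      with hD
    have hD1 : ∀ k, (C (r + 2 * k - 1)).1 = dilate c (D k).1 := by
      intro k
      refine (dilate_contract ?_).symm
      have := hfst (r + 2 * (k - 1))
      rw [show r + 2 * (k - 1) + 1 = r + 2 * k - 1 by ring] at this
      rw [this]
      exact hpar (k - 1)
    have hD2 : ∀ k, (C (r + 2 * k - 1)).2 +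
        (turnStep (a (r + 2 * k - 1)) (C (r + 2 * k - 1))).2 = dilate 0 (D k).2 :=
      fun k => ((hd _).exists_contract _).1
    have hturn : ∀ k, C (r + 2 * (k + 1) - 1) =
        turnStep (a (r + 2 * k)) (turnStep (a (r + 2 * k - 1)) (C (r + 2 * k - 1))) := by
      intro k
      rw [← hC, show r + 2 * k - 1 + 1 = r + 2 * k by ring, ← hC]
      congr 1; ring
    have hDhead : ∀ k, head (C (r + 2 * k)) = dilate c (head (D k)) := by
      intro k
      have := (dilate_turnStep (τ := 1) (hD1 k) (hD2 k)).1
      rw [turnStep_fst, turnStep_fst, ← hC, sub_add_cancel] at this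
      exact this
    obtain ⟨t', ht', htD⟩ := ih ha' (C := D) (fun k => by
        have := dilate_turnStep (τ := a (r + 2 * k)) (hD1 k) (hD2 k)
        rw [← halt k, ← hturn] at this
        exact Prod.ext (dilate_injective c ((hD1 (k + 1)).symm.trans this.1))
          (dilate_injective 0 ((hD2 (k + 1)).symm.trans
            (by rw [show r + 2 * (k + 1) - 1 = r + 2 * k + 1 by ring] at this ⊢; exact this.2))))
      (fun k => ((hd _).exists_contract _).2)
      (fun k l hkl => hcons _ _ (by rw [hDhead, hDhead, hkl]))
    -- Two perpendicular unit steps change the abscissa by one, so its parity alternates together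
    -- with the turns `a (r + 2 * k + 1)`, which therefore depend on that parity alone.
    have hflip : ∀ k : ℤ, (head (C (r + 2 * (k + 1) + 1))).1 % 2 ≠ (head (C (r + 2 * k + 1))).1 % 2 := by
      intro k
      have := (head_turnStep_turnStep (hd (r + 2 * k + 1)) (a (r + 2 * k + 1))
        (a (r + 2 * k + 1 + 1))).1
      rw [← hC, ← hC, show r + 2 * k + 1 + 1 + 1 = r + 2 * (k + 1) + 1 by ring] at this
      omega
    obtain ⟨ε, hε⟩ : ∃ ε : ℤˣ, ∀ k : ℤ,
        (if (head (C (r + 2 * k + 1))).1 % 2 = 0 then ε else -ε) = a (r + 2 * k + 1) := by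
      refine ⟨if (head (C (r + 2 * 0 + 1))).1 % 2 = 0 then a (r + 2 * 0 + 1)
        else -a (r + 2 * 0 + 1), fun k => ?_⟩
      induction k using Int.induction_on with
      | zero => split_ifs <;> simp
      | succ k ih =>
        have h1 := hflip k
        have h2 := halt (k + 1)
        rw [show r + 2 * ((k : ℤ) + 1) - 1 = r + 2 * k + 1 by ring] at h2
        rw [h2, ← ih]
        split_ifs <;> first | omega | simp
      | pred k ih =>
        have h1 := hflip (-k - 1)
        have h2 := halt (-k)
        rw [show r + 2 * (-(k : ℤ)) - 1 = r + 2 * (-k - 1) + 1 by ring] at h2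
        rw [← neg_eq_iff_eq_neg] at h2
        rw [← h2, ← ih]
        rw [show r + 2 * (-(k : ℤ) - 1 + 1) + 1 = r + 2 * (-k) + 1 by ring] at h1
        split_ifs <;> first | omega | simp
    refine ⟨fun z => if (z.1 + z.2 - c) % 2 = 0 then t' (contract c z)
      else if z.1 % 2 = 0 then ε else -ε, ⟨c, fun z hz => ?_, ?_⟩, fun i => ?_⟩
    · have e1 : ¬ (z.1 + z.2 - c) % 2 = 0 := by omega
      have e2 : ¬ (z.1 + 1 + (z.2 + 1) - c) % 2 = 0 := by omega
      have e3 : ¬ (z.1 + 1 + (z.2 - 1) - c) % 2 = 0 := by omega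
      by_cases h : z.1 % 2 = 0
      · have h' : ¬ (z.1 + 1) % 2 = 0 := by omega
        simp only [e1, e2, e3, h, h', if_true, if_false, and_self]
      · have h' : (z.1 + 1) % 2 = 0 := by omega
        simp only [e1, e2, e3, h, h', if_true, if_false, neg_neg, and_self]
    · convert ht' using 1
      funext w
      have : ((dilate c w).1 + (dilate c w).2 - c) % 2 = 0 := by simp [dilate]; omega
      simp only [this, if_true, contract_dilate]
    · obtain ⟨k, hk⟩ : ∃ k, i = r + 2 * k ∨ i = r + 2 * k + 1 := ⟨(i - r) / 2, by omega⟩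
      rcases hk with rfl | rfl
      · simp only [hpar k, if_true]
        rw [hDhead, contract_dilate, htD]
      · simp only
        rw [if_neg (by have := hodd k; omega), hε]

/-- A complete folding curve follows a turning rule without periodic orbits, for which opposite
corners of squares of one parity class have opposite signs. -/
theorem exists_aperiodic_rule {a : ℤ → ℤˣ} (ha : IsCompleteFoldingSequence a) {C : ℤ → Dart}
    (hC : ∀ i, C (i + 1) = turnStep (a i) (C i)) (hd : ∀ i, IsDir (C i).2)
    (hcons : ∀ i j, head (C i) = head (C j) → a i = a j) :
    ∃ t : ℤ × ℤ → ℤˣ, (∃ c, FlipsOff c t) ∧ (∀ i, C (i + 1) = step t (C i)) ∧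
      ∀ x : Dart, IsDir x.2 → ∀ k, 0 < k → (step t)^[k] x ≠ x := by
  choose T hT hTa using fun n => exists_isFoldingRule n (ha.isToeplitz n) hC hd hcons
  -- The rules `T n` need not be compatible. Their pointwise limit along an ultrafilter agrees on
  -- any finite set of lattice points with `T n` for arbitrarily large `n`.
  let l : Ultrafilter ℕ := Filter.hyperfilter ℕ
  have hlim : ∀ z, ∃ ε : ℤˣ, ∀ᶠ n in l, T n z = ε := by
    intro z
    have : ∀ᶠ n in (l : Filter ℕ), T n z = 1 ∨ T n z = -1 :=
      Filter.Eventually.of_forall fun n => Int.units_eq_one_or _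
    rcases Ultrafilter.eventually_or.1 this with h | h
    · exact ⟨_, h⟩
    · exact ⟨_, h⟩
  choose t ht using hlim
  have hl : (l : Filter ℕ) ≤ Filter.atTop := by
    rw [← Nat.cofinite_eq_atTop]; exact Filter.hyperfilter_le_cofinite
  refine ⟨t, ?_, fun i => ?_, fun x hx k hk hper => ?_⟩
  -- Only the parity of `c` matters, and the ultrafilter selects one of the two.
  · have hpos : ∀ᶠ n in (l : Filter ℕ), FlipsOff 0 (T n) ∨ FlipsOff 1 (T n) := by
      filter_upwards [hl (Filter.eventually_ge_atTop 1)] with n hn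
      obtain ⟨m, rfl⟩ : ∃ m, n = m + 1 := ⟨n - 1, by omega⟩
      obtain ⟨c, hc, -⟩ := hT (m + 1)
      rcases Int.emod_two_eq_zero_or_one c with h | h
      · exact .inl fun z hz => hc z (by omega)
      · exact .inr fun z hz => hc z (by omega)
    have key : ∀ c, (∀ᶠ n in (l : Filter ℕ), FlipsOff c (T n)) → FlipsOff c t := by
      intro c h z hz
      obtain ⟨n, hn, h1, h2, h3⟩ := (h.and ((ht z).and ((ht _).and (ht _)))).exists
      have := hn z hz
      rw [h1, h2, h3] at this
      exact this
    rcases Ultrafilter.eventually_or.1 hpos with h | h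
    · exact ⟨_, key _ h⟩
    · exact ⟨_, key _ h⟩
  · obtain ⟨n, hn⟩ := (ht (head (C i))).exists
    rw [hC, step, ← hn, hTa]
  -- An orbit of length `k` sees finitely many points, so a period of `t` is one of `T n` for some
  -- `n ≥ k`; but then `2 ^ n` divides `k`.
  · have hit : ∀ j, ∀ᶠ n in (l : Filter ℕ), (step (T n))^[j] x = (step t)^[j] x := by
      intro j
      induction j with
      | zero => simp
      | succ j ih =>
        filter_upwards [ih, ht (head ((step t)^[j] x))] with n h1 h2
        rw [Function.iterate_succ_apply', Function.iterate_succ_apply', h1, step, h2, step]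
    obtain ⟨n, h1, h2⟩ := ((hit k).and (hl (Filter.eventually_ge_atTop k))).exists
    have h3 := Nat.le_of_dvd hk ((hT n).two_pow_dvd hx (h1.trans hper))
    have h4 : n < 2 ^ n := Nat.lt_two_pow_self
    omega

/-! ### Faces of the square lattice and their colourings -/

/-- The orientation of the lattice where horizontal and vertical steps alternate: there is exactly
one oriented dart on each edge. -/
def Oriented (κ : ℤ) (x : Dart) : Prop := IsDir x.2 ∧ (x.1.1 + x.1.2 + x.2.1 + κ) % 2 = 0

/-- The dart with the same head and the opposite direction. -/
def opp (x : Dart) : Dart := (x.1 + x.2 + x.2, -x.2)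

/-- The square on the left (`s = 1`) or right (`s = -1`) side of a dart, represented by the double
of its centre. -/
def face (s : ℤˣ) (x : Dart) : ℤ × ℤ :=
  (2 * x.1.1 + x.2.1 - s * x.2.2, 2 * x.1.2 + x.2.2 + s * x.2.1)

theorem opp_opp (x : Dart) : opp (opp x) = x := by
  obtain ⟨z, d⟩ := x; simp [opp]

theorem head_opp (x : Dart) : head (opp x) = head x := by
  obtain ⟨z, d⟩ := x; simp [opp, head]

theorem opp_ne {x : Dart} (hx : IsDir x.2) : opp x ≠ x := by
  intro h
  have := congrArg Prod.snd h
  rcases hx with h' | h' | h' | h' <;> simp [opp, h'] at this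

/-- Two opposite strands that arrive at a lattice point and turn the same way leave it in opposite
directions: they touch there without crossing. -/
theorem turnStep_opp (s : ℤˣ) (x : Dart) : turnStep s (opp x) = turnStep (-s) x := by
  obtain ⟨z, d⟩ := x; simp [opp, turnStep]

theorem face_turnStep (s : ℤˣ) (x : Dart) : face s (turnStep s x) = face s x := by
  obtain ⟨⟨a, b⟩, d, e⟩ := x
  rcases Int.units_eq_one_or s with rfl | rfl <;> simp [face, turnStep] <;> constructor <;> ring

theorem face_opp (s : ℤˣ) (x : Dart) : face s (opp x) = face s (turnStep (-s) x) := by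
  rw [← face_turnStep, turnStep_opp]

theorem turnStep_four (s : ℤˣ) (x : Dart) :
    turnStep s (turnStep s (turnStep s (turnStep s x))) = x := by
  obtain ⟨⟨a, b⟩, d, e⟩ := x
  rcases Int.units_eq_one_or s with rfl | rfl <;> simp [turnStep] <;> constructor <;> ring

theorem turnStep_ne (s : ℤˣ) {x : Dart} (hx : IsDir x.2) : turnStep s x ≠ turnStep (-s) x := by
  intro h
  have := congrArg Prod.snd h
  rcases hx with h' | h' | h' | h' <;> rcases Int.units_eq_one_or s with rfl | rfl <;>
    simp [turnStep, h'] at this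

theorem Oriented.turn {κ : ℤ} {x : Dart} (hx : Oriented κ x) (s : ℤˣ) :
    Oriented κ (turnStep s x) := by
  refine ⟨isDir_turnStep hx.1 s, ?_⟩
  obtain ⟨z, d⟩ := x
  obtain ⟨hd, hp⟩ := hx
  rcases hd with h' | h' | h' | h' <;> rcases Int.units_eq_one_or s with rfl | rfl <;>
    simp at h' <;> subst h' <;> simp [turnStep] at hp ⊢ <;> omega

theorem Oriented.next {κ : ℤ} {x : Dart} (hx : Oriented κ x) (t : ℤ × ℤ → ℤˣ) :
    Oriented κ (step t x) := hx.turn _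

theorem Oriented.opp {κ : ℤ} {x : Dart} (hx : Oriented κ x) : Oriented κ (opp x) := by
  obtain ⟨z, d⟩ := x
  obtain ⟨hd, hp⟩ := hx
  rcases hd with h' | h' | h' | h' <;> simp at h' <;> subst h' <;>
    simp [Oriented, IsDir, _root_.opp] at hp ⊢ <;> omega

theorem Oriented.eq_or_eq_opp {κ : ℤ} {x y : Dart} (hx : Oriented κ x) (hy : Oriented κ y)
    (h : head x = head y) : y = x ∨ y = _root_.opp x := by
  obtain ⟨⟨a, b⟩, d⟩ := x
  obtain ⟨⟨a', b'⟩, d'⟩ := y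
  obtain ⟨hd, hp⟩ := hx
  obtain ⟨hd', hp'⟩ := hy
  rcases hd with h1 | h1 | h1 | h1 <;> rcases hd' with h2 | h2 | h2 | h2 <;>
    simp at h1 h2 <;> subst h1 h2 <;> simp [head, _root_.opp] at h hp hp' ⊢ <;> omega

theorem Oriented.eq_or_eq_turnStep {κ : ℤ} {x y : Dart} (hx : Oriented κ x) (hy : Oriented κ y)
    (h : head x = y.1) (s : ℤˣ) : y = turnStep s x ∨ y = turnStep (-s) x := by
  obtain ⟨⟨a, b⟩, d⟩ := x
  obtain ⟨⟨a', b'⟩, d'⟩ := y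
  obtain ⟨hd, hp⟩ := hx
  obtain ⟨hd', hp'⟩ := hy
  rcases hd with h1 | h1 | h1 | h1 <;> rcases hd' with h2 | h2 | h2 | h2 <;>
    rcases Int.units_eq_one_or s with rfl | rfl <;>
    simp at h1 h2 <;> subst h1 h2 <;> simp [head, turnStep] at h hp hp' ⊢ <;> omega

/-- Every lattice point is the head of an oriented dart. -/
theorem exists_oriented_head (κ : ℤ) (z : ℤ × ℤ) : ∃ x, Oriented κ x ∧ head x = z := by
  obtain ⟨a, b⟩ := z
  rcases Int.emod_two_eq_zero_or_one (a + b + κ) with h | h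
  · exact ⟨((a - 1, b), (1, 0)), ⟨by simp [IsDir], by simp; omega⟩, by simp [head]⟩
  · exact ⟨((a, b - 1), (0, 1)), ⟨by simp [IsDir], by simp; omega⟩, by simp [head]⟩

/-! ### Colourings of the squares modulo two -/

/-- `f` is a colouring of the squares which changes exactly across the edges of `A`. -/
def IsColoring (κ : ℤ) (A : Set Dart) (f : ℤ × ℤ → ZMod 2) : Prop :=
  ∀ x, Oriented κ x → ∀ s : ℤˣ, (x ∈ A → f (face s x) = f (face (-s) x) + 1) ∧
    (x ∉ A → f (face s x) = f (face (-s) x))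

/-- At each lattice point, the number of edges of `A` is even. -/
def IsBalanced (κ : ℤ) (t : ℤ × ℤ → ℤˣ) (A : Set Dart) : Prop :=
  ∀ x, Oriented κ x → ((x ∈ A ↔ step t x ∈ A) ↔ (opp x ∈ A ↔ step t (opp x) ∈ A))

/-- Discrete integration from `0`; one of the two intervals is always empty, and modulo 2 no sign is
needed for negative `x`. -/
theorem exists_antiderivative (h : ℤ → ZMod 2) :
    ∃ F : ℤ → ZMod 2, F 0 = 0 ∧ ∀ x, F x = F (x - 1) + h x := by
  refine ⟨fun x => ∑ k ∈ Finset.Ioc 0 x, h k + ∑ k ∈ Finset.Ioc x 0, h k, by simp, fun x => ?_⟩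
  rcases le_or_gt x 0 with hx | hx
  · have e : Finset.Ioc (x - 1) 0 = insert x (Finset.Ioc x 0) := by ext; simp; omega
    simp only [e, Finset.sum_insert (show x ∉ Finset.Ioc x 0 by simp)]
    rw [Finset.Ioc_eq_empty (show ¬ (0 : ℤ) < x by omega),
      Finset.Ioc_eq_empty (show ¬ (0 : ℤ) < x - 1 by omega)]
    linear_combination -CharTwo.add_self_eq_zero (h x)
  · have e : Finset.Ioc 0 x = insert x (Finset.Ioc 0 (x - 1)) := by ext; simp; omega
    simp only [e, Finset.sum_insert (show x ∉ Finset.Ioc 0 (x - 1) by simp)]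
    rw [Finset.Ioc_eq_empty (show ¬ x < 0 by omega), Finset.Ioc_eq_empty (show ¬ x - 1 < 0 by omega)]
    ring

/-- The oriented dart on the edge from `(x, y)` to `(x + 1, y)`. -/
def hDart (κ x y : ℤ) : Dart :=
  if (x + y + 1 + κ) % 2 = 0 then ((x, y), (1, 0)) else ((x + 1, y), (-1, 0))

/-- The oriented dart on the edge from `(x, y)` to `(x, y + 1)`. -/
def vDart (κ x y : ℤ) : Dart :=
  if (x + y + κ) % 2 = 0 then ((x, y), (0, 1)) else ((x, y + 1), (0, -1))

open Classical in
/-- The indicator function of a set of darts. -/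
noncomputable def ind (A : Set Dart) (x : Dart) : ZMod 2 := if x ∈ A then 1 else 0

theorem ind_add_ind {A : Set Dart} {x y : Dart} : ind A x + ind A y = 0 ↔ (x ∈ A ↔ y ∈ A) := by
  unfold ind
  split_ifs with h1 h2 h2 <;> simp [h1, h2]
  decide

theorem IsBalanced.sum_eq_zero {κ : ℤ} {t : ℤ × ℤ → ℤˣ} {A : Set Dart} (hA : IsBalanced κ t A)
    {x : Dart} (hx : Oriented κ x) :
    ind A x + ind A (opp x) + ind A (turnStep 1 x) + ind A (turnStep (-1) x) = 0 := by
  have h := hA x hx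
  rw [← ind_add_ind, ← ind_add_ind] at h
  have h' : ind A x + ind A (step t x) + (ind A (opp x) + ind A (step t (opp x))) = 0 := by
    generalize ind A x + ind A (step t x) = u at *
    generalize ind A (opp x) + ind A (step t (opp x)) = v at *
    revert u v; decide
  unfold step at h'
  rw [head_opp, turnStep_opp] at h'
  rcases Int.units_eq_one_or (t (head x)) with e | e <;> rw [e] at h' <;>
    (try simp only [neg_neg] at h') <;> linear_combination h'

/-- Evenness at `(x, y)` is the closedness condition for a potential on the dual lattice. -/
theorem IsBalanced.curl {κ : ℤ} {t : ℤ × ℤ → ℤˣ} {A : Set Dart} (hA : IsBalanced κ t A) (x y : ℤ) :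
    ind A (hDart κ x y) + ind A (hDart κ (x - 1) y) + ind A (vDart κ x y) +
      ind A (vDart κ x (y - 1)) = 0 := by
  unfold hDart vDart
  rcases Int.emod_two_eq_zero_or_one (x + y + κ) with h | h
  · rw [if_neg (by omega), if_pos (by omega), if_pos (by omega), if_neg (by omega)]
    have := hA.sum_eq_zero (x := ((x - 1, y), (1, 0))) ⟨by simp [IsDir], by simp; omega⟩
    simp [opp, turnStep] at this ⊢
    linear_combination this
  · rw [if_pos (by omega), if_neg (by omega), if_neg (by omega), if_pos (by omega)]
    have := hA.sum_eq_zero (x := ((x, y - 1), (0, 1))) ⟨by simp [IsDir], by simp; omega⟩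
    simp [opp, turnStep] at this ⊢
    linear_combination this

/-- The potential of a balanced set. -/
theorem IsBalanced.exists_potential {κ : ℤ} {t : ℤ × ℤ → ℤˣ} {A : Set Dart}
    (hA : IsBalanced κ t A) : ∃ g : ℤ → ℤ → ZMod 2,
      (∀ x y, g x y = g x (y - 1) + ind A (hDart κ x y)) ∧
      ∀ x y, g x y = g (x - 1) y + ind A (vDart κ x y) := by
  obtain ⟨P, -, hP⟩ := exists_antiderivative fun x => ind A (vDart κ x 0)
  choose Q hQ0 hQ using fun x => exists_antiderivative fun y => ind A (hDart κ x y)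
  -- Integration along the axis and then along each column gives the first relation by construction;
  -- the second propagates from `y = 0` by `curl`.
  refine ⟨fun x y => P x + Q x y, fun x y => by simp only [hQ x y]; ring, fun x y => ?_⟩
  have two : ∀ u : ZMod 2, u + u = 0 := CharTwo.add_self_eq_zero
  induction y using Int.induction_on with
  | zero => simp [hQ0, hP x]
  | succ y ih =>
    have := hA.curl x (y + 1)
    change P x + Q x y = P (x - 1) + Q (x - 1) y + _ at ih
    change P x + Q x (y + 1) = P (x - 1) + Q (x - 1) (y + 1) + _
    rw [hQ x, hQ (x - 1)]
    simp only [add_sub_cancel_right] at this ⊢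
    linear_combination ih + this - two (ind A (vDart κ x (y + 1))) - two (ind A (hDart κ (x - 1) (y + 1)))
  | pred y ih =>
    have := hA.curl x (-y)
    change P x + Q x (-y) = P (x - 1) + Q (x - 1) (-y) + _ at ih
    change P x + Q x (-y - 1) = P (x - 1) + Q (x - 1) (-y - 1) + _
    rw [hQ x (-y), hQ (x - 1) (-y)] at ih
    linear_combination ih + this - two (ind A (vDart κ x (-y - 1))) - two (ind A (hDart κ x (-y)))

/-- `g x y` is the colour of the square with lower left corner `(x, y)`, whose doubled centre `(2x +
1, 2y + 1)` gives back `(x, y)` by floor division. -/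
theorem isColoring_of_potential {κ : ℤ} {A : Set Dart} {g : ℤ → ℤ → ZMod 2}
    (h₁ : ∀ x y, g x y = g x (y - 1) + ind A (hDart κ x y))
    (h₂ : ∀ x y, g x y = g (x - 1) y + ind A (vDart κ x y)) :
    IsColoring κ A fun F => g (F.1 / 2) (F.2 / 2) := by
  have key : ∀ x, Oriented κ x → ∀ s : ℤˣ,
      g ((face s x).1 / 2) ((face s x).2 / 2) =
        g ((face (-s) x).1 / 2) ((face (-s) x).2 / 2) + ind A x := by
    rintro ⟨⟨a, b⟩, d⟩ ⟨hd, hp⟩ s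
    have two : ∀ u : ZMod 2, u + u = 0 := CharTwo.add_self_eq_zero
    rcases hd with h | h | h | h <;> simp only at h hp <;> subst h
    · have e := h₁ a b
      rw [hDart, if_pos (by simp at hp; omega)] at e
      have i1 : (2 * a + 1 - 0) / 2 = a := by omega
      have i2 : (2 * b + 0 + 1) / 2 = b := by omega
      have i3 : (2 * b + 0 + -1) / 2 = b - 1 := by omega
      rcases Int.units_eq_one_or s with rfl | rfl <;> simp [face] <;> simp at i1 i2 i3 <;>
        simp only [i1, i2, i3] <;> rw [e]
      linear_combination -two (ind A ((a, b), (1, 0)))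
    · have e := h₂ a b
      rw [vDart, if_pos (by simp at hp; omega)] at e
      have i1 : (2 * a + 1) / 2 = a := by omega
      have i2 : (2 * b + 1) / 2 = b := by omega
      have i3 : (2 * a - 1) / 2 = a - 1 := by omega
      rcases Int.units_eq_one_or s with rfl | rfl <;> simp [face] <;>
        simp only [i1, i2, i3] <;> rw [e]
      linear_combination -two (ind A ((a, b), (0, 1)))
    · have e := h₁ (a - 1) b
      rw [hDart, if_neg (by simp at hp; omega)] at e
      have i1 : (2 * a + -1) / 2 = a - 1 := by omega
      have i2 : (2 * b + 1) / 2 = b := by omega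
      have i3 : (2 * b + -1) / 2 = b - 1 := by omega
      rcases Int.units_eq_one_or s with rfl | rfl <;> simp [face] <;>
        simp only [i1, i2, i3] <;> rw [e] <;> simp
      linear_combination -two (ind A ((a, b), (-1, 0)))
    · have e := h₂ a (b - 1)
      rw [vDart, if_neg (by simp at hp; omega)] at e
      have i1 : (2 * a + 1) / 2 = a := by omega
      have i2 : (2 * b + -1) / 2 = b - 1 := by omega
      have i3 : (2 * a - 1) / 2 = a - 1 := by omega
      rcases Int.units_eq_one_or s with rfl | rfl <;> simp [face] <;>
        simp only [i1, i2, i3] <;> rw [e] <;> simp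
      linear_combination -two (ind A ((a, b), (0, -1)))
  intro x hx s
  have := key x hx s
  constructor <;> intro hA <;> simpa [ind, hA] using this

theorem IsBalanced.exists_coloring {κ : ℤ} {t : ℤ × ℤ → ℤˣ} {A : Set Dart}
    (hA : IsBalanced κ t A) : ∃ f, IsColoring κ A f := by
  obtain ⟨g, h₁, h₂⟩ := hA.exists_potential
  exact ⟨_, isColoring_of_potential h₁ h₂⟩

theorem Int.eq_of_forall_eq_pred {X : Type*} {g : ℤ → X} (h : ∀ x, g x = g (x - 1)) (x y : ℤ) :
    g x = g y := by
  have : ∀ x, g x = g 0 := by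
    intro x
    induction x using Int.induction_on with
    | zero => rfl
    | succ x ih => rw [h, add_sub_cancel_right, ih]
    | pred x ih => rw [← h, ih]
  rw [this x, this y]

/-- Far columns and far rows avoid `A` and meet each other, so the potential is constant outside a
box; subtracting this constant gives a colouring with bounded support. -/
theorem IsBalanced.exists_finite_coloring {κ : ℤ} {t : ℤ × ℤ → ℤˣ} {A : Set Dart}
    (hA : IsBalanced κ t A) (hfin : A.Finite) : ∃ f, IsColoring κ A f ∧
      ∃ R : ℤ, ∀ F : ℤ × ℤ, R < |F.1| ∨ R < |F.2| → f F = 0 := by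
  obtain ⟨g, h₁, h₂⟩ := hA.exists_potential
  obtain ⟨R, hR⟩ : ∃ R : ℤ, ∀ x ∈ A, |x.1.1| ≤ R ∧ |x.1.2| ≤ R := by
    obtain ⟨R₁, h1⟩ := (hfin.image fun x => |x.1.1|).bddAbove
    obtain ⟨R₂, h2⟩ := (hfin.image fun x => |x.1.2|).bddAbove
    exact ⟨max R₁ R₂, fun x hx => ⟨(h1 ⟨x, hx, rfl⟩).trans (le_max_left _ _),
      (h2 ⟨x, hx, rfl⟩).trans (le_max_right _ _)⟩⟩
  have hH : ∀ x y, R + 1 < |x| ∨ R + 1 < |y| → ind A (hDart κ x y) = 0 := by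
    intro x y h
    refine if_neg fun hmem => ?_
    have := hR _ hmem
    unfold hDart at this
    split_ifs at this <;> simp only [abs_le, lt_abs] at this h <;> omega
  have hV : ∀ x y, R + 1 < |x| ∨ R + 1 < |y| → ind A (vDart κ x y) = 0 := by
    intro x y h
    refine if_neg fun hmem => ?_
    have := hR _ hmem
    unfold vDart at this
    split_ifs at this <;> simp only [abs_le, lt_abs] at this h <;> omega
  have col : ∀ x, R + 1 < |x| → ∀ y y', g x y = g x y' := fun x hx =>
    Int.eq_of_forall_eq_pred fun y => by rw [h₁, hH x y (.inl hx), add_zero]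
  have row : ∀ y, R + 1 < |y| → ∀ x x', g x y = g x' y := fun y hy x x' =>
    Int.eq_of_forall_eq_pred (g := fun x => g x y) (fun x => by
      rw [h₂, hV x y (.inr hy), add_zero]) x x'
  obtain ⟨S, hS⟩ : ∃ S, R + 1 < |S| := ⟨|R| + 2, by
    rw [abs_of_nonneg (by positivity)]; have := le_abs_self R; omega⟩
  have hout : ∀ x y, R + 1 < |x| ∨ R + 1 < |y| → g x y = g S S := by
    rintro x y (h | h)
    · rw [col x h y S, row S hS x S]
    · rw [row y h x S, col S hS y S]
  refine ⟨_, isColoring_of_potential (κ := κ) (A := A) (g := fun x y => g x y - g S S)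
    (fun x y => by rw [h₁]; ring) (fun x y => by rw [h₂]; ring), 2 * (|R| + 3), fun F hF => ?_⟩
  have hR' := le_abs_self R
  rw [hout, sub_self]
  simp only [lt_abs] at hF ⊢
  omega

/-! ### Curves which follow an aperiodic turning rule -/

theorem Int.units_eq_or_eq_neg (s τ : ℤˣ) : τ = s ∨ τ = -s := by
  revert s τ; decide

/-- The curve `c` visits the lattice point `z`. -/
def Visited (c : ℤ → Dart) (z : ℤ × ℤ) : Prop := ∃ i, head (c i) = z

/-- A complete curve which follows an aperiodic turning rule `t`, where `t` takes opposite values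
at the opposite corners of each square which belong to a certain parity class. -/
structure IsTrack (κ : ℤ) (t : ℤ × ℤ → ℤˣ) (c : ℤ → Dart) : Prop where
  next : ∀ i, c (i + 1) = step t (c i)
  oriented : ∀ i, Oriented κ (c i)
  injective : Function.Injective c
  flips : ∃ e, FlipsOff e t
  aperiodic : ∀ x : Dart, IsDir x.2 → ∀ k, 0 < k → (step t)^[k] x ≠ x

/-- On the side to which `t` turns, the square does not change. On the other side, compare with that
square across the two darts, which are both in `A` or both out. -/
theorem IsColoring.step_eq {κ : ℤ} {t : ℤ × ℤ → ℤˣ} {A : Set Dart} {f : ℤ × ℤ → ZMod 2}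
    (hf : IsColoring κ A f) {x : Dart} (hx : Oriented κ x) (h : x ∈ A ↔ step t x ∈ A) (s : ℤˣ) :
    f (face s (step t x)) = f (face s x) := by
  rcases Int.units_eq_or_eq_neg s (t (head x)) with e | e
  · rw [step, e, face_turnStep]
  · have e' : face (-s) (step t x) = face (-s) x := by rw [step, e, face_turnStep]
    by_cases hA : x ∈ A
    · rw [(hf x hx s).1 hA, (hf _ (hx.next t) s).1 (h.1 hA), e']
    · rw [(hf x hx s).2 hA, (hf _ (hx.next t) s).2 (mt h.2 hA), e']

theorem IsColoring.eq_of_notMem {κ : ℤ} {A : Set Dart} {f : ℤ × ℤ → ZMod 2}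
    (hf : IsColoring κ A f) {x : Dart} (hx : Oriented κ x) (h : x ∉ A) (s s' : ℤˣ) :
    f (face s x) = f (face s' x) := by
  rcases Int.units_eq_or_eq_neg s s' with rfl | rfl
  · rfl
  · exact (hf x hx s).2 h

theorem Oriented.iterate {κ : ℤ} {x : Dart} (hx : Oriented κ x) (t : ℤ × ℤ → ℤˣ) (k : ℕ) :
    Oriented κ ((step t)^[k] x) := by
  induction k with
  | zero => exact hx
  | succ k ih => rw [Function.iterate_succ_apply']; exact ih.next t

theorem finite_darts (B : ℤ) : {x : Dart | IsDir x.2 ∧ |x.1.1| ≤ B ∧ |x.1.2| ≤ B}.Finite := by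
  refine ((Set.finite_Icc ((-B, -B) : ℤ × ℤ) (B, B)).prod
    (Set.finite_Icc ((-1, -1) : ℤ × ℤ) (1, 1))).subset ?_
  rintro ⟨⟨a, b⟩, d⟩ ⟨hd, h1, h2⟩
  simp only [abs_le] at h1 h2
  rcases hd with h | h | h | h <;> simp at h <;> subst h <;>
    simp [Prod.le_def] <;> omega

namespace IsTrack

variable {κ : ℤ} {t : ℤ × ℤ → ℤˣ} {c : ℤ → Dart}

theorem iterate_injective (h : IsTrack κ t c) {x : Dart} (hx : IsDir x.2) :
    Function.Injective fun k : ℕ => (step t)^[k] x := by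
  intro m n hmn
  by_contra hne
  wlog hlt : m < n generalizing m n
  · exact this hmn.symm (Ne.symm hne) (by omega)
  obtain ⟨k, rfl⟩ : ∃ k, n = m + k := ⟨n - m, by omega⟩
  simp only [Function.iterate_add_apply] at hmn
  exact h.aperiodic x hx k (by omega) ((step_injective t).iterate m hmn).symm

theorem step_mem_iff (h : IsTrack κ t c) {x : Dart} :
    step t x ∈ Set.range c ↔ x ∈ Set.range c := by
  constructor
  · rintro ⟨i, hi⟩
    refine ⟨i - 1, step_injective t ?_⟩
    rw [← h.next, sub_add_cancel, hi]
  · rintro ⟨i, rfl⟩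
    exact ⟨i + 1, h.next i⟩

theorem iterate_mem_iff (h : IsTrack κ t c) {x : Dart} (k : ℕ) :
    (step t)^[k] x ∈ Set.range c ↔ x ∈ Set.range c := by
  induction k with
  | zero => rfl
  | succ k ih => rw [Function.iterate_succ_apply', h.step_mem_iff, ih]

theorem visited_fst (h : IsTrack κ t c) (i : ℤ) : Visited c (c i).1 :=
  ⟨i - 1, by rw [← step_fst t, ← h.next, sub_add_cancel]⟩

theorem notMem_of_fst (h : IsTrack κ t c) {x : Dart} (hx : ¬ Visited c x.1) :
    x ∉ Set.range c := by
  rintro ⟨i, rfl⟩; exact hx (h.visited_fst i)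

theorem notMem_of_head {x : Dart} (hx : ¬ Visited c (head x)) : x ∉ Set.range c := by
  rintro ⟨i, rfl⟩; exact hx ⟨i, rfl⟩

theorem opp_mem (h : IsTrack κ t c) {x : Dart} (hx : Oriented κ x) (hmem : x ∉ Set.range c)
    (hv : Visited c (head x)) : opp x ∈ Set.range c := by
  obtain ⟨i, hi⟩ := hv
  rcases hx.eq_or_eq_opp (h.oriented i) hi.symm with e | e
  · exact absurd ⟨i, e⟩ hmem
  · exact ⟨i, e⟩

theorem isBalanced (h : IsTrack κ t c) : IsBalanced κ t (Set.range c) := by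
  intro x _
  simp only [h.step_mem_iff]

/-- The colour on each side of the curve is constant. -/
theorem color_eq (h : IsTrack κ t c) {f : ℤ × ℤ → ZMod 2} (hf : IsColoring κ (Set.range c) f)
    (s : ℤˣ) (i j : ℤ) : f (face s (c i)) = f (face s (c j)) :=
  Int.eq_of_forall_eq_pred (g := fun i => f (face s (c i))) (fun i => by
    have e := h.next (i - 1)
    rw [sub_add_cancel] at e
    simp only [e]
    exact hf.step_eq (h.oriented _) h.step_mem_iff.symm s) i j

theorem color_ne (h : IsTrack κ t c) {f : ℤ × ℤ → ZMod 2} (hf : IsColoring κ (Set.range c) f)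
    (s : ℤˣ) (i j : ℤ) : f (face s (c i)) ≠ f (face (-s) (c j)) := by
  rw [h.color_eq hf (-s) j i, (hf _ (h.oriented i) s).1 ⟨i, rfl⟩]
  simp

/-- The dart of `c` that arrives at `head x` is `opp x`, and the rule turns it away from `x`: the
contact is on the side of `c` opposite to the turn. -/
theorem color_of_touch (h : IsTrack κ t c) {f : ℤ × ℤ → ZMod 2}
    (hf : IsColoring κ (Set.range c) f) {x : Dart} (hx : Oriented κ x) (hmem : x ∉ Set.range c)
    (hv : Visited c (head x)) (s : ℤˣ) (i : ℤ) :
    f (face s x) = f (face (-t (head x)) (c i)) := by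
  obtain ⟨j, hj⟩ := h.opp_mem hx hmem hv
  rw [hf.eq_of_notMem hx hmem s (-t (head x)), ← face_turnStep, ← turnStep_opp, ← head_opp x]
  change f (face _ (step t (opp x))) = _
  rw [← hj, ← h.next]
  exact h.color_eq hf _ _ _

theorem turn_eq_of_touch (h : IsTrack κ t c) {f : ℤ × ℤ → ZMod 2}
    (hf : IsColoring κ (Set.range c) f) {x y : Dart} (hx : Oriented κ x) (hy : Oriented κ y)
    (hxm : x ∉ Set.range c) (hym : y ∉ Set.range c) (hxv : Visited c (head x))
    (hyv : Visited c (head y)) {s s' : ℤˣ} (hc : f (face s x) = f (face s' y)) :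
    t (head x) = t (head y) := by
  rw [h.color_of_touch hf hx hxm hxv s 0, h.color_of_touch hf hy hym hyv s' 0] at hc
  rcases Int.units_eq_or_eq_neg (t (head y)) (t (head x)) with e | e
  · exact e
  · rw [e] at hc
    exact absurd hc.symm (h.color_ne hf _ _ _)

/-- The colour is constant along an orbit off `c`, so all its contacts with `c` have the same turn;
four in succession would trace a unit square, a closed orbit. -/
theorem exists_not_visited (h : IsTrack κ t c) {x : Dart} (hx : Oriented κ x)
    (hmem : x ∉ Set.range c) : ∃ k < 4, ¬ Visited c (head ((step t)^[k] x)) := by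
  by_contra! hcon
  obtain ⟨f, hf⟩ := h.isBalanced.exists_coloring
  have key : ∀ k < 4, t (head ((step t)^[k] x)) = t (head x) := by
    intro k hk
    refine h.turn_eq_of_touch hf (hx.iterate t k) hx (mt (h.iterate_mem_iff k).1 hmem) hmem
      (hcon k hk) (hcon 0 (by norm_num)) (s := 1) (s' := 1) ?_
    clear hk
    induction k with
    | zero => rfl
    | succ k ih =>
      rw [Function.iterate_succ_apply', hf.step_eq (hx.iterate t k) h.step_mem_iff.symm, ih]
  have e1 := key 1 (by norm_num)
  have e2 := key 2 (by norm_num)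
  have e3 := key 3 (by norm_num)
  refine h.aperiodic x hx.1 4 (by norm_num) ?_
  simp only [Function.iterate_succ_apply', Function.iterate_zero, id] at e1 e2 e3 ⊢
  rw [show step t (step t (step t (step t x))) = turnStep (t (head x)) (step t (step t (step t x)))
      by rw [← e3]; rfl,
    show step t (step t (step t x)) = turnStep (t (head x)) (step t (step t x)) by rw [← e2]; rfl,
    show step t (step t x) = turnStep (t (head x)) (step t x) by rw [← e1]; rfl]
  exact turnStep_four _ x

/-- A forward orbit which avoids a finite closed set of edges stays outside of it. -/
theorem color_eq_zero (h : IsTrack κ t c) {A : Set Dart} {f : ℤ × ℤ → ZMod 2}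
    (hf : IsColoring κ A f) {R : ℤ} (hR : ∀ F : ℤ × ℤ, R < |F.1| ∨ R < |F.2| → f F = 0)
    {x : Dart} (hx : Oriented κ x) (hA : ∀ k, (step t)^[k] x ∉ A) (s : ℤˣ) :
    f (face s x) = 0 := by
  by_contra hne
  have hconst : ∀ k, f (face s ((step t)^[k] x)) = f (face s x) := by
    intro k
    induction k with
    | zero => rfl
    | succ k ih =>
      have h1 := hA k
      have h2 := hA (k + 1)
      rw [Function.iterate_succ_apply'] at h2 ⊢
      rw [hf.step_eq (hx.iterate t k) (by simp [h1, h2]), ih]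
  -- The infinitely many darts of the orbit would all border squares of nonzero colour, which lie in
  -- a bounded region.
  refine Set.infinite_range_of_injective (h.iterate_injective hx.1)
    ((finite_darts (R + 2)).subset ?_)
  rintro _ ⟨k, rfl⟩
  simp only
  refine ⟨(hx.iterate t k).1, ?_⟩
  have hk : f (face s ((step t)^[k] x)) ≠ 0 := by rw [hconst]; exact hne
  have hb : |(face s ((step t)^[k] x)).1| ≤ R ∧ |(face s ((step t)^[k] x)).2| ≤ R := by
    constructor <;> by_contra! hlt
    · exact hk (hR _ (.inl hlt))
    · exact hk (hR _ (.inr hlt))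
  have hd := (hx.iterate t k).1
  generalize (step t)^[k] x = y at hb hd
  obtain ⟨⟨a, b⟩, d⟩ := y
  simp only [abs_le] at hb ⊢
  rcases hd with e | e | e | e <;> rcases Int.units_eq_one_or s with rfl | rfl <;>
    simp at e <;> subst e <;> simp [face] at hb ⊢ <;> omega

/-- The orbit enters the arc after `c i` and leaves it after `c j`; nothing else changes since the
range of `c` is invariant. -/
theorem arc_balance (h : IsTrack κ t c) {i j : ℤ} (hij : i < j) (y : Dart) :
    (y ∈ c '' Set.Ioc i j ↔ step t y ∈ c '' Set.Ioc i j) ↔ ¬ (y = c i ∨ y = c j) := by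
  have hsub : c '' Set.Ioc i j ⊆ Set.range c := Set.image_subset_range _ _
  by_cases hy : y ∈ Set.range c
  · obtain ⟨k, rfl⟩ := hy
    rw [← h.next, h.injective.mem_set_image, h.injective.mem_set_image, h.injective.eq_iff,
      h.injective.eq_iff, Set.mem_Ioc, Set.mem_Ioc]
    omega
  · have h1 : y ∉ c '' Set.Ioc i j := fun hm => hy (hsub hm)
    have h2 : step t y ∉ c '' Set.Ioc i j := fun hm => hy (h.step_mem_iff.1 (hsub hm))
    simp only [h1, h2, true_iff]
    rintro (rfl | rfl) <;> exact hy ⟨_, rfl⟩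

end IsTrack

/-! ### Connectedness of the exterior along an orbit -/

/-- Lattice points at distance one, both of them in `E`. -/
def LatticeAdj (E : Set (ℤ × ℤ)) (P Q : ℤ × ℤ) : Prop :=
  P ∈ E ∧ Q ∈ E ∧ (Q.1 - P.1) ^ 2 + (Q.2 - P.2) ^ 2 = 1

/-- Connectedness by lattice paths inside `E`. -/
def Conn (E : Set (ℤ × ℤ)) : ℤ × ℤ → ℤ × ℤ → Prop := Relation.ReflTransGen (LatticeAdj E)

theorem Conn.symm {E : Set (ℤ × ℤ)} {P Q : ℤ × ℤ} (h : Conn E P Q) : Conn E Q P :=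
  haveI : Std.Symm (LatticeAdj E) := ⟨fun _ _ h => ⟨h.2.1, h.1, by rw [← h.2.2]; ring⟩⟩
  (Relation.ReflTransGen.stdSymm (r := LatticeAdj E)).symm _ _ h

theorem Conn.trans {E : Set (ℤ × ℤ)} {P Q R : ℤ × ℤ} (h : Conn E P Q) (h' : Conn E Q R) :
    Conn E P R := Relation.ReflTransGen.trans h h'

theorem Conn.refl (E : Set (ℤ × ℤ)) (P : ℤ × ℤ) : Conn E P P := Relation.ReflTransGen.refl

/-- The lattice points which are not visited by `c`. -/
def exterior (c : ℤ → Dart) : Set (ℤ × ℤ) := {z | ¬ Visited c z}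

theorem conn_of_dart {c : ℤ → Dart} {x : Dart} (hx : IsDir x.2) (h₁ : ¬ Visited c x.1)
    (h₂ : ¬ Visited c (head x)) : Conn (exterior c) x.1 (head x) := by
  refine Relation.ReflTransGen.single ⟨h₁, h₂, ?_⟩
  rcases hx with e | e | e | e <;> simp [head, e]

/-- The first lattice point, among the heads of the orbit of `x`, which is not visited by `c`. -/
noncomputable def firstExit (t : ℤ × ℤ → ℤˣ) (c : ℤ → Dart) (x : Dart) : ℤ × ℤ :=
  head ((step t)^[sInf {k | ¬ Visited c (head ((step t)^[k] x))}] x)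

theorem firstExit_of_not_visited (t : ℤ × ℤ → ℤˣ) {c : ℤ → Dart} {x : Dart}
    (hv : ¬ Visited c (head x)) : firstExit t c x = head x := by
  have : sInf {k | ¬ Visited c (head ((step t)^[k] x))} = 0 := Nat.sInf_eq_zero.2 (.inl hv)
  rw [firstExit, this]; rfl

theorem turnStep_four_fst (s : ℤˣ) (x : Dart) :
    head (turnStep s (turnStep s (turnStep s x))) = x.1 :=
  congrArg Prod.fst (turnStep_four s x)

theorem head_ne_fst {x : Dart} (hx : IsDir x.2) : head x ≠ x.1 := by
  intro h
  rcases hx with e | e | e | e <;> simp [head, e] at h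

theorem turnStep_two_ne (s : ℤˣ) {x : Dart} (hx : IsDir x.2) : turnStep s (turnStep s x) ≠ x := by
  intro h
  have := congrArg Prod.snd h
  rcases hx with h' | h' | h' | h' <;> rcases Int.units_eq_one_or s with rfl | rfl <;>
    simp [turnStep, h'] at this

namespace IsTrack

variable {κ : ℤ} {t : ℤ × ℤ → ℤˣ} {c : ℤ → Dart}

/-- By `exists_not_visited` the set of exit times is nonempty, so `sInf` is a true minimum and not
the default `0`; a step lowers it by one. -/
theorem firstExit_of_visited (h : IsTrack κ t c) {x : Dart} (hx : Oriented κ x)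
    (hmem : x ∉ Set.range c) (hv : Visited c (head x)) :
    firstExit t c x = firstExit t c (step t x) := by
  obtain ⟨k, -, hk⟩ := h.exists_not_visited (hx.next t) (mt h.step_mem_iff.1 hmem)
  have hne : {k | ¬ Visited c (head ((step t)^[k] (step t x)))}.Nonempty := ⟨k, hk⟩
  have hne' : {k | ¬ Visited c (head ((step t)^[k] x))}.Nonempty := ⟨k + 1, hk⟩
  have : sInf {k | ¬ Visited c (head ((step t)^[k] x))} =
      sInf {k | ¬ Visited c (head ((step t)^[k] (step t x)))} + 1 := by
    apply le_antisymm
    · exact Nat.sInf_le (by simpa using Nat.sInf_mem hne)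
    · have hm := Nat.sInf_mem hne'
      rcases hj : sInf {k | ¬ Visited c (head ((step t)^[k] x))} with _ | j
      · rw [hj] at hm; exact absurd hv hm
      · rw [hj] at hm
        exact Nat.succ_le_succ (Nat.sInf_le hm)
  rw [firstExit, this, Function.iterate_succ_apply, firstExit]

/-- The exit comes after fewer than four steps. Hence an orbit with bounded exits is bounded, which
is used to prove that components are infinite. -/
theorem firstExit_near (h : IsTrack κ t c) {x : Dart} (hx : Oriented κ x)
    (hmem : x ∉ Set.range c) : |x.1.1 - (firstExit t c x).1| ≤ 4 ∧
      |x.1.2 - (firstExit t c x).2| ≤ 4 := by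
  have hlt : sInf {k | ¬ Visited c (head ((step t)^[k] x))} < 4 := by
    obtain ⟨k, hk4, hk⟩ := h.exists_not_visited hx hmem
    exact (Nat.sInf_le hk).trans_lt hk4
  have key : ∀ k : ℕ, |x.1.1 - (head ((step t)^[k] x)).1| ≤ k + 1 ∧
      |x.1.2 - (head ((step t)^[k] x)).2| ≤ k + 1 := by
    intro k
    induction k with
    | zero => rcases hx.1 with e | e | e | e <;> simp [head, e]
    | succ k ih =>
      have hd := (hx.iterate t (k + 1)).1
      rw [Function.iterate_succ_apply'] at hd ⊢
      have e1 : (head (step t ((step t)^[k] x))) =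
        head ((step t)^[k] x) + (step t ((step t)^[k] x)).2 := rfl
      rw [e1]
      simp only [abs_le] at ih ⊢
      rcases hd with e | e | e | e <;> rw [e] <;> simp <;> omega
  have := key (sInf {k | ¬ Visited c (head ((step t)^[k] x))})
  unfold firstExit
  constructor
  · exact this.1.trans (by exact_mod_cast hlt)
  · exact this.2.trans (by exact_mod_cast hlt)

/-- If two opposite corners of a square are unvisited and its two other corners are visited,
then the orbit which turns around the square cannot separate the latter from each other. -/
theorem false_of_loop (h : IsTrack κ t c) {x y₁ y₂ y₃ : Dart} (hx : Oriented κ x) (s : ℤˣ)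
    (hy₁ : turnStep s x = y₁) (hy₂ : turnStep s y₁ = y₂) (hy₃ : turnStep s y₂ = y₃)
    (t₀ : t (head x) = s) (t₁ : t (head y₁) = s) (t₂ : t (head y₂) = s) (t₃ : t x.1 = -s)
    (v₀ : ¬ Visited c x.1) (v₂ : ¬ Visited c (head y₁)) {m n : ℤ} (hmn : m < n)
    (hends : (c m = opp x ∧ c n = opp y₂) ∨ (c n = opp x ∧ c m = opp y₂)) : False := by
  have o₁ : Oriented κ y₁ := hy₁ ▸ hx.turn s
  have o₂ : Oriented κ y₂ := hy₂ ▸ o₁.turn s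
  have o₃ : Oriented κ y₃ := hy₃ ▸ o₂.turn s
  have hh₃ : head y₃ = x.1 := by rw [← hy₃, ← hy₂, ← hy₁, turnStep_four_fst]
  have hx₄ : turnStep s y₃ = x := by rw [← hy₃, ← hy₂, ← hy₁, turnStep_four]
  -- `p` is the predecessor of `x`: as the rule turns by `-s` at `x.1`, the orbit leaves the square
  -- after `y₃` instead of closing up.
  obtain ⟨p, hp⟩ : ∃ p, p = opp y₃ := ⟨_, rfl⟩
  have op : Oriented κ p := hp ▸ o₃.opp
  have hhp : head p = x.1 := by rw [hp, head_opp, hh₃]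
  have s₀ : step t x = y₁ := by rw [step, t₀, hy₁]
  have s₁ : step t y₁ = y₂ := by rw [step, t₁, hy₂]
  have s₂ : step t y₂ = y₃ := by rw [step, t₂, hy₃]
  have sp : step t p = x := by
    rw [step, hhp, t₃, hp, turnStep_opp, neg_neg, hx₄]
  obtain ⟨u, hu⟩ : ∃ u, u = step t y₃ := ⟨_, rfl⟩
  have hu' : u = turnStep (-s) y₃ := by rw [hu, step, hh₃, t₃]
  have f₁ : y₁.1 = head x := by rw [← hy₁]; rfl
  have f₂ : y₂.1 = head y₁ := by rw [← hy₂]; rfl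
  have f₃ : y₃.1 = head y₂ := by rw [← hy₃]; rfl
  have n₀ : x ∉ Set.range c := h.notMem_of_fst v₀
  have n₁ : y₁ ∉ Set.range c := notMem_of_head v₂
  have n₂ : y₂ ∉ Set.range c := h.notMem_of_fst (by rwa [f₂])
  have n₃ : y₃ ∉ Set.range c := notMem_of_head (by rwa [hh₃])
  have np : p ∉ Set.range c := notMem_of_head (by rwa [hhp])
  have d₀₂ : y₂ ≠ x := by rw [← hy₂, ← hy₁]; exact turnStep_two_ne s hx.1
  have d₁₃ : y₃ ≠ y₁ := by rw [← hy₃, ← hy₂]; exact turnStep_two_ne s o₁.1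
  have d₀₁ : y₁ ≠ x := fun e => head_ne_fst hx.1 (by rw [← f₁, e])
  have d₁₂ : y₂ ≠ y₁ := fun e => head_ne_fst o₁.1 (by rw [← f₂, e])
  have d₂₃ : y₃ ≠ y₂ := fun e => head_ne_fst o₂.1 (by rw [← f₃, e])
  have d₀₃ : x ≠ y₃ := fun e => head_ne_fst o₃.1 (by rw [hh₃, ← e])
  have dp₀ : p ≠ x := fun e => head_ne_fst hx.1 (by rw [← e, hhp, e])
  have dp₃ : p ≠ y₃ := hp ▸ opp_ne o₃.1
  -- The arc of `c` between the two visited corners, closed up by the two sides `y₃` and `x` of the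
  -- square through `x.1`.
  obtain ⟨A, hA⟩ : ∃ A : Set Dart, A = c '' Set.Ioc m n ∪ {y₃, x} := ⟨_, rfl⟩
  have hsub : c '' Set.Ioc m n ⊆ Set.range c := Set.image_subset_range _ _
  have memA : ∀ y, y ∉ Set.range c → (y ∈ A ↔ y = y₃ ∨ y = x) := by
    intro y hy
    have : y ∉ c '' Set.Ioc m n := fun hm => hy (hsub hm)
    simp [hA, this]
  have memA' : ∀ y, y ∈ Set.range c → (y ∈ A ↔ y ∈ c '' Set.Ioc m n) := by
    intro y hy
    have h1 : y ≠ y₃ := fun e => n₃ (e ▸ hy)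
    have h2 : y ≠ x := fun e => n₀ (e ▸ hy)
    simp [hA, h1, h2]
  -- Membership changes exactly after three pairs of opposite darts, one pair at each of the corners
  -- `head x`, `head y₂` and `x.1`; hence `A` is balanced.
  have bal : ∀ y, (y ∈ A ↔ step t y ∈ A) ↔
      ¬ ((y = x ∨ y = opp x) ∨ (y = y₂ ∨ y = opp y₂) ∨ (y = y₃ ∨ y = p)) := by
    intro y
    by_cases hy : y ∈ Set.range c
    · rw [memA' y hy, memA' _ (h.step_mem_iff.2 hy), h.arc_balance hmn]
      have h1 : y ≠ y₃ := fun e => n₃ (e ▸ hy)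
      have h2 : y ≠ x := fun e => n₀ (e ▸ hy)
      have h3 : y ≠ y₂ := fun e => n₂ (e ▸ hy)
      have h4 : y ≠ p := fun e => np (e ▸ hy)
      rcases hends with ⟨e1, e2⟩ | ⟨e1, e2⟩ <;> simp only [e1, e2] <;> tauto
    · rw [memA y hy, memA _ (mt h.step_mem_iff.1 hy)]
      have e1 : step t y = y₃ ↔ y = y₂ := by rw [← s₂, (step_injective t).eq_iff]
      have e2 : step t y = x ↔ y = p := by
        conv_lhs => rw [← sp]
        rw [(step_injective t).eq_iff]
      rw [e1, e2]
      have h1 : y ≠ opp x := by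
        rintro rfl
        rcases hends with ⟨e, -⟩ | ⟨e, -⟩ <;> exact hy ⟨_, e⟩
      have h2 : y ≠ opp y₂ := by
        rintro rfl
        rcases hends with ⟨-, e⟩ | ⟨-, e⟩ <;> exact hy ⟨_, e⟩
      by_cases k0 : y = x
      · subst k0; simp [Ne.symm d₀₂, Ne.symm dp₀]
      by_cases k2 : y = y₂
      · simp [k2, Ne.symm d₂₃, d₀₂]
      by_cases k3 : y = y₃
      · simp [k3, d₂₃, Ne.symm dp₃]
      simp only [k0, k2, k3, h1, h2]
      tauto
  have oppeq : ∀ y z : Dart, opp y = z ↔ y = opp z := fun y z =>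
    ⟨fun e => by rw [← e, opp_opp], fun e => by rw [e, opp_opp]⟩
  have hbal : IsBalanced κ t A := by
    intro y _
    have hpp : opp p = y₃ := by rw [hp, opp_opp]
    have e1 := oppeq y x
    have e2 : opp y = opp x ↔ y = x := by rw [oppeq, opp_opp]
    have e3 := oppeq y y₂
    have e4 : opp y = opp y₂ ↔ y = y₂ := by rw [oppeq, opp_opp]
    have e5 : opp y = y₃ ↔ y = p := by rw [oppeq, hp]
    have e6 : opp y = p ↔ y = y₃ := by rw [oppeq, hpp]
    rw [bal, bal, e1, e2, e3, e4, e5, e6, or_comm (a := y = x), or_comm (a := y = y₂),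
      or_comm (a := y = y₃)]
  have hfin : A.Finite := hA ▸ ((Set.finite_Ioc m n).image c).union (by simp)
  obtain ⟨f, hf, R, hR⟩ := hbal.exists_finite_coloring hfin
  have y3A : y₃ ∈ A := by simp [hA]
  have xA : x ∈ A := by simp [hA]
  have hy2 : y₂ = (step t)^[2] x := by
    simp only [Function.iterate_succ_apply', Function.iterate_zero, id, s₀, s₁]
  have hy3 : y₃ = (step t)^[3] x := by
    simp only [Function.iterate_succ_apply', Function.iterate_zero, id, s₀, s₁, s₂]
  have hu4 : u = (step t)^[4] x := by
    simp only [Function.iterate_succ_apply', Function.iterate_zero, id, s₀, s₁, s₂, hu]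
  -- The orbit after `y₃` never comes back to `x` or `y₃`, so it is outside the loop.
  have hu0 : ∀ σ, f (face σ u) = 0 := by
    rw [hu]
    refine h.color_eq_zero hf hR (o₃.next t) fun k hk => ?_
    rw [← hu] at hk
    have hkc : (step t)^[k] u ∉ Set.range c := by
      rw [h.iterate_mem_iff, hu]; exact mt h.step_mem_iff.1 n₃
    rcases (memA _ hkc).1 hk with e | e
    · rw [hu4, hy3, ← Function.iterate_add_apply] at e
      have := h.iterate_injective hx.1 (a₁ := k + 4) (a₂ := 3) e
      omega
    · rw [hu4, ← Function.iterate_add_apply] at e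
      exact h.aperiodic x hx.1 _ (by omega) e
  -- Crossing `y₃` from there leads into the square, which is thus inside the loop; crossing `x`
  -- leads out again, to the squares along `p`.
  have hF : f (face s x) = 1 := by
    rw [← congrArg (face s) hx₄, face_turnStep, (hf _ o₃ s).1 y3A, ← face_turnStep, ← hu', hu0, zero_add]
  have pA : p ∉ A := by rw [memA p np]; simp [dp₀, dp₃]
  have hp0 : f (face 1 p) = 0 := by
    have e := (hf x hx s).1 xA
    rw [hF] at e
    rw [hf.eq_of_notMem op pA 1 (-s), ← face_turnStep, hp, turnStep_opp, neg_neg, hx₄]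
    simpa using e.symm
  have y1A : y₁ ∉ A := by rw [memA _ n₁]; simp [d₀₁, Ne.symm d₁₃]
  -- The other outgoing dart `w` at the unvisited corner `head y₁` starts inside the loop. Its orbit
  -- cannot reach `x`, whose predecessor `p` is outside; so it also misses `y₁`, `y₂`, `y₃` and
  -- stays inside forever, which `color_eq_zero` forbids.
  obtain ⟨w, hw⟩ : ∃ w, w = turnStep (-s) y₁ := ⟨_, rfl⟩
  have fw : w.1 = head y₁ := by rw [hw]; rfl
  have ow : Oriented κ w := hw ▸ o₁.turn _
  have nw : w ∉ Set.range c := h.notMem_of_fst (by rwa [fw])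
  have key : ∀ k, (step t)^[k] w ∉ Set.range c ∧ ((step t)^[k] w ≠ x ∧ (step t)^[k] w ≠ y₁ ∧
      (step t)^[k] w ≠ y₂ ∧ (step t)^[k] w ≠ y₃) ∧ f (face 1 ((step t)^[k] w)) = 1 := by
    intro k
    have nk : (step t)^[k] w ∉ Set.range c := by rwa [h.iterate_mem_iff]
    refine ⟨nk, ?_⟩
    induction k with
    | zero =>
      simp only [Function.iterate_zero, id]
      have f1 : w ≠ x := fun e => by
        rcases o₁.eq_or_eq_opp o₃ (by rw [← fw, e, hh₃]) with e3 | e3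
        · exact d₁₃ e3
        · have e4 := congrArg (turnStep (-s)) e3
          rw [turnStep_opp, neg_neg, hy₂, ← hu', hu4, hy2] at e4
          have := h.iterate_injective hx.1 (a₁ := 4) (a₂ := 2) e4
          omega
      have f2 : w ≠ y₁ := fun e => head_ne_fst o₁.1 (by rw [← fw, e])
      have f3 : w ≠ y₂ := by rw [hw, ← hy₂]; exact (turnStep_ne s o₁.1).symm
      have f4 : w ≠ y₃ := fun e => head_ne_fst o₂.1 (by rw [← f₃, ← e, fw, f₂])
      refine ⟨⟨f1, f2, f3, f4⟩, ?_⟩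
      have wA : w ∉ A := by rw [memA _ nw]; simp [f1, f4]
      rw [hf.eq_of_notMem ow wA 1 (-s), hw, face_turnStep, hf.eq_of_notMem o₁ y1A (-s) s, ← hy₁,
        face_turnStep, hF]
    | succ k ih =>
      have nk' : (step t)^[k] w ∉ Set.range c := by rwa [h.iterate_mem_iff]
      obtain ⟨⟨g0, g1, g2, g3⟩, gf⟩ := ih nk'
      rw [Function.iterate_succ_apply'] at nk ⊢
      have f0 : step t ((step t)^[k] w) ≠ x := fun e => by
        have : (step t)^[k] w = p := step_injective t (by rw [e, sp])
        rw [this, hp0] at gf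
        exact zero_ne_one gf
      have f1 : step t ((step t)^[k] w) ≠ y₁ := fun e => g0 (step_injective t (by rw [e, s₀]))
      have f2 : step t ((step t)^[k] w) ≠ y₂ := fun e => g1 (step_injective t (by rw [e, s₁]))
      have f3 : step t ((step t)^[k] w) ≠ y₃ := fun e => g2 (step_injective t (by rw [e, s₂]))
      refine ⟨⟨f0, f1, f2, f3⟩, ?_⟩
      have a1 : (step t)^[k] w ∉ A := by rw [memA _ nk']; simp [g0, g3]
      have a2 : step t ((step t)^[k] w) ∉ A := by rw [memA _ nk]; simp [f0, f3]
      rw [hf.step_eq (ow.iterate t k) (by simp [a1, a2]), gf]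
  have := h.color_eq_zero hf hR ow (fun k hk => by
    obtain ⟨nk, ⟨g0, -, -, g3⟩, -⟩ := key k
    rcases (memA _ nk).1 hk with e | e
    · exact g3 e
    · exact g0 e) 1
  rw [show f (face 1 w) = 1 from (key 0).2.2] at this
  exact one_ne_zero this

/-- If three corners of a square, two of them opposite, are as below, then the fourth one is not
visited. -/
theorem not_visited_corner (h : IsTrack κ t c) {x : Dart} (hx : Oriented κ x) {s : ℤˣ}
    (hs : t (head x) = s) (v₀ : ¬ Visited c x.1) (v₁ : Visited c (head x))
    (v₂ : ¬ Visited c (head (turnStep s x))) :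
    ¬ Visited c (head (turnStep s (turnStep s x))) := by
  intro v₃
  obtain ⟨f, hf⟩ := h.isBalanced.exists_coloring
  have o₂ : Oriented κ (turnStep s (turnStep s x)) := (hx.turn s).turn s
  have n₀ : x ∉ Set.range c := h.notMem_of_fst v₀
  have n₂ : turnStep s (turnStep s x) ∉ Set.range c := h.notMem_of_fst v₂
  -- Both visited corners are touched from the same square, so the rule has the same value there.
  have t₂ : t (head (turnStep s (turnStep s x))) = s := by
    refine (h.turn_eq_of_touch hf o₂ hx n₂ n₀ v₃ v₁ (s := s) (s' := s) ?_).trans hs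
    rw [face_turnStep, face_turnStep]
  obtain ⟨m, hm⟩ := h.opp_mem hx n₀ v₁
  obtain ⟨n, hn⟩ := h.opp_mem o₂ n₂ v₃
  have hne : m ≠ n := by
    rintro rfl
    rw [hm] at hn
    have := congrArg opp hn
    rw [opp_opp, opp_opp] at this
    exact turnStep_two_ne s hx.1 this.symm
  have hx₄ : turnStep s (turnStep s (turnStep s (turnStep s x))) = x := turnStep_four s x
  have hd₀ := head_turnStep_turnStep hx.1 s s
  have hd₁ := head_turnStep_turnStep (isDir_turnStep hx.1 s) s s
  rw [turnStep_four_fst] at hd₁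
  obtain ⟨e, he⟩ := h.flips
  rcases Int.emod_two_eq_zero_or_one ((head x).1 + (head x).2 - e) with hpar | hpar
  -- The unvisited corners are in the class where diagonal neighbours have opposite turns; the loop
  -- is taken from the one with turn `-s`.
  · have hpar' : (x.1.1 + x.1.2 - e) % 2 = 1 := by
      rcases hx.1 with k | k | k | k <;> simp [head, k] at hpar <;> omega
    have hpar'' : ((head (turnStep s x)).1 + (head (turnStep s x)).2 - e) % 2 = 1 := by omega
    have hneg := he.eq_neg hpar'' hd₁.1 hd₁.2
    rcases Int.units_eq_or_eq_neg s (t (head (turnStep s x))) with t₁ | t₁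
    · rw [t₁] at hneg
      rcases lt_or_gt_of_ne hne with hlt | hlt
      · exact h.false_of_loop hx s rfl rfl rfl hs t₁ t₂ hneg v₀ v₂ hlt (.inl ⟨hm, hn⟩)
      · exact h.false_of_loop hx s rfl rfl rfl hs t₁ t₂ hneg v₀ v₂ hlt (.inr ⟨hm, hn⟩)
    · rw [t₁, neg_neg] at hneg
      rw [← hx₄] at hm
      have a₁ : t (head (turnStep s (turnStep s (turnStep s x)))) = s := by
        rw [turnStep_four_fst, hneg]
      have a₂ : t (head (turnStep s (turnStep s (turnStep s (turnStep s x))))) = s := by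
        rw [hx₄, hs]
      have a₃ : ¬ Visited c (head (turnStep s (turnStep s (turnStep s x)))) := by
        rwa [turnStep_four_fst]
      rcases lt_or_gt_of_ne hne with hlt | hlt
      · exact h.false_of_loop o₂ s rfl rfl rfl t₂ a₁ a₂ t₁ v₂ a₃ hlt (.inr ⟨hn, hm⟩)
      · exact h.false_of_loop o₂ s rfl rfl rfl t₂ a₁ a₂ t₁ v₂ a₃ hlt (.inl ⟨hn, hm⟩)
  -- Otherwise the visited corners would have opposite turns, against `t₂`.
  · have := he.eq_neg hpar hd₀.1 hd₀.2
    rw [t₂, hs] at this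
    revert this
    rcases Int.units_eq_one_or s with rfl | rfl <;> decide

/-- While the heads are visited, the orbit runs around one square with a constant turn, so it exits
at a corner of this square. If that is the corner opposite to `x.1`, the path goes through the
fourth corner by `not_visited_corner`. -/
theorem conn_firstExit (h : IsTrack κ t c) {x : Dart} (hx : Oriented κ x)
    (v₀ : ¬ Visited c x.1) : Conn (exterior c) (firstExit t c x) x.1 := by
  obtain ⟨f, hf⟩ := h.isBalanced.exists_coloring
  have n₀ : x ∉ Set.range c := h.notMem_of_fst v₀
  by_cases v₁ : Visited c (head x)
  swap
  · rw [firstExit_of_not_visited t v₁]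
    exact (conn_of_dart hx.1 v₀ v₁).symm
  obtain ⟨s, hs⟩ : ∃ s, t (head x) = s := ⟨_, rfl⟩
  have s₀ : step t x = turnStep s x := by rw [step, hs]
  have o₁ := hx.turn s
  have o₂ := o₁.turn s
  have o₃ := o₂.turn s
  have hx₄ : turnStep s (turnStep s (turnStep s (turnStep s x))) = x := turnStep_four s x
  have hh₃ := turnStep_four_fst s x
  have n₁ : turnStep s x ∉ Set.range c := by rw [← s₀]; exact mt h.step_mem_iff.1 n₀
  rw [h.firstExit_of_visited hx n₀ v₁, s₀]
  by_cases v₂ : Visited c (head (turnStep s x))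
  swap
  · rw [firstExit_of_not_visited t v₂]
    have v₃ := h.not_visited_corner hx hs v₀ v₁ v₂
    refine (conn_of_dart o₂.1 v₂ v₃).trans ?_
    have := conn_of_dart o₃.1 v₃ (by rwa [hh₃])
    rwa [hh₃] at this
  have t₁ : t (head (turnStep s x)) = s := by
    exact (h.turn_eq_of_touch hf o₁ hx n₁ n₀ v₂ v₁ (s := s) (s' := s)
      (by rw [face_turnStep])).trans hs
  have s₁ : step t (turnStep s x) = turnStep s (turnStep s x) := by rw [step, t₁]
  have n₂ : turnStep s (turnStep s x) ∉ Set.range c := by rw [← s₁]; exact mt h.step_mem_iff.1 n₁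
  rw [h.firstExit_of_visited o₁ n₁ v₂, s₁]
  by_cases v₃ : Visited c (head (turnStep s (turnStep s x)))
  swap
  · rw [firstExit_of_not_visited t v₃]
    have := conn_of_dart o₃.1 v₃ (by rwa [hh₃])
    rwa [hh₃] at this
  have t₂ : t (head (turnStep s (turnStep s x))) = s := by
    exact (h.turn_eq_of_touch hf o₂ o₁ n₂ n₁ v₃ v₂ (s := s) (s' := s)
      (by rw [face_turnStep])).trans t₁
  have s₂ : step t (turnStep s (turnStep s x)) = turnStep s (turnStep s (turnStep s x)) := by
    rw [step, t₂]
  rw [h.firstExit_of_visited o₂ n₂ v₃, s₂, firstExit_of_not_visited t (by rwa [hh₃]), hh₃]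
  exact Conn.refl _ _

theorem conn_firstExit_step (h : IsTrack κ t c) {x : Dart} (hx : Oriented κ x)
    (hmem : x ∉ Set.range c) :
    Conn (exterior c) (firstExit t c x) (firstExit t c (step t x)) := by
  by_cases hv : Visited c (head x)
  · rw [h.firstExit_of_visited hx hmem hv]; exact Conn.refl _ _
  · rw [firstExit_of_not_visited t hv]
    exact (h.conn_firstExit (hx.next t) hv).symm

end IsTrack

/-! ### The two sides of the curve -/

/-- The alternating orientation makes the boundary of each square a directed cycle. -/
theorem Oriented.eq_of_face_eq {κ : ℤ} {x y : Dart} (hx : Oriented κ x) (hy : Oriented κ y)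
    (s : ℤˣ) (h : face s x = face s y) :
    y = x ∨ y = turnStep s x ∨ y = turnStep s (turnStep s x) ∨
      y = turnStep s (turnStep s (turnStep s x)) := by
  obtain ⟨⟨a, b⟩, d⟩ := x
  obtain ⟨⟨a', b'⟩, d'⟩ := y
  obtain ⟨hd, hp⟩ := hx
  obtain ⟨hd', hp'⟩ := hy
  rcases hd with h1 | h1 | h1 | h1 <;> rcases hd' with h2 | h2 | h2 | h2 <;>
    rcases Int.units_eq_one_or s with rfl | rfl <;>
    simp at h1 h2 <;> subst h1 h2 <;> simp [face, turnStep] at h hp hp' ⊢ <;> omega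

/-- On the side `s` of the dart `x`, there is an unvisited lattice point which is connected to
`P` in the exterior of `c`. -/
def SideLeadsTo (κ : ℤ) (t : ℤ × ℤ → ℤˣ) (c : ℤ → Dart) (s : ℤˣ) (F P : ℤ × ℤ) : Prop :=
  ∃ y, Oriented κ y ∧ face s y = F ∧ y ∉ Set.range c ∧ Conn (exterior c) (firstExit t c y) P

namespace IsTrack

variable {κ : ℤ} {t : ℤ × ℤ → ℤˣ} {c : ℤ → Dart}

/-- At a visited head where the rule turns by `-s`, the dart `turnStep s x` would continue `opp x`,
which is on `c`. Otherwise an orbit step or a common exterior point makes the connection. -/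
theorem conn_turnStep (h : IsTrack κ t c) {x : Dart} (hx : Oriented κ x) (s : ℤˣ)
    (hxm : x ∉ Set.range c) (hm : turnStep s x ∉ Set.range c) :
    Conn (exterior c) (firstExit t c x) (firstExit t c (turnStep s x)) := by
  by_cases hv : Visited c (head x)
  · rcases Int.units_eq_or_eq_neg s (t (head x)) with e | e
    · have := h.conn_firstExit_step hx hxm
      rwa [step, e] at this
    · have h1 := h.opp_mem hx hxm hv
      rw [← h.step_mem_iff, step, head_opp, e, turnStep_opp, neg_neg] at h1
      exact absurd h1 hm
  · rw [firstExit_of_not_visited t hv]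
    exact (h.conn_firstExit (hx.turn s) hv).symm

/-- If a third side of the square is off `c`, go through it. If not, membership changes at all four
corners, so all turns are `-s`, whereas one pair of diagonal corners has opposite turns. -/
theorem conn_turnStep_two (h : IsTrack κ t c) {x : Dart} (hx : Oriented κ x) (s : ℤˣ)
    (hxm : x ∉ Set.range c) (hm : turnStep s (turnStep s x) ∉ Set.range c) :
    Conn (exterior c) (firstExit t c x) (firstExit t c (turnStep s (turnStep s x))) := by
  have o₁ := hx.turn s
  have o₂ := o₁.turn s
  have o₃ := o₂.turn s
  have hx₄ : turnStep s (turnStep s (turnStep s (turnStep s x))) = x := turnStep_four s x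
  by_cases h1 : turnStep s x ∈ Set.range c
  swap
  · exact (h.conn_turnStep hx s hxm h1).trans (h.conn_turnStep o₁ s h1 hm)
  by_cases h3 : turnStep s (turnStep s (turnStep s x)) ∈ Set.range c
  swap
  · have := (h.conn_turnStep o₂ s hm h3).trans (h.conn_turnStep o₃ s h3 (by rwa [hx₄]))
    rw [hx₄] at this
    exact this.symm
  exfalso
  have key : ∀ y, ¬ (y ∈ Set.range c ↔ turnStep s y ∈ Set.range c) → t (head y) = -s := by
    intro y hy
    rcases Int.units_eq_or_eq_neg s (t (head y)) with e | e
    · rw [← h.step_mem_iff (x := y), step, e] at hy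
      exact absurd Iff.rfl hy
    · exact e
  have k₀ := key x (by simp only [hxm, h1]; decide)
  have k₁ := key (turnStep s x) (by simp only [hm, h1]; decide)
  have k₂ := key (turnStep s (turnStep s x)) (by simp only [hm, h3]; decide)
  have k₃ := key (turnStep s (turnStep s (turnStep s x))) (by rw [hx₄]; simp only [hxm, h3]; decide)
  obtain ⟨e, he⟩ := h.flips
  have hd₀ := head_turnStep_turnStep hx.1 s s
  have hd₁ := head_turnStep_turnStep (isDir_turnStep hx.1 s) s s
  rcases Int.emod_two_eq_zero_or_one ((head x).1 + (head x).2 - e) with hpar | hpar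
  · have hpar' : ((head (turnStep s x)).1 + (head (turnStep s x)).2 - e) % 2 = 1 := by
      have e1 : head (turnStep s x) = head x + (turnStep s x).2 := rfl
      rw [e1]
      rcases o₁.1 with k | k | k | k <;> rw [k] <;> simp <;> omega
    have := he.eq_neg hpar' hd₁.1 hd₁.2
    rw [k₁, k₃] at this
    revert this
    rcases Int.units_eq_one_or s with rfl | rfl <;> decide
  · have := he.eq_neg hpar hd₀.1 hd₀.2
    rw [k₀, k₂] at this
    revert this
    rcases Int.units_eq_one_or s with rfl | rfl <;> decide

theorem conn_of_face_eq (h : IsTrack κ t c) {x y : Dart} (hx : Oriented κ x) (hy : Oriented κ y)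
    (s : ℤˣ) (hf : face s x = face s y) (hxm : x ∉ Set.range c) (hym : y ∉ Set.range c) :
    Conn (exterior c) (firstExit t c x) (firstExit t c y) := by
  rcases hx.eq_of_face_eq hy s hf with rfl | rfl | rfl | rfl
  · exact Conn.refl _ _
  · exact h.conn_turnStep hx s hxm hym
  · exact h.conn_turnStep_two hx s hxm hym
  · have := h.conn_turnStep (((hx.turn s).turn s).turn s) s hym (by rwa [turnStep_four])
    rw [turnStep_four] at this
    exact this.symm

theorem conn_of_sideLeadsTo (h : IsTrack κ t c) {s : ℤˣ} {F P Q : ℤ × ℤ}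
    (hP : SideLeadsTo κ t c s F P) (hQ : SideLeadsTo κ t c s F Q) : Conn (exterior c) P Q := by
  obtain ⟨x, hx, hxF, hxm, hxP⟩ := hP
  obtain ⟨y, hy, hyF, hym, hyQ⟩ := hQ
  exact (hxP.symm.trans (h.conn_of_face_eq hx hy s (hxF.trans hyF.symm) hxm hym)).trans hyQ

/-- The arc of `c` between two visits of the same lattice point is closed. -/
theorem arc_isBalanced (h : IsTrack κ t c) {i j : ℤ} (hij : i < j) (ho : c j = opp (c i)) :
    IsBalanced κ t (c '' Set.Ioc i j) := by
  intro y _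
  have e1 : opp y = c i ↔ y = c j := by
    rw [ho]; exact ⟨fun e => by rw [← e, opp_opp], fun e => by rw [e, opp_opp]⟩
  have e2 : opp y = c j ↔ y = c i := by
    rw [ho]; exact ⟨fun e => by rw [← opp_opp y, e, opp_opp], fun e => by rw [e]⟩
  rw [h.arc_balance hij, h.arc_balance hij, e1, e2, or_comm]

/-- A dart off `c` has an infinite orbit that never meets `c`, so closed arcs of `c` cannot enclose
it. -/
theorem color_eq_zero_of_sideLeadsTo (h : IsTrack κ t c) {A : Set Dart} (hA : A ⊆ Set.range c)
    {f : ℤ × ℤ → ZMod 2} (hf : IsColoring κ A f) {R : ℤ}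
    (hR : ∀ F : ℤ × ℤ, R < |F.1| ∨ R < |F.2| → f F = 0) {s : ℤˣ} {F P : ℤ × ℤ}
    (hP : SideLeadsTo κ t c s F P) : f F = 0 := by
  obtain ⟨x, hx, rfl, hxm, -⟩ := hP
  exact h.color_eq_zero hf hR hx (fun k hk => hxm ((h.iterate_mem_iff k).1 (hA hk))) s

/-- Where `c` turns away from the side `s`, the other strand passes from the square after the turn
to the square before it. -/
theorem sideLeadsTo_succ (h : IsTrack κ t c) {s : ℤˣ} {i : ℤ} {P : ℤ × ℤ}
    (hs : t (head (c i)) = -s) (hm : opp (c i) ∉ Set.range c)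
    (hP : SideLeadsTo κ t c s (face s (c i)) P) :
    SideLeadsTo κ t c s (face s (c (i + 1))) P := by
  have hb : Oriented κ (opp (c i)) := (h.oriented i).opp
  have hstep : step t (opp (c i)) = turnStep s (c i) := by
    rw [step, head_opp, hs, turnStep_opp, neg_neg]
  refine ⟨opp (c i), hb, ?_, hm, (h.conn_firstExit_step hb hm).trans ?_⟩
  · rw [face_opp, h.next, step, hs]
  · refine h.conn_of_sideLeadsTo (s := s) (F := face s (c i))
      ⟨_, hb.next t, ?_, mt h.step_mem_iff.1 hm, Conn.refl _ _⟩ hP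
    rw [hstep, face_turnStep]

/-- All the unvisited lattice points which are reached from the same side of the curve are
connected. -/
theorem conn_of_side_add (h : IsTrack κ t c) {s : ℤˣ} (n : ℕ) {i : ℤ} {P Q : ℤ × ℤ}
    (hP : SideLeadsTo κ t c s (face s (c i)) P)
    (hQ : SideLeadsTo κ t c s (face s (c (i + n))) Q) : Conn (exterior c) P Q := by
  -- Strong induction, because a closed arc of `c` is skipped in a single move.
  induction n using Nat.strong_induction_on generalizing i P with
  | _ n ih =>
  rcases Nat.eq_zero_or_pos n with rfl | hn
  · rw [Nat.cast_zero, add_zero] at hQ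
    exact h.conn_of_sideLeadsTo hP hQ
  have hnext : ∀ {R}, SideLeadsTo κ t c s (face s (c (i + 1))) R → Conn (exterior c) R Q := by
    intro R hR
    refine ih (n - 1) (by omega) hR ?_
    rwa [Nat.cast_sub hn, Nat.cast_one, add_assoc, add_sub_cancel]
  rcases Int.units_eq_or_eq_neg s (t (head (c i))) with hs | hs
  · refine hnext ?_
    rwa [h.next, step, hs, face_turnStep]
  by_cases hm : opp (c i) ∈ Set.range c
  swap
  · exact hnext (h.sideLeadsTo_succ hs hm hP)
  obtain ⟨m, hm⟩ := hm
  have hne : m ≠ i := by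
    rintro rfl
    exact opp_ne (h.oriented m).1 hm.symm
  have hface : face (-s) (c (i + 1)) = face (-s) (c i) := by rw [h.next, step, hs, face_turnStep]
  rcases lt_or_gt_of_ne hne with hlt | hlt
  · -- the curve comes back from a closed arc which contains the side in its interior
    exfalso
    have hsub : c '' Set.Ioc m i ⊆ Set.range c := Set.image_subset_range _ _
    obtain ⟨f, hf, R, hR⟩ := (h.arc_isBalanced hlt (by rw [hm, opp_opp])).exists_finite_coloring
      ((Set.finite_Ioc m i).image c)
    have h0 := h.color_eq_zero_of_sideLeadsTo hsub hf hR hP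
    -- The curve never meets the arc again, so its side `-s` after `c i` is outside as well; but
    -- colours differ across `c i`.
    have h1 : f (face (-s) (c (i + 1))) = 0 := by
      refine h.color_eq_zero hf hR (h.oriented _) (fun k => ?_) _
      have : (step t)^[k] (c (i + 1)) = c (i + 1 + k) := by
        induction k with
        | zero => simp
        | succ k ih =>
          rw [Function.iterate_succ_apply', ih, ← h.next]
          congr 1; push_cast; ring
      rw [this, h.injective.mem_set_image, Set.mem_Ioc]
      omega
    rw [(hf _ (h.oriented i) s).1 ((h.injective.mem_set_image).2 ⟨hlt, le_rfl⟩), ← hface, h1] at h0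
    simp at h0
  · have hsub : c '' Set.Ioc i m ⊆ Set.range c := Set.image_subset_range _ _
    obtain ⟨f, hf, R, hR⟩ := (h.arc_isBalanced hlt hm).exists_finite_coloring
      ((Set.finite_Ioc i m).image c)
    have h0 := h.color_eq_zero_of_sideLeadsTo hsub hf hR hP
    -- From `c (i + 1)` to `c m`, the side `s` faces the interior of the loop, from which no
    -- exterior point is reached.
    have h1 : ∀ k : ℕ, i + 1 + k ≤ m → f (face s (c (i + 1 + k))) = 1 := by
      intro k
      induction k with
      | zero =>
        intro _
        simp only [Nat.cast_zero, add_zero]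
        rw [(hf _ (h.oriented _) s).1 ((h.injective.mem_set_image).2 ⟨by omega, by omega⟩), hface,
          ← (hf _ (h.oriented i) s).2 (by rw [h.injective.mem_set_image]; simp), h0, zero_add]
      | succ k ih =>
        intro hk
        push_cast at hk ⊢
        rw [← ih (by omega), ← add_assoc, h.next]
        refine hf.step_eq (h.oriented _) ?_ s
        rw [← h.next, h.injective.mem_set_image, h.injective.mem_set_image, Set.mem_Ioc,
          Set.mem_Ioc]
        omega
    -- After the loop the curve borders the same square again, so the loop can be skipped.
    have hback : face s (c (m + 1)) = face s (c i) := by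
      rw [h.next, hm, step, head_opp, turnStep_opp, hs, neg_neg, face_turnStep]
    rcases le_or_gt (i + n) m with hle | hgt
    · exfalso
      have h2 := h.color_eq_zero_of_sideLeadsTo hsub hf hR hQ
      have h3 := h1 (n - 1) (by push_cast [Nat.cast_sub hn]; omega)
      rw [Nat.cast_sub hn, Nat.cast_one, add_assoc, add_sub_cancel, h2] at h3
      exact zero_ne_one h3
    · refine ih (i + n - (m + 1)).toNat (by omega) (i := m + 1) (by rwa [hback]) ?_
      rwa [Int.toNat_of_nonneg (by omega), add_sub_cancel]

theorem conn_of_side (h : IsTrack κ t c) {s : ℤˣ} {i j : ℤ} {P Q : ℤ × ℤ}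
    (hP : SideLeadsTo κ t c s (face s (c i)) P) (hQ : SideLeadsTo κ t c s (face s (c j)) Q) :
    Conn (exterior c) P Q := by
  rcases le_total i j with hij | hij
  · exact h.conn_of_side_add (j - i).toNat hP
      (by rwa [Int.toNat_of_nonneg (by omega), add_sub_cancel])
  · exact (h.conn_of_side_add (i - j).toNat hQ
      (by rwa [Int.toNat_of_nonneg (by omega), add_sub_cancel])).symm

/-- If the edge is oriented away from `P`, the next dart of its orbit shares a square with `c` at
the contact. If it is oriented towards `P`, it is the outgoing dart which `c` does not take on its
visit to `P + d`. -/
theorem exists_side_of_visited (h : IsTrack κ t c) {P d : ℤ × ℤ} (hd : IsDir d)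
    (hP : ¬ Visited c P) (hv : Visited c (P + d)) :
    ∃ s i, SideLeadsTo κ t c s (face s (c i)) P := by
  rcases Int.emod_two_eq_zero_or_one (P.1 + P.2 + d.1 + κ) with hpar | hpar
  · have hx : Oriented κ (P, d) := ⟨hd, hpar⟩
    have hm : (P, d) ∉ Set.range c := h.notMem_of_fst hP
    obtain ⟨i, hi⟩ := h.opp_mem hx hm hv
    refine ⟨-t (head (P, d)), i, step t (P, d), hx.next t, ?_, mt h.step_mem_iff.1 hm, ?_⟩
    · rw [hi, face_opp, neg_neg]
      rfl
    · exact (h.conn_firstExit_step hx hm).symm.trans (h.conn_firstExit hx hP)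
  · have hx : Oriented κ (P + d, -d) := by
      refine ⟨?_, ?_⟩
      · rcases hd with rfl | rfl | rfl | rfl <;> simp [IsDir]
      · rcases hd with rfl | rfl | rfl | rfl <;> simp at hpar ⊢ <;> omega
    have hh : head (P + d, -d) = P := by simp [head]
    have hm : (P + d, -d) ∉ Set.range c := notMem_of_head (by rwa [hh])
    obtain ⟨i, hi⟩ := hv
    have hx' : (P + d, -d) = turnStep (-t (head (c i))) (c i) := by
      rcases (h.oriented i).eq_or_eq_turnStep hx hi (t (head (c i))) with e | e
      · exact absurd ⟨i + 1, by rw [h.next, e, step]⟩ hm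
      · exact e
    refine ⟨-t (head (c i)), i, (P + d, -d), hx, by rw [hx', face_turnStep], hm, ?_⟩
    rw [firstExit_of_not_visited t (by rwa [hh]), hh]
    exact Conn.refl _ _

/-- Walk from `P` towards a visited point: the last exterior point before `c` is met is next to `c`
and connected to `P`. -/
theorem exists_side (h : IsTrack κ t c) {P : ℤ × ℤ} (hP : ¬ Visited c P) :
    ∃ s i, SideLeadsTo κ t c s (face s (c i)) P := by
  obtain ⟨v, hv⟩ : ∃ v, Visited c v := ⟨head (c 0), 0, rfl⟩
  induction hn : (v.1 - P.1).natAbs + (v.2 - P.2).natAbs generalizing P with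
  | zero =>
    have : P = v := by ext <;> omega
    exact absurd hv (this ▸ hP)
  | succ n ih =>
    obtain ⟨d, hd, hlt⟩ : ∃ d, IsDir d ∧
        (v.1 - (P + d).1).natAbs + (v.2 - (P + d).2).natAbs = n := by
      by_cases h1 : v.1 = P.1
      · rcases lt_or_gt_of_ne (show v.2 ≠ P.2 by omega) with h2 | h2
        · exact ⟨(0, -1), by simp [IsDir], by simp; omega⟩
        · exact ⟨(0, 1), by simp [IsDir], by simp; omega⟩
      · rcases lt_or_gt_of_ne h1 with h2 | h2
        · exact ⟨(-1, 0), by simp [IsDir], by simp; omega⟩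
        · exact ⟨(1, 0), by simp [IsDir], by simp; omega⟩
    by_cases hv' : Visited c (P + d)
    · exact h.exists_side_of_visited hd hP hv'
    · obtain ⟨s, i, y, h1, h2, h3, h4⟩ := ih hv' hlt
      exact ⟨s, i, y, h1, h2, h3, h4.trans (conn_of_dart (x := (P, d)) hd hP hv').symm⟩

/-- The orbit that leaves `P` is infinite and remains close to its exits, all of which are connected
to `P`. -/
theorem infinite_conn (h : IsTrack κ t c) {P : ℤ × ℤ} (hP : ¬ Visited c P) :
    {Q | Conn (exterior c) P Q}.Infinite := by
  intro hfin
  obtain ⟨x, hx, hxP⟩ : ∃ x, Oriented κ x ∧ x.1 = P := by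
    obtain ⟨y, hy, hyP⟩ := exists_oriented_head κ P
    exact ⟨turnStep 1 y, hy.turn 1, hyP⟩
  have hm : x ∉ Set.range c := h.notMem_of_fst (by rwa [hxP])
  have hmk : ∀ k, (step t)^[k] x ∉ Set.range c := fun k => mt (h.iterate_mem_iff k).1 hm
  have hconn : ∀ k, Conn (exterior c) P (firstExit t c ((step t)^[k] x)) := by
    intro k
    induction k with
    | zero =>
      have := h.conn_firstExit hx (by rwa [hxP])
      rw [hxP] at this
      exact this.symm
    | succ k ih =>
      rw [Function.iterate_succ_apply']
      exact ih.trans (h.conn_firstExit_step (hx.iterate t k) (hmk k))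
  obtain ⟨B, hB⟩ : ∃ B : ℤ, ∀ Q, Conn (exterior c) P Q → |Q.1| ≤ B ∧ |Q.2| ≤ B := by
    obtain ⟨R₁, h1⟩ := (hfin.image fun x => |x.1|).bddAbove
    obtain ⟨R₂, h2⟩ := (hfin.image fun x => |x.2|).bddAbove
    exact ⟨max R₁ R₂, fun x hx => ⟨(h1 ⟨x, hx, rfl⟩).trans (le_max_left _ _),
      (h2 ⟨x, hx, rfl⟩).trans (le_max_right _ _)⟩⟩
  refine Set.infinite_range_of_injective (h.iterate_injective hx.1)
    ((finite_darts (B + 4)).subset ?_)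
  rintro _ ⟨k, rfl⟩
  have h1 := h.firstExit_near (hx.iterate t k) (hmk k)
  have h2 := hB _ (hconn k)
  refine ⟨(hx.iterate t k).1, ?_⟩
  simp only [abs_le] at h1 h2 ⊢
  omega

end IsTrack

/-! ### The curve in the plane -/

/-- The point `p` lies on the straight middle part of the smoothed edge of `x`. -/
def OnEdge (α : ℝ) (x : Dart) (p : ℝ × ℝ) : Prop :=
  ∃ u : ℝ, 2 * α ≤ u ∧ u ≤ 1 - 2 * α ∧ p.1 = x.1.1 + u * x.2.1 ∧ p.2 = x.1.2 + u * x.2.2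

/-- The point `p` lies on the cut corner where one turns from `x` in the direction `s`. -/
def OnCorner (α : ℝ) (s : ℤˣ) (x : Dart) (p : ℝ × ℝ) : Prop :=
  ∃ b : ℝ, 0 ≤ b ∧ b ≤ 2 * α ∧
    p.1 = x.1.1 + x.2.1 - (2 * α - b) * x.2.1 - b * ((s : ℤ) * x.2.2) ∧
    p.2 = x.1.2 + x.2.2 - (2 * α - b) * x.2.2 + b * ((s : ℤ) * x.2.1)

/-- The plane curve with smoothed corners given by a sequence of darts. -/
def smoothCurve (α : ℝ) (t : ℤ × ℤ → ℤˣ) (c : ℤ → Dart) : Set (ℝ × ℝ) :=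
  {p | ∃ i, OnEdge α (c i) p ∨ OnCorner α (t (head (c i))) (c i) p}

/-- Both coordinates of the double of the centre of a square are odd. -/
def IsFace (F : ℤ × ℤ) : Prop := F.1 % 2 = 1 ∧ F.2 % 2 = 1

/-- The centre of a square. -/
noncomputable def centre (F : ℤ × ℤ) : ℝ × ℝ := (F.1 / 2, F.2 / 2)

/-- A square with cut corners. -/
def octagon (α : ℝ) (F : ℤ × ℤ) : Set (ℝ × ℝ) :=
  {p | |2 * p.1 - F.1| ≤ 1 ∧ |2 * p.2 - F.2| ≤ 1 ∧ |2 * p.1 - F.1| + |2 * p.2 - F.2| ≤ 2 - 4 * α}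

/-- The tilted square, centred at a lattice point, which is bounded by cut corners. -/
def diamond (α : ℝ) (v : ℤ × ℤ) : Set (ℝ × ℝ) := {p | |p.1 - v.1| + |p.2 - v.2| ≤ 2 * α}

theorem isFace_face {x : Dart} (hx : IsDir x.2) (s : ℤˣ) : IsFace (face s x) := by
  obtain ⟨⟨a, b⟩, d⟩ := x
  rcases hx with h | h | h | h <;> rcases Int.units_eq_one_or s with rfl | rfl <;>
    simp at h <;> subst h <;> simp [face, IsFace]

theorem one_le_abs_cast {n : ℤ} (h : n ≠ 0) : (1 : ℝ) ≤ |(n : ℝ)| := by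
  exact_mod_cast Int.one_le_abs h

theorem OnCorner.dist_eq {α : ℝ} {s : ℤˣ} {x : Dart} (hx : IsDir x.2) {p : ℝ × ℝ}
    (h : OnCorner α s x p) : |p.1 - (head x).1| + |p.2 - (head x).2| = 2 * α := by
  obtain ⟨b, h0, h1, h2, h3⟩ := h
  have e0 : |b| = b := abs_of_nonneg h0
  have e1 : |2 * α - b| = 2 * α - b := abs_of_nonneg (by linarith)
  have e2 : |b - 2 * α| = 2 * α - b := by rw [abs_sub_comm, e1]
  rw [h2, h3]
  obtain ⟨⟨a, b⟩, d⟩ := x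
  rcases hx with h | h | h | h <;> rcases Int.units_eq_one_or s with rfl | rfl <;>
    simp at h <;> subst h <;> simp [head, e0, e1, e2]

/-- Distinct lattice points are far away from each other. -/
theorem eq_of_dist_lt {v w : ℤ × ℤ} {p : ℝ × ℝ}
    (h : |p.1 - v.1| + |p.2 - v.2| + (|p.1 - w.1| + |p.2 - w.2|) < 1) : v = w := by
  by_contra hne
  have h1 : |(v.1 : ℝ) - w.1| ≤ |p.1 - v.1| + |p.1 - w.1| := by
    rw [abs_sub_comm p.1]; exact abs_sub_le _ _ _
  have h2 : |(v.2 : ℝ) - w.2| ≤ |p.2 - v.2| + |p.2 - w.2| := by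
    rw [abs_sub_comm p.2]; exact abs_sub_le _ _ _
  have h3 := abs_nonneg ((v.1 : ℝ) - w.1)
  have h4 := abs_nonneg ((v.2 : ℝ) - w.2)
  by_cases hv : v.1 = w.1
  · have := one_le_abs_cast (n := v.2 - w.2) (fun e => hne (Prod.ext hv (by omega)))
    push_cast at this
    linarith
  · have := one_le_abs_cast (n := v.1 - w.1) (by omega)
    push_cast at this
    linarith

theorem le_abs_of_between {u β : ℝ} (h₁ : β ≤ u) (h₂ : u ≤ 1 - β) (n : ℤ) : β ≤ |u - n| := by
  rcases le_or_gt n 0 with h | h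
  · have : (n : ℝ) ≤ 0 := by exact_mod_cast h
    exact (by linarith : β ≤ u - n).trans (le_abs_self _)
  · have : (1 : ℝ) ≤ n := by exact_mod_cast h
    exact (by linarith : β ≤ -(u - n)).trans (neg_le_abs _)

section

variable {α : ℝ} {κ : ℤ} {t : ℤ × ℤ → ℤˣ} {c : ℤ → Dart}

theorem OnEdge.le_dist {x : Dart} (hx : IsDir x.2) {p : ℝ × ℝ} (h : OnEdge α x p) (v : ℤ × ℤ) :
    2 * α ≤ |p.1 - v.1| + |p.2 - v.2| := by
  obtain ⟨u, h1, h2, h3, h4⟩ := h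
  have n1 := abs_nonneg (p.1 - v.1)
  have n2 := abs_nonneg (p.2 - v.2)
  rw [h3] at n1 ⊢
  rw [h4] at n2 ⊢
  rcases hx with h | h | h | h <;> rw [h] at n1 n2 ⊢
  · have := le_abs_of_between h1 h2 (v.1 - x.1.1)
    push_cast at this n1 n2 ⊢
    rw [show (x.1.1 : ℝ) + u * 1 - v.1 = u - (v.1 - x.1.1) by ring]
    linarith
  · have := le_abs_of_between h1 h2 (v.2 - x.1.2)
    push_cast at this n1 n2 ⊢
    rw [show (x.1.2 : ℝ) + u * 1 - v.2 = u - (v.2 - x.1.2) by ring]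
    linarith
  · have := le_abs_of_between h1 h2 (x.1.1 - v.1)
    push_cast at this n1 n2 ⊢
    rw [show (x.1.1 : ℝ) + u * -1 - v.1 = -(u - (x.1.1 - v.1)) by ring, abs_neg]
    linarith
  · have := le_abs_of_between h1 h2 (x.1.2 - v.2)
    push_cast at this n1 n2 ⊢
    rw [show (x.1.2 : ℝ) + u * -1 - v.2 = -(u - (x.1.2 - v.2)) by ring, abs_neg]
    linarith

/-- Corners lie on the boundaries of the diamonds and straight parts outside their interiors;
distinct diamonds are disjoint as `4 * α < 1`. -/
theorem notMem_of_dist_lt (hα' : α < 1 / 4) (hd : ∀ i, IsDir (c i).2) {p : ℝ × ℝ} {v : ℤ × ℤ}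
    (h : |p.1 - v.1| + |p.2 - v.2| < 2 * α) : p ∉ smoothCurve α t c := by
  rintro ⟨i, hi | hi⟩
  · exact absurd (hi.le_dist (hd i) v) (not_le.2 h)
  · have h1 := hi.dist_eq (hd i)
    have : v = head (c i) := eq_of_dist_lt (p := p) (by linarith)
    rw [this] at h
    linarith

theorem abs_sub_eq_one_of_isFace {a b : ℤ} {x β : ℝ} (ha : a % 2 = 1) (h₁ : |2 * x - a| ≤ 1)
    (h₂ : |x - b| ≤ β) (hβ : β < 1 / 2) : |(a : ℝ) - 2 * b| = 1 := by
  have h3 : |(a : ℝ) - 2 * b| < 2 := by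
    have : (a : ℝ) - 2 * b = -(2 * x - a) + 2 * (x - b) := by ring
    rw [this]
    refine (abs_add_le _ _).trans_lt ?_
    rw [abs_neg, abs_mul, abs_two]
    linarith
  have h4 : |a - 2 * b| < 2 := by exact_mod_cast h3
  have h5 : |a - 2 * b| = 1 := by rw [abs_lt] at h4; rw [abs_eq (by norm_num)]; omega
  exact_mod_cast h5

/-- A straight part has an integer coordinate, which the interior of the square excludes. A corner
lies on a diamond around a corner of the square, and the triangle inequality puts it on or beyond
the cut. -/
theorem notMem_of_mem_interior (hα' : α < 1 / 4) (hd : ∀ i, IsDir (c i).2)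
    {p : ℝ × ℝ} {F : ℤ × ℤ} (hF : IsFace F) (h₁ : |2 * p.1 - F.1| < 1) (h₂ : |2 * p.2 - F.2| < 1)
    (h₃ : |2 * p.1 - F.1| + |2 * p.2 - F.2| < 2 - 4 * α) : p ∉ smoothCurve α t c := by
  rintro ⟨i, hi | hi⟩
  · obtain ⟨u, -, -, h4, h5⟩ := hi
    obtain ⟨hF1, hF2⟩ := hF
    rw [h4] at h₁
    rw [h5] at h₂
    rcases hd i with h | h | h | h <;> rw [h] at h₁ h₂ <;> simp only [Int.cast_zero, mul_zero, add_zero] at h₁ h₂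
    · have : |2 * (c i).1.2 - F.2| < 1 := by exact_mod_cast h₂
      rw [abs_lt] at this; omega
    · have : |2 * (c i).1.1 - F.1| < 1 := by exact_mod_cast h₁
      rw [abs_lt] at this; omega
    · have : |2 * (c i).1.2 - F.2| < 1 := by exact_mod_cast h₂
      rw [abs_lt] at this; omega
    · have : |2 * (c i).1.1 - F.1| < 1 := by exact_mod_cast h₁
      rw [abs_lt] at this; omega
  · have h := hi.dist_eq (hd i)
    have n1 := abs_nonneg (p.1 - (head (c i)).1)
    have n2 := abs_nonneg (p.2 - (head (c i)).2)
    have k1 := abs_sub_eq_one_of_isFace hF.1 h₁.le (b := (head (c i)).1) (β := 2 * α)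
      (by linarith) (by linarith)
    have k2 := abs_sub_eq_one_of_isFace hF.2 h₂.le (b := (head (c i)).2) (β := 2 * α)
      (by linarith) (by linarith)
    have j1 : |(F.1 : ℝ) - 2 * (head (c i)).1| ≤
        |2 * p.1 - F.1| + 2 * |p.1 - (head (c i)).1| := by
      rw [show (F.1 : ℝ) - 2 * (head (c i)).1 = -(2 * p.1 - F.1) + 2 * (p.1 - (head (c i)).1) by ring]
      refine (abs_add_le _ _).trans ?_
      rw [abs_neg, abs_mul, abs_two]
    have j2 : |(F.2 : ℝ) - 2 * (head (c i)).2| ≤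
        |2 * p.2 - F.2| + 2 * |p.2 - (head (c i)).2| := by
      rw [show (F.2 : ℝ) - 2 * (head (c i)).2 = -(2 * p.2 - F.2) + 2 * (p.2 - (head (c i)).2) by ring]
      refine (abs_add_le _ _).trans ?_
      rw [abs_neg, abs_mul, abs_two]
    linarith

/-! ### Passages through the complement of the curve -/

/-- Two points are in the same connected component of the complement of the curve. -/
def Linked (S : Set (ℝ × ℝ)) (p q : ℝ × ℝ) : Prop :=
  connectedComponentIn Sᶜ p = connectedComponentIn Sᶜ q

theorem linked_of_segment {S : Set (ℝ × ℝ)} {p q : ℝ × ℝ}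
    (h : ∀ r : ℝ, 0 ≤ r → r ≤ 1 → (p.1 + r * (q.1 - p.1), p.2 + r * (q.2 - p.2)) ∉ S) :
    Linked S p q := by
  refine connectedComponentIn_eq ?_
  refine (convex_segment p q).isPreconnected.subset_connectedComponentIn
    (left_mem_segment ℝ p q) ?_ (right_mem_segment ℝ p q)
  rw [segment_eq_image']
  rintro _ ⟨r, ⟨h0, h1⟩, rfl⟩
  exact h r h0 h1

/-- The octagon is star-shaped around its centre: deviations shrink by the factor `1 - r`, so all
points of the segment but `p` are interior. -/
theorem linked_centre (hα' : α < 1 / 4) (hd : ∀ i, IsDir (c i).2)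
    {p : ℝ × ℝ} {F : ℤ × ℤ} (hF : IsFace F) (hp : p ∈ octagon α F) (hpS : p ∉ smoothCurve α t c) :
    Linked (smoothCurve α t c) p (centre F) := by
  obtain ⟨h1, h2, h3⟩ := hp
  refine linked_of_segment fun r r0 r1 => ?_
  rcases r0.eq_or_lt with rfl | hr
  · simpa using hpS
  have e1 : |2 * (p.1 + r * ((centre F).1 - p.1)) - F.1| = (1 - r) * |2 * p.1 - F.1| := by
    rw [← abs_of_nonneg (sub_nonneg.2 r1), ← abs_mul]; congr 1; simp only [centre]; ring
  have e2 : |2 * (p.2 + r * ((centre F).2 - p.2)) - F.2| = (1 - r) * |2 * p.2 - F.2| := by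
    rw [← abs_of_nonneg (sub_nonneg.2 r1), ← abs_mul]; congr 1; simp only [centre]; ring
  have n1 := abs_nonneg (2 * p.1 - F.1)
  have n2 := abs_nonneg (2 * p.2 - F.2)
  refine notMem_of_mem_interior hα' hd hF ?_ ?_ ?_
  · simp only [e1]; nlinarith
  · simp only [e2]; nlinarith
  · simp only [e1, e2]; nlinarith

theorem linked_vertex (hα : 0 < α) (hα' : α < 1 / 4) (hd : ∀ i, IsDir (c i).2)
    {p : ℝ × ℝ} {v : ℤ × ℤ} (hp : p ∈ diamond α v) (hpS : p ∉ smoothCurve α t c) :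
    Linked (smoothCurve α t c) p (latticePoint v) := by
  refine linked_of_segment fun r r0 r1 => ?_
  rcases r0.eq_or_lt with rfl | hr
  · simpa using hpS
  have e1 : |p.1 + r * ((latticePoint v).1 - p.1) - v.1| = (1 - r) * |p.1 - v.1| := by
    rw [← abs_of_nonneg (sub_nonneg.2 r1), ← abs_mul]; congr 1; simp only [latticePoint]; ring
  have e2 : |p.2 + r * ((latticePoint v).2 - p.2) - v.2| = (1 - r) * |p.2 - v.2| := by
    rw [← abs_of_nonneg (sub_nonneg.2 r1), ← abs_mul]; congr 1; simp only [latticePoint]; ring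
  have n1 := abs_nonneg (p.1 - v.1)
  have n2 := abs_nonneg (p.2 - v.2)
  have hp' : |p.1 - v.1| + |p.2 - v.2| ≤ 2 * α := hp
  refine notMem_of_dist_lt (v := v) hα' hd ?_
  simp only [e1, e2]
  nlinarith

/-- The middle of an edge is on the curve only if the edge is used by the curve. -/
theorem mem_range_of_edge_mid (hα : 0 < α) (hα' : α < 1 / 4) (hc : ∀ i, Oriented κ (c i))
    {y : Dart} (hy : Oriented κ y)
    (hm : ((y.1.1 + y.2.1 / 2, y.1.2 + y.2.2 / 2) : ℝ × ℝ) ∈ smoothCurve α t c) :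
    y ∈ Set.range c := by
  have hi0 : ∀ a b : ℤ, (a : ℝ) + 1 / 2 ≠ b := by
    intro a b h
    have : (2 * a + 1 : ℝ) = 2 * b := by linarith
    have : 2 * a + 1 = 2 * b := by exact_mod_cast this
    omega
  obtain ⟨i, hi | hi⟩ := hm
  · refine ⟨i, ?_⟩
    have ho := hc i
    generalize c i = x at hi ho
    obtain ⟨u, h1, h2, h3, h4⟩ := hi
    have hl : ∀ a b : ℤ, (a : ℝ) + 1 / 2 = b + u → b = a := by
      intro a b h
      have i1 : (b : ℝ) < a + 1 := by linarith
      have i2 : (a : ℝ) < b + 1 := by linarith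
      have i1 : b < a + 1 := by exact_mod_cast i1
      have i2 : a < b + 1 := by exact_mod_cast i2
      omega
    have hr : ∀ a b : ℤ, (a : ℝ) + 1 / 2 = b - u → b = a + 1 := by
      intro a b h
      have i1 : (b : ℝ) < a + 2 := by linarith
      have i2 : (a : ℝ) < b := by linarith
      have i1 : b < a + 2 := by exact_mod_cast i1
      have i2 : a < b := by exact_mod_cast i2
      omega
    obtain ⟨⟨a, b⟩, d⟩ := y
    obtain ⟨⟨a', b'⟩, d'⟩ := x
    obtain ⟨hd, hp⟩ := hy
    obtain ⟨hd', hp'⟩ := ho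
    rcases hd with k1 | k1 | k1 | k1 <;> rcases hd' with k2 | k2 | k2 | k2 <;>
      simp only at k1 k2 <;> subst k1 k2 <;> simp only [Int.cast_zero, Int.cast_one, Int.cast_neg,
        mul_zero, mul_one, zero_div, add_zero] at h3 h4 hp hp' <;>
      simp only [Prod.mk.injEq]
    · have := hl a a' (by linarith); have : b = b' := by exact_mod_cast h4
      simp; omega
    · exact absurd (by linarith) (hi0 a a')
    · have := hr a a' (by linarith); have : b = b' := by exact_mod_cast h4
      omega
    · exact absurd (by linarith) (hi0 a a')
    · exact absurd (by linarith) (hi0 b b')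
    · have := hl b b' (by linarith); have : a = a' := by exact_mod_cast h3
      simp; omega
    · exact absurd (by linarith) (hi0 b b')
    · have := hr b b' (by linarith); have : a = a' := by exact_mod_cast h3
      omega
    · have := hl (a - 1) a' (by push_cast; linarith); have : b = b' := by exact_mod_cast h4
      omega
    · exact absurd (by push_cast; linarith) (hi0 (a - 1) a')
    · have := hr (a - 1) a' (by push_cast; linarith); have : b = b' := by exact_mod_cast h4
      simp; omega
    · exact absurd (by push_cast; linarith) (hi0 (a - 1) a')
    · exact absurd (by push_cast; linarith) (hi0 (b - 1) b')
    · have := hl (b - 1) b' (by push_cast; linarith); have : a = a' := by exact_mod_cast h3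
      omega
    · exact absurd (by push_cast; linarith) (hi0 (b - 1) b')
    · have := hr (b - 1) b' (by push_cast; linarith); have : a = a' := by exact_mod_cast h3
      simp; omega
  · exfalso
    have h := hi.dist_eq (hc i).1
    -- With `1 / 4` for `α`, the straight part reduces to the midpoint, at distance at least `1 / 2
    -- > 2 * α` from lattice points.
    have : OnEdge (1 / 4) y (y.1.1 + y.2.1 / 2, y.1.2 + y.2.2 / 2) :=
      ⟨1 / 2, by norm_num, by norm_num, by simp only; ring, by simp only; ring⟩
    have := this.le_dist hy.1 (head (c i))
    linarith

/-- The middle of a corner is on the curve only if the corner is used by the curve. -/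
theorem mem_range_of_corner_mid (hα : 0 < α) (hα' : α < 1 / 4) (hc : ∀ i, Oriented κ (c i))
    {y : Dart} (hy : Oriented κ y) {s : ℤˣ}
    (hm : (((head y).1 + α * ((face s y).1 - 2 * (head y).1),
      (head y).2 + α * ((face s y).2 - 2 * (head y).2)) : ℝ × ℝ) ∈ smoothCurve α t c) :
    s = t (head y) ∧ y ∈ Set.range c := by
  have hε : ((face s y).1 - 2 * (head y).1 = 1 ∨ (face s y).1 - 2 * (head y).1 = -1) ∧
      ((face s y).2 - 2 * (head y).2 = 1 ∨ (face s y).2 - 2 * (head y).2 = -1) := by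
    obtain ⟨⟨a, b⟩, d⟩ := y
    rcases hy.1 with k | k | k | k <;> rcases Int.units_eq_one_or s with rfl | rfl <;>
      simp only at k <;> subst k <;> simp [face, head] <;> omega
  obtain ⟨ε₁, h1⟩ : ∃ ε, ε = (face s y).1 - 2 * (head y).1 := ⟨_, rfl⟩
  obtain ⟨ε₂, h2⟩ : ∃ ε, ε = (face s y).2 - 2 * (head y).2 := ⟨_, rfl⟩
  have r1 : ((face s y).1 : ℝ) - 2 * (head y).1 = ε₁ := by rw [h1]; push_cast; ring
  have r2 : ((face s y).2 : ℝ) - 2 * (head y).2 = ε₂ := by rw [h2]; push_cast; ring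
  rw [r1, r2] at hm
  rw [← h1, ← h2] at hε
  obtain ⟨hε₁, hε₂⟩ := hε
  have a1 : |α * ε₁| = α := by
    rcases hε₁ with e | e <;> rw [e] <;> simp [abs_of_pos hα]
  have a2 : |α * ε₂| = α := by
    rcases hε₂ with e | e <;> rw [e] <;> simp [abs_of_pos hα]
  obtain ⟨i, hi | hi⟩ := hm
  · exfalso
    -- Straight parts have an integer coordinate, whereas both coordinates of this point differ from
    -- an integer by `α`.
    have hint : ∀ (a b : ℤ) (ε : ℤ), |α * ε| = α → (a : ℝ) + α * ε = b → False := by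
      intro a b ε ha h
      have h' : ((b - a : ℤ) : ℝ) = α * ε := by push_cast; linarith
      rw [← h'] at ha
      have hne : b - a ≠ 0 := by
        intro h0
        rw [h0] at ha
        simp at ha
        linarith
      have := one_le_abs_cast hne
      linarith
    obtain ⟨u, -, -, h3, h4⟩ := hi
    rcases (hc i).1 with k | k | k | k <;> rw [k] at h3 h4 <;>
      simp only [Int.cast_zero, mul_zero, add_zero] at h3 h4
    · exact hint _ _ _ a2 h4
    · exact hint _ _ _ a1 h3
    · exact hint _ _ _ a2 h4
    · exact hint _ _ _ a1 h3
  · have hd := hi.dist_eq (hc i).1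
    have hv : head y = head (c i) := by
      refine eq_of_dist_lt (p := (((head y).1 + α * ε₁, (head y).2 + α * ε₂) : ℝ × ℝ)) ?_
      rw [hd]
      simp only [add_sub_cancel_left, a1, a2]
      linarith
    have hor := hy.eq_or_eq_opp (hc i) hv
    obtain ⟨b, b0, b1, h3, h4⟩ := hi
    rw [show t (head y) = t (head (c i)) by rw [hv]]
    generalize t (head (c i)) = τ at h3 h4 ⊢
    rcases hor with e | e
    · refine ⟨?_, i, e⟩
      rw [e] at h3 h4
      obtain ⟨⟨a, b⟩, d⟩ := y
      rcases hy.1 with k | k | k | k <;> rcases Int.units_eq_one_or s with rfl | rfl <;>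
        rcases Int.units_eq_one_or τ with rfl | rfl <;> simp only at k <;> subst k <;>
        simp [face, head] at h1 h2 h3 h4 ⊢ <;> subst h1 h2 <;> push_cast at h3 h4 <;> linarith
    · exfalso
      rw [e] at h3 h4
      obtain ⟨⟨a, b⟩, d⟩ := y
      rcases hy.1 with k | k | k | k <;> rcases Int.units_eq_one_or s with rfl | rfl <;>
        rcases Int.units_eq_one_or τ with rfl | rfl <;> simp only at k <;> subst k <;>
        simp [face, head, opp] at h1 h2 h3 h4 ⊢ <;> subst h1 h2 <;> push_cast at h3 h4 <;> linarith

end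

theorem abs_face_sub_head {y : Dart} (hy : IsDir y.2) (s : ℤˣ) :
    |((face s y).1 : ℝ) - 2 * (head y).1| = 1 ∧ |((face s y).2 : ℝ) - 2 * (head y).2| = 1 := by
  have : |(face s y).1 - 2 * (head y).1| = 1 ∧ |(face s y).2 - 2 * (head y).2| = 1 := by
    obtain ⟨⟨a, b⟩, d⟩ := y
    rcases hy with k | k | k | k <;> rcases Int.units_eq_one_or s with rfl | rfl <;>
      simp only at k <;> subst k <;> simp only [abs_eq zero_le_one] <;> simp [face, head] <;> omega
  exact ⟨by exact_mod_cast this.1, by exact_mod_cast this.2⟩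

/-- The distance from `x` to the nearest integer is `(1 - |2x - F|) / 2` with `F = 2⌊x⌋ + 1`; so a
point beyond the cut of its octagon is in the diamond of the nearest lattice point. -/
theorem exists_mem_octagon_or_diamond (α : ℝ) (p : ℝ × ℝ) :
    (∃ F, IsFace F ∧ p ∈ octagon α F) ∨ ∃ v, p ∈ diamond α v := by
  have key : ∀ x : ℝ, |2 * x - (2 * ⌊x⌋ + 1 : ℤ)| ≤ 1 ∧
      ∃ n : ℤ, |x - n| = (1 - |2 * x - (2 * ⌊x⌋ + 1 : ℤ)|) / 2 := by
    intro x
    have h1 := Int.floor_le x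
    have h2 := Int.lt_floor_add_one x
    push_cast
    refine ⟨abs_le.2 ⟨by linarith, by linarith⟩, ?_⟩
    rcases le_total 0 (2 * x - (2 * ⌊x⌋ + 1)) with h | h
    · refine ⟨⌊x⌋ + 1, ?_⟩
      push_cast
      rw [abs_of_nonneg h, abs_of_nonpos (by linarith)]; ring
    · refine ⟨⌊x⌋, ?_⟩
      rw [abs_of_nonpos h, abs_of_nonneg (by linarith)]; ring
  obtain ⟨h1, m, hm⟩ := key p.1
  obtain ⟨h2, n, hn⟩ := key p.2
  by_cases h : |2 * p.1 - (2 * ⌊p.1⌋ + 1 : ℤ)| + |2 * p.2 - (2 * ⌊p.2⌋ + 1 : ℤ)| ≤ 2 - 4 * α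
  · exact .inl ⟨(2 * ⌊p.1⌋ + 1, 2 * ⌊p.2⌋ + 1), ⟨by simp, by simp⟩, h1, h2, h⟩
  · refine .inr ⟨(m, n), ?_⟩
    simp only [diamond, Set.mem_ofPred_eq, hm, hn]
    linarith

/-- The edge between two squares, one above the other. -/
theorem exists_dart_horizontal (κ x y : ℤ) (α : ℝ) : ∃ z, ∃ s : ℤˣ, Oriented κ z ∧
    face s z = (2 * x + 1, 2 * y + 1) ∧ face (-s) z = (2 * x + 1, 2 * y - 1) ∧
    ∀ p : ℝ × ℝ, p.2 = y → x + 2 * α ≤ p.1 → p.1 ≤ x + 1 - 2 * α → OnEdge α z p := by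
  rcases Int.emod_two_eq_zero_or_one (x + y + κ) with h | h
  · refine ⟨((x + 1, y), (-1, 0)), -1, ⟨by simp [IsDir], by simp; omega⟩, ?_, ?_, fun p h1 h2 h3 =>
      ⟨x + 1 - p.1, by linarith, by linarith, by push_cast; ring, by push_cast; linarith⟩⟩ <;>
      simp [face] <;> omega
  · refine ⟨((x, y), (1, 0)), 1, ⟨by simp [IsDir], by simp; omega⟩, ?_, ?_, fun p h1 h2 h3 =>
      ⟨p.1 - x, by linarith, by linarith, by push_cast; ring, by push_cast; linarith⟩⟩ <;>
      simp [face] <;> omega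

/-- The edge between two squares, side by side. -/
theorem exists_dart_vertical (κ x y : ℤ) (α : ℝ) : ∃ z, ∃ s : ℤˣ, Oriented κ z ∧
    face s z = (2 * x + 1, 2 * y + 1) ∧ face (-s) z = (2 * x - 1, 2 * y + 1) ∧
    ∀ p : ℝ × ℝ, p.1 = x → y + 2 * α ≤ p.2 → p.2 ≤ y + 1 - 2 * α → OnEdge α z p := by
  rcases Int.emod_two_eq_zero_or_one (x + y + κ) with h | h
  · refine ⟨((x, y), (0, 1)), -1, ⟨by simp [IsDir], by simp; omega⟩, ?_, ?_, fun p h1 h2 h3 =>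
      ⟨p.2 - y, by linarith, by linarith, by push_cast; linarith, by push_cast; ring⟩⟩ <;>
      simp [face]
  · refine ⟨((x, y + 1), (0, -1)), 1, ⟨by simp [IsDir], by simp; omega⟩, ?_, ?_, fun p h1 h2 h3 =>
      ⟨y + 1 - p.2, by linarith, by linarith, by push_cast; linarith, by push_cast; ring⟩⟩ <;>
      simp [face] <;> omega

section

variable {S : Set (ℝ × ℝ)} {p q r : ℝ × ℝ}

theorem Linked.symm (h : Linked S p q) : Linked S q p := Eq.symm h

theorem Linked.trans (h : Linked S p q) (h' : Linked S q r) : Linked S p r := Eq.trans h h'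

end

namespace IsTrack

variable {α : ℝ} {κ : ℤ} {t : ℤ × ℤ → ℤˣ} {c : ℤ → Dart}

theorem isDir (h : IsTrack κ t c) (i : ℤ) : IsDir (c i).2 := (h.oriented i).1

/-- The passage is the midpoint of the corner, common to the diamond and the octagon. -/
theorem linked_corner (h : IsTrack κ t c) (hα : 0 < α) (hα' : α < 1 / 4) {y : Dart}
    (hy : Oriented κ y) {s : ℤˣ} (hs : s = t (head y) → y ∉ Set.range c) :
    Linked (smoothCurve α t c) (latticePoint (head y)) (centre (face s y)) := by
  obtain ⟨e1, e2⟩ := abs_face_sub_head hy.1 s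
  have hm : (((head y).1 + α * ((face s y).1 - 2 * (head y).1),
      (head y).2 + α * ((face s y).2 - 2 * (head y).2)) : ℝ × ℝ) ∉ smoothCurve α t c := fun hm =>
    have := mem_range_of_corner_mid hα hα' h.oriented hy hm
    hs this.1 this.2
  have a1 : |1 - 2 * α| = 1 - 2 * α := abs_of_pos (by linarith)
  refine (linked_vertex hα hα' h.isDir ?_ hm).symm.trans
    (linked_centre hα' h.isDir (isFace_face hy.1 s) ?_ hm)
  · simp only [diamond, Set.mem_ofPred_eq, add_sub_cancel_left, abs_mul, e1, e2, abs_of_pos hα]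
    linarith
  · have key : ∀ v F : ℝ, |F - 2 * v| = 1 → |2 * (v + α * (F - 2 * v)) - F| = 1 - 2 * α := by
      intro v F hv
      rw [show 2 * (v + α * (F - 2 * v)) - F = -((1 - 2 * α) * (F - 2 * v)) by ring, abs_neg,
        abs_mul, hv, a1, mul_one]
    simp only [octagon, Set.mem_ofPred_eq, key _ _ e1, key _ _ e2]
    exact ⟨by linarith, by linarith, by linarith⟩

theorem linked_across (h : IsTrack κ t c) (hα : 0 < α) (hα' : α < 1 / 4) {y : Dart}
    (hy : Oriented κ y) (hyc : y ∉ Set.range c) (s : ℤˣ) :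
    Linked (smoothCurve α t c) (centre (face s y)) (centre (face (-s) y)) := by
  have hm : ((y.1.1 + y.2.1 / 2, y.1.2 + y.2.2 / 2) : ℝ × ℝ) ∉ smoothCurve α t c := fun hm =>
    hyc (mem_range_of_edge_mid hα hα' h.oriented hy hm)
  have key : ∀ s : ℤˣ, ((y.1.1 + y.2.1 / 2, y.1.2 + y.2.2 / 2) : ℝ × ℝ) ∈ octagon α (face s y) := by
    intro s
    have e1 : 2 * (y.1.1 + y.2.1 / 2 : ℝ) - (face s y).1 = ((s * y.2.2 : ℤ) : ℝ) := by
      simp only [face]; push_cast; ring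
    have e2 : 2 * (y.1.2 + y.2.2 / 2 : ℝ) - (face s y).2 = ((-(s * y.2.1) : ℤ) : ℝ) := by
      simp only [face]; push_cast; ring
    simp only [octagon, Set.mem_ofPred_eq, e1, e2]
    rcases hy.1 with k | k | k | k <;> rcases Int.units_eq_one_or s with rfl | rfl <;>
      rw [k] <;> simp <;> linarith
  exact (linked_centre hα' h.isDir (isFace_face hy.1 s) (key s) hm).symm.trans
    (linked_centre hα' h.isDir (isFace_face hy.1 (-s)) (key (-s)) hm)

/-- A turn towards `s` keeps the square. At a turn away from it, the squares before and after are
linked through the lattice point, since the rule cuts neither of their corners there. -/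
theorem linked_side (h : IsTrack κ t c) (hα : 0 < α) (hα' : α < 1 / 4) (s : ℤˣ) (i j : ℤ) :
    Linked (smoothCurve α t c) (centre (face s (c i))) (centre (face s (c j))) := by
  refine Int.eq_of_forall_eq_pred
    (g := fun i => connectedComponentIn (smoothCurve α t c)ᶜ (centre (face s (c i)))) (fun i => ?_)
    i j
  have e := h.next (i - 1)
  rw [sub_add_cancel] at e
  simp only [e]
  have hx := h.oriented (i - 1)
  generalize c (i - 1) = x at hx
  rcases Int.units_eq_or_eq_neg s (t (head x)) with e | e
  · rw [step, e, face_turnStep]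
  · have hne : s = t (head x) → False := by rw [e]; intro h; exact units_ne_neg_self s h
    have h1 := h.linked_corner hα hα' hx (s := s) (fun h => (hne h).elim)
    have h2 := h.linked_corner hα hα' hx.opp (s := s) (fun h => (hne (by rwa [head_opp] at h)).elim)
    rw [head_opp, face_opp] at h2
    rw [step, e]
    exact h2.symm.trans h1

/-- Crossing an unused edge stays in the component, crossing an edge of `c` leads to the other side
of the curve, and such moves join all squares. -/
theorem linked_face (h : IsTrack κ t c) (hα : 0 < α) (hα' : α < 1 / 4) {F : ℤ × ℤ}
    (hF : IsFace F) :
    ∃ s, Linked (smoothCurve α t c) (centre F) (centre (face s (c 0))) := by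
  have key : ∀ {z : Dart} (_ : Oriented κ z) (s : ℤˣ),
      (∃ s', Linked (smoothCurve α t c) (centre (face s z)) (centre (face s' (c 0)))) →
      ∃ s', Linked (smoothCurve α t c) (centre (face (-s) z)) (centre (face s' (c 0))) := by
    rintro z hz s ⟨s', hs'⟩
    by_cases hzc : z ∈ Set.range c
    · obtain ⟨i, rfl⟩ := hzc
      exact ⟨-s, h.linked_side hα hα' _ _ _⟩
    · exact ⟨s', (h.linked_across hα hα' hz hzc s).symm.trans hs'⟩
  have hv : ∀ x y : ℤ,
      (∃ s, Linked (smoothCurve α t c) (centre (2 * x + 1, 2 * y + 1)) (centre (face s (c 0)))) =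
      ∃ s, Linked (smoothCurve α t c) (centre (2 * x + 1, 2 * (y - 1) + 1))
        (centre (face s (c 0))) := by
    intro x y
    obtain ⟨z, s, hz, h1, h2, -⟩ := exists_dart_horizontal κ x y 0
    rw [show 2 * (y - 1) + 1 = 2 * y - 1 by ring, ← h1, ← h2]
    exact propext ⟨key hz s, fun hh => by have := key hz (-s) hh; rwa [neg_neg] at this⟩
  have hh : ∀ x y : ℤ,
      (∃ s, Linked (smoothCurve α t c) (centre (2 * x + 1, 2 * y + 1)) (centre (face s (c 0)))) =
      ∃ s, Linked (smoothCurve α t c) (centre (2 * (x - 1) + 1, 2 * y + 1))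
        (centre (face s (c 0))) := by
    intro x y
    obtain ⟨z, s, hz, h1, h2, -⟩ := exists_dart_vertical κ x y 0
    rw [show 2 * (x - 1) + 1 = 2 * x - 1 by ring, ← h1, ← h2]
    exact propext ⟨key hz s, fun hh => by have := key hz (-s) hh; rwa [neg_neg] at this⟩
  have hall : ∀ {F : ℤ × ℤ}, IsFace F → F = (2 * (F.1 / 2) + 1, 2 * (F.2 / 2) + 1) := by
    rintro ⟨a, b⟩ ⟨h1, h2⟩
    ext <;> simp at h1 h2 ⊢ <;> omega
  have h0 : ∃ s, Linked (smoothCurve α t c) (centre (face 1 (c 0))) (centre (face s (c 0))) :=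
    ⟨1, rfl⟩
  rw [hall (isFace_face (h.isDir 0) 1)] at h0
  rw [hall hF, Int.eq_of_forall_eq_pred (fun x => hh x _) (F.1 / 2) ((face 1 (c 0)).1 / 2),
    Int.eq_of_forall_eq_pred (fun y => hv _ y) (F.2 / 2) ((face 1 (c 0)).2 / 2)]
  exact h0

/-- Each point of the complement of the curve belongs to the component of one of its two sides. -/
theorem exists_linked_side (h : IsTrack κ t c) (hα : 0 < α) (hα' : α < 1 / 4) {p : ℝ × ℝ}
    (hp : p ∉ smoothCurve α t c) :
    ∃ s, Linked (smoothCurve α t c) p (centre (face s (c 0))) := by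
  rcases exists_mem_octagon_or_diamond α p with ⟨F, hF, hpF⟩ | ⟨v, hpv⟩
  · obtain ⟨s, hs⟩ := h.linked_face hα hα' hF
    exact ⟨s, (linked_centre hα' h.isDir hF hpF hp).trans hs⟩
  · obtain ⟨y, hy, rfl⟩ := exists_oriented_head κ v
    obtain ⟨s, hs⟩ := h.linked_face hα hα' (isFace_face hy.1 (-t (head y)))
    exact ⟨s, (linked_vertex hα hα' h.isDir hpv hp).trans
      ((h.linked_corner hα hα' hy fun e => absurd e.symm (units_ne_neg_self _)).trans hs)⟩

theorem linked_head (h : IsTrack κ t c) (hα : 0 < α) (hα' : α < 1 / 4) {y : Dart}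
    (hy : Oriented κ y) (hyc : y ∉ Set.range c) (s : ℤˣ) :
    Linked (smoothCurve α t c) (centre (face s y)) (latticePoint (head y)) :=
  (h.linked_corner hα hα' hy fun _ => hyc).symm

theorem linked_fst (h : IsTrack κ t c) (hα : 0 < α) (hα' : α < 1 / 4) {y : Dart}
    (hy : Oriented κ y) (hv : ¬ Visited c y.1) (s : ℤˣ) :
    Linked (smoothCurve α t c) (centre (face s y)) (latticePoint y.1) := by
  obtain ⟨x, hx, hxy⟩ := exists_oriented_head κ y.1
  have hyc := h.notMem_of_fst hv
  have key : ∀ s : ℤˣ, y = turnStep s x →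
      Linked (smoothCurve α t c) (centre (face s y)) (latticePoint y.1) := by
    intro s e
    rw [← hxy] at hv ⊢
    rw [e, face_turnStep]
    exact h.linked_head hα hα' hx (notMem_of_head hv) s
  rcases hx.eq_or_eq_turnStep hy hxy s with e | e
  · exact key _ e
  · exact (h.linked_across hα hα' hy hyc s).trans (key _ e)

theorem linked_firstExit (h : IsTrack κ t c) (hα : 0 < α) (hα' : α < 1 / 4) {y : Dart}
    (hy : Oriented κ y) (hyc : y ∉ Set.range c) (s : ℤˣ) :
    Linked (smoothCurve α t c) (centre (face s y)) (latticePoint (firstExit t c y)) := by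
  obtain ⟨k, -, hk⟩ := h.exists_not_visited hy hyc
  induction k generalizing y with
  | zero =>
    rw [firstExit_of_not_visited t (x := y) hk]
    exact h.linked_head hα hα' hy hyc s
  | succ k ih =>
    by_cases hv : Visited c (head y)
    · rw [h.firstExit_of_visited hy hyc hv]
      have hyc' := mt h.step_mem_iff.1 hyc
      refine Linked.trans ?_ (ih (hy.next t) hyc' hk)
      rcases Int.units_eq_or_eq_neg s (t (head y)) with e | e
      · rw [step, e, face_turnStep]; rfl
      · refine (h.linked_across hα hα' hy hyc s).trans (.trans ?_
          (h.linked_across hα hα' (hy.next t) hyc' s).symm)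
        rw [step, e, face_turnStep]; rfl
    · rw [firstExit_of_not_visited t hv]; exact h.linked_head hα hα' hy hyc s

theorem linked_of_latticeAdj (h : IsTrack κ t c) (hα : 0 < α) (hα' : α < 1 / 4) {P Q : ℤ × ℤ}
    (hPQ : LatticeAdj (exterior c) P Q) :
    Linked (smoothCurve α t c) (latticePoint P) (latticePoint Q) := by
  obtain ⟨hP, hQ, hd⟩ := hPQ
  have hdir : IsDir (Q - P) := by
    obtain ⟨a, b⟩ := P
    obtain ⟨a', b'⟩ := Q
    have key : ∀ u v : ℤ, u ^ 2 + v ^ 2 = 1 → IsDir (u, v) := by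
      intro u v huv
      have h1 : -1 ≤ u ∧ u ≤ 1 := by constructor <;> nlinarith
      have h2 : -1 ≤ v ∧ v ≤ 1 := by constructor <;> nlinarith
      obtain ⟨h1, h1'⟩ := h1
      obtain ⟨h2, h2'⟩ := h2
      interval_cases u <;> interval_cases v <;> simp [IsDir] at huv ⊢
    exact key _ _ hd
  have key : ∀ x : Dart, Oriented κ x → ¬ Visited c x.1 → ¬ Visited c (head x) →
      Linked (smoothCurve α t c) (latticePoint x.1) (latticePoint (head x)) := fun x hx h1 h2 =>
    (h.linked_fst hα hα' hx h1 1).symm.trans (h.linked_head hα hα' hx (notMem_of_head h2) 1)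
  by_cases hor : Oriented κ (P, Q - P)
  · have e : head (P, Q - P) = Q := by simp [head]
    have := key _ hor hP (by rwa [e])
    rwa [e] at this
  · have hor' : Oriented κ (Q, P - Q) := by
      obtain ⟨a, b⟩ := P
      obtain ⟨a', b'⟩ := Q
      have hodd : ¬ (a + b + (a' - a) + κ) % 2 = 0 := fun hp => hor ⟨hdir, hp⟩
      refine ⟨?_, ?_⟩
      · simp only [IsDir, Prod.mk_sub_mk, Prod.mk.injEq] at hdir ⊢
        omega
      · simp only [IsDir, Prod.mk_sub_mk, Prod.mk.injEq] at hdir ⊢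
        omega
    have e : head (Q, P - Q) = P := by simp [head]
    have := key _ hor' hQ (by rwa [e])
    rw [e] at this
    exact this.symm

theorem linked_of_sideLeadsTo (h : IsTrack κ t c) (hα : 0 < α) (hα' : α < 1 / 4) {s : ℤˣ}
    {F P : ℤ × ℤ} (hP : SideLeadsTo κ t c s F P) :
    Linked (smoothCurve α t c) (centre F) (latticePoint P) := by
  obtain ⟨y, hy, rfl, hyc, hconn⟩ := hP
  refine (h.linked_firstExit hα hα' hy hyc s).trans ?_
  induction hconn with
  | refl => rfl
  | tail _ hadj ih => exact ih.trans (h.linked_of_latticeAdj hα hα' hadj)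

end IsTrack

/-! ### Separation of the two sides by closed coloured regions -/

/-- A family of closed subsets of the plane, indexed by `ℤ × ℤ`, whose members stay near the
corresponding points of a lattice, has closed unions. -/
theorem isClosed_biUnion_of_near {k : ℝ} {X : ℤ × ℤ → Set (ℝ × ℝ)} (hX : ∀ F, IsClosed (X F))
    (hk : ∀ F, ∀ p ∈ X F, |k * p.1 - F.1| ≤ 1 ∧ |k * p.2 - F.2| ≤ 1) (T : Set (ℤ × ℤ)) :
    IsClosed (⋃ F ∈ T, X F) := by
  rw [Set.biUnion_eq_iUnion]
  refine LocallyFinite.isClosed_iUnion ?_ fun F => hX F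
  have hfin : LocallyFinite X := by
    intro p
    refine ⟨{q | |k * q.1 - k * p.1| < 1 ∧ |k * q.2 - k * p.2| < 1}, ?_, ?_⟩
    · refine IsOpen.mem_nhds (IsOpen.and ?_ ?_) (by simp)
      · exact isOpen_lt (by fun_prop) continuous_const
      · exact isOpen_lt (by fun_prop) continuous_const
    · refine (Set.finite_Icc ((⌊k * p.1⌋ - 3, ⌊k * p.2⌋ - 3) : ℤ × ℤ)
        (⌊k * p.1⌋ + 3, ⌊k * p.2⌋ + 3)).subset ?_
      rintro F ⟨q, hq, h1, h2⟩
      obtain ⟨h3, h4⟩ := hk F q hq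
      have key : ∀ (n : ℤ) (x y : ℝ), |y - x| < 1 → |y - n| ≤ 1 → ⌊x⌋ - 3 ≤ n ∧ n ≤ ⌊x⌋ + 3 := by
        intro n x y hxy hyn
        have f1 := Int.floor_le x
        have f2 := Int.lt_floor_add_one x
        rw [abs_lt] at hxy
        rw [abs_le] at hyn
        constructor
        · have : (⌊x⌋ - 3 : ℝ) ≤ n := by linarith
          exact_mod_cast this
        · have : (n : ℝ) ≤ ⌊x⌋ + 3 := by linarith
          exact_mod_cast this
      have k1 := key F.1 _ _ h1 h3
      have k2 := key F.2 _ _ h2 h4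
      exact ⟨⟨k1.1, k2.1⟩, k1.2, k2.2⟩
  exact hfin.comp_injective Subtype.val_injective

theorem isClosed_octagon (α : ℝ) (F : ℤ × ℤ) : IsClosed (octagon α F) :=
  IsClosed.and (isClosed_le (by fun_prop) (by fun_prop))
    (IsClosed.and (isClosed_le (by fun_prop) (by fun_prop))
      (isClosed_le (by fun_prop) (by fun_prop)))

theorem isClosed_diamond (α : ℝ) (v : ℤ × ℤ) : IsClosed (diamond α v) :=
  isClosed_le (by fun_prop) (by fun_prop)

/-- Two distinct squares with cut corners can only meet along the edge between them. -/
theorem exists_onEdge_of_mem_octagon {α : ℝ} (hα : 0 < α) (κ : ℤ) {F G : ℤ × ℤ} (hF : IsFace F)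
    (hG : IsFace G) (hne : F ≠ G) {p : ℝ × ℝ} (hpF : p ∈ octagon α F) (hpG : p ∈ octagon α G) :
    ∃ z, ∃ s : ℤˣ, Oriented κ z ∧ face s z = F ∧ face (-s) z = G ∧ OnEdge α z p := by
  obtain ⟨a, b⟩ := F
  obtain ⟨a', b'⟩ := G
  obtain ⟨h1, h2, h3⟩ := hpF
  obtain ⟨h4, h5, h6⟩ := hpG
  obtain ⟨x, rfl⟩ : ∃ x, a = 2 * x + 1 := ⟨a / 2, by have := hF.1; simp at this; omega⟩
  obtain ⟨y, rfl⟩ : ∃ y, b = 2 * y + 1 := ⟨b / 2, by have := hF.2; simp at this; omega⟩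
  obtain ⟨x', rfl⟩ : ∃ x, a' = 2 * x + 1 := ⟨a' / 2, by have := hG.1; simp at this; omega⟩
  obtain ⟨y', rfl⟩ : ∃ y, b' = 2 * y + 1 := ⟨b' / 2, by have := hG.2; simp at this; omega⟩
  clear hF hG
  have near : ∀ (m n : ℤ) (u : ℝ), |2 * u - (2 * m + 1 : ℤ)| ≤ 1 → |2 * u - (2 * n + 1 : ℤ)| ≤ 1 →
      n = m ∨ n = m + 1 ∧ u = n ∨ m = n + 1 ∧ u = m := by
    intro m n u hm hn
    rw [abs_le] at hm hn
    push_cast at hm hn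
    have i1 : (m : ℝ) ≤ n + 1 := by linarith
    have i2 : (n : ℝ) ≤ m + 1 := by linarith
    have i1 : m ≤ n + 1 := by exact_mod_cast i1
    have i2 : n ≤ m + 1 := by exact_mod_cast i2
    obtain rfl | rfl | rfl : n = m ∨ n = m + 1 ∨ m = n + 1 := by omega
    · exact .inl rfl
    · refine .inr (.inl ⟨rfl, ?_⟩); push_cast at hn ⊢; linarith
    · refine .inr (.inr ⟨rfl, ?_⟩); push_cast at hm ⊢; linarith
  have one : ∀ (m n : ℤ) (u : ℝ), (n = m + 1 ∧ u = n ∨ m = n + 1 ∧ u = m) →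
      |2 * u - (2 * m + 1 : ℤ)| = 1 := by
    rintro m n u (⟨rfl, rfl⟩ | ⟨rfl, rfl⟩) <;> push_cast
    · rw [abs_eq zero_le_one]; left; ring
    · rw [abs_eq zero_le_one]; right; ring
  have small : ∀ (m : ℤ) (u : ℝ), |2 * u - (2 * m + 1 : ℤ)| ≤ 1 - 4 * α →
      m + 2 * α ≤ u ∧ u ≤ m + 1 - 2 * α := by
    intro m u h
    rw [abs_le] at h
    push_cast at h
    exact ⟨by linarith, by linarith⟩
  simp only at h1 h2 h3 h4 h5 h6
  rcases near x x' p.1 h1 h4 with rfl | hx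
  · rcases near y y' p.2 h2 h5 with rfl | hy
    · exact absurd rfl hne
    · rw [one _ _ _ hy] at h3
      obtain ⟨l1, l2⟩ := small x' p.1 (by linarith)
      rcases hy with ⟨rfl, hy⟩ | ⟨rfl, hy⟩
      · obtain ⟨z, s, hz, f1, f2, hE⟩ := exists_dart_horizontal κ x' (y + 1) α
        exact ⟨z, -s, hz, by rw [f2]; ext <;> simp; ring, by rw [neg_neg, f1], hE p hy l1 l2⟩
      · obtain ⟨z, s, hz, f1, f2, hE⟩ := exists_dart_horizontal κ x' (y' + 1) α
        exact ⟨z, s, hz, f1, by rw [f2]; ext <;> simp; ring, hE p hy l1 l2⟩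
  · rw [one _ _ _ hx] at h3
    rcases near y y' p.2 h2 h5 with rfl | hy
    · obtain ⟨l1, l2⟩ := small y' p.2 (by linarith)
      rcases hx with ⟨rfl, hx⟩ | ⟨rfl, hx⟩
      · obtain ⟨z, s, hz, f1, f2, hE⟩ := exists_dart_vertical κ (x + 1) y' α
        exact ⟨z, -s, hz, by rw [f2]; ext <;> simp; ring, by rw [neg_neg, f1], hE p hx l1 l2⟩
      · obtain ⟨z, s, hz, f1, f2, hE⟩ := exists_dart_vertical κ (x' + 1) y' α
        exact ⟨z, s, hz, f1, by rw [f2]; ext <;> simp; ring, hE p hx l1 l2⟩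
    -- Unit squares that differ in both coordinates share only a lattice point, which the cut
    -- removes.
    · rw [one _ _ _ hy] at h3
      linarith

/-- A square with cut corners can only meet a tilted square along the cut corner between them. -/
theorem exists_onCorner_of_mem {α : ℝ} (hα' : α < 1 / 4) {κ : ℤ} {F v : ℤ × ℤ} (hF : IsFace F)
    {p : ℝ × ℝ} (hpF : p ∈ octagon α F) (hpv : p ∈ diamond α v) :
    ∃ y, ∃ s : ℤˣ, Oriented κ y ∧ head y = v ∧ face s y = F ∧ OnCorner α s y p := by
  obtain ⟨h1, h2, h3⟩ := hpF
  have h4 : |p.1 - v.1| + |p.2 - v.2| ≤ 2 * α := hpv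
  have n1 := abs_nonneg (p.1 - v.1)
  have n2 := abs_nonneg (p.2 - v.2)
  have k1 := abs_sub_eq_one_of_isFace hF.1 h1 (b := v.1) (β := 2 * α) (by linarith) (by linarith)
  have k2 := abs_sub_eq_one_of_isFace hF.2 h2 (b := v.2) (β := 2 * α) (by linarith) (by linarith)
  -- Octagon and diamond bound the sum over both coordinates of `|2u - n| + 2|u - m|` by `2`, while
  -- each term is at least `1`. Equality follows, and it fixes the sign of `u - m`.
  have key : ∀ (n m : ℤ) (u : ℝ), |(n : ℝ) - 2 * m| = 1 → 1 ≤ |2 * u - n| + 2 * |u - m| ∧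
      (1 = |2 * u - n| + 2 * |u - m| → u - m = (n - 2 * m) * |u - m|) := by
    intro n m u h
    rcases (abs_eq zero_le_one).1 h with e | e
    · rw [show (2 * u - n : ℝ) = 2 * (u - m) - 1 by linarith, e]
      generalize u - m = w
      rcases abs_cases w with hw | hw <;> rcases abs_cases (2 * w - 1) with hw' | hw' <;>
        exact ⟨by linarith, fun _ => by linarith⟩
    · rw [show (2 * u - n : ℝ) = 2 * (u - m) + 1 by linarith, e]
      generalize u - m = w
      rcases abs_cases w with hw | hw <;> rcases abs_cases (2 * w + 1) with hw' | hw' <;>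
        exact ⟨by linarith, fun _ => by linarith⟩
  obtain ⟨l1, m1⟩ := key _ _ p.1 k1
  obtain ⟨l2, m2⟩ := key _ _ p.2 k2
  have e1 := m1 (by linarith)
  have e2 := m2 (by linarith)
  have hsum : |p.1 - v.1| + |p.2 - v.2| = 2 * α := by linarith
  generalize |p.1 - v.1| = β₁ at *
  generalize |p.2 - v.2| = β₂ at *
  clear h1 h2 h3 h4 l1 l2 m1 m2 key hpv
  obtain ⟨a, b⟩ := v
  obtain ⟨a', b'⟩ := F
  replace k1 : a' = 2 * a + 1 ∨ a' = 2 * a - 1 := by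
    rcases (abs_eq zero_le_one).1 k1 with e | e
    · left; simp only at e; have : (a' : ℝ) = 2 * a + 1 := by linarith
      exact_mod_cast this
    · right; simp only at e; have : (a' : ℝ) = 2 * a - 1 := by linarith
      exact_mod_cast this
  replace k2 : b' = 2 * b + 1 ∨ b' = 2 * b - 1 := by
    rcases (abs_eq zero_le_one).1 k2 with e | e
    · left; simp only at e; have : (b' : ℝ) = 2 * b + 1 := by linarith
      exact_mod_cast this
    · right; simp only at e; have : (b' : ℝ) = 2 * b - 1 := by linarith
      exact_mod_cast this
  simp only at e1 e2
  have q1 : p.1 = a + (a' - 2 * a) * β₁ := by linarith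
  have q2 : p.2 = b + (b' - 2 * b) * β₂ := by linarith
  clear e1 e2
  -- Parity decides whether the oriented darts that end at `v` are horizontal or vertical.
  rcases Int.emod_two_eq_zero_or_one (a + b + κ) with h | h
  · rcases k1 with rfl | rfl <;> rcases k2 with rfl | rfl <;> push_cast at q1 q2
    · refine ⟨((a + 1, b), (-1, 0)), -1, ⟨by simp [IsDir], by simp; omega⟩, by simp [head],
        by simp [face]; omega, β₂, n2, by linarith, ?_, ?_⟩ <;> simp only [q1, q2] <;> push_cast <;>
        linarith
    · refine ⟨((a + 1, b), (-1, 0)), 1, ⟨by simp [IsDir], by simp; omega⟩, by simp [head],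
        by simp [face]; omega, β₂, n2, by linarith, ?_, ?_⟩ <;> simp only [q1, q2] <;> push_cast <;>
        linarith
    · refine ⟨((a - 1, b), (1, 0)), 1, ⟨by simp [IsDir], by simp; omega⟩, by simp [head],
        by simp [face]; omega, β₂, n2, by linarith, ?_, ?_⟩ <;> simp only [q1, q2] <;> push_cast <;>
        linarith
    · refine ⟨((a - 1, b), (1, 0)), -1, ⟨by simp [IsDir], by simp; omega⟩, by simp [head],
        by simp [face]; omega, β₂, n2, by linarith, ?_, ?_⟩ <;> simp only [q1, q2] <;> push_cast <;>
        linarith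
  · rcases k1 with rfl | rfl <;> rcases k2 with rfl | rfl <;> push_cast at q1 q2
    · refine ⟨((a, b + 1), (0, -1)), 1, ⟨by simp [IsDir], by simp; omega⟩, by simp [head],
        by simp [face]; omega, β₁, n1, by linarith, ?_, ?_⟩ <;> simp only [q1, q2] <;> push_cast <;>
        linarith
    · refine ⟨((a, b - 1), (0, 1)), -1, ⟨by simp [IsDir], by simp; omega⟩, by simp [head],
        by simp [face]; omega, β₁, n1, by linarith, ?_, ?_⟩ <;> simp only [q1, q2] <;> push_cast <;>
        linarith
    · refine ⟨((a, b + 1), (0, -1)), -1, ⟨by simp [IsDir], by simp; omega⟩, by simp [head],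
        by simp [face]; omega, β₁, n1, by linarith, ?_, ?_⟩ <;> simp only [q1, q2] <;> push_cast <;>
        linarith
    · refine ⟨((a, b - 1), (0, 1)), 1, ⟨by simp [IsDir], by simp; omega⟩, by simp [head],
        by simp [face]; omega, β₁, n1, by linarith, ?_, ?_⟩ <;> simp only [q1, q2] <;> push_cast <;>
        linarith

/-- The colour of the lattice point `v`, which is the colour of the squares that are not separated
from it by a corner of a curve with the turning rule `t`. -/
noncomputable def vertexColor (κ : ℤ) (t : ℤ × ℤ → ℤˣ) (f : ℤ × ℤ → ZMod 2) (v : ℤ × ℤ) : ZMod 2 :=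
  f (face (-t v) (Classical.choose (exists_oriented_head κ v)))

/-- The region of the plane with the colour `k`. -/
def region (α : ℝ) (f D : ℤ × ℤ → ZMod 2) (k : ZMod 2) : Set (ℝ × ℝ) :=
  (⋃ F ∈ {F | IsFace F ∧ f F = k}, octagon α F) ∪ ⋃ v ∈ {v | D v = k}, diamond α v

theorem isClosed_region {α : ℝ} (hα' : α < 1 / 4) (f D : ℤ × ℤ → ZMod 2) (k : ZMod 2) :
    IsClosed (region α f D k) := by
  refine IsClosed.union ?_ ?_
  · exact isClosed_biUnion_of_near (k := 2) (isClosed_octagon α) (fun F p hp => ⟨hp.1, hp.2.1⟩) _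
  · refine isClosed_biUnion_of_near (k := 1) (isClosed_diamond α) (fun v p hp => ?_) _
    have hp' : |p.1 - v.1| + |p.2 - v.2| ≤ 2 * α := hp
    have n1 := abs_nonneg (p.1 - v.1)
    have n2 := abs_nonneg (p.2 - v.2)
    simp only [one_mul]
    exact ⟨by linarith, by linarith⟩

namespace IsTrack

variable {α : ℝ} {κ : ℤ} {t : ℤ × ℤ → ℤˣ} {c : ℤ → Dart} {f : ℤ × ℤ → ZMod 2}

/-- The chosen dart does not matter: the other one is opposite, and its square is on the side `-t`
of the step after `y`. -/
theorem vertexColor_head (h : IsTrack κ t c) (hf : IsColoring κ (Set.range c) f) {y : Dart}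
    (hy : Oriented κ y) : vertexColor κ t f (head y) = f (face (-t (head y)) y) := by
  obtain ⟨hx, hxv⟩ := Classical.choose_spec (exists_oriented_head κ (head y))
  rw [vertexColor]
  generalize Classical.choose (exists_oriented_head κ (head y)) = x at *
  rcases hy.eq_or_eq_opp hx hxv.symm with rfl | rfl
  · rfl
  · rw [face_opp, neg_neg]
    exact hf.step_eq hy h.step_mem_iff.symm _

/-- Regions with different colours only meet on the curve. -/
theorem mem_smoothCurve_of_mem_region (h : IsTrack κ t c) (hα : 0 < α) (hα' : α < 1 / 4)
    (hf : IsColoring κ (Set.range c) f) {k l : ZMod 2} (hkl : k ≠ l) {p : ℝ × ℝ}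
    (hk : p ∈ region α f (vertexColor κ t f) k) (hl : p ∈ region α f (vertexColor κ t f) l) :
    p ∈ smoothCurve α t c := by
  have hcorner : ∀ {F v : ℤ × ℤ}, IsFace F → p ∈ octagon α F → p ∈ diamond α v →
      f F ≠ vertexColor κ t f v → p ∈ smoothCurve α t c := by
    intro F v hF hpF hpv hne
    obtain ⟨y, s, hy, rfl, rfl, hcor⟩ := exists_onCorner_of_mem (κ := κ) hα' hF hpF hpv
    rw [h.vertexColor_head hf hy] at hne
    -- Different colours force this corner to be the one cut by `t`, and force `y` to be on `c`,
    -- since an unused dart has equal colours on both sides.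
    have hs : t (head y) = s := by
      rcases Int.units_eq_or_eq_neg s (t (head y)) with e | e
      · exact e
      · rw [e, neg_neg] at hne; exact absurd rfl hne
    by_cases hyc : y ∈ Set.range c
    · obtain ⟨i, rfl⟩ := hyc
      exact ⟨i, .inr (by rwa [hs])⟩
    · exact absurd (hf.eq_of_notMem hy hyc _ _) hne
  simp only [region, Set.mem_union, Set.mem_iUnion, Set.mem_ofPred_eq, exists_prop] at hk hl
  rcases hk with ⟨F, ⟨hF, rfl⟩, hpF⟩ | ⟨v, rfl, hpv⟩ <;>
    rcases hl with ⟨G, ⟨hG, rfl⟩, hpG⟩ | ⟨w, rfl, hpw⟩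
  · obtain ⟨z, s, hz, rfl, rfl, hE⟩ := exists_onEdge_of_mem_octagon hα κ hF hG
      (fun e => hkl (by rw [e])) hpF hpG
    by_cases hzc : z ∈ Set.range c
    · obtain ⟨i, rfl⟩ := hzc
      exact ⟨i, .inl hE⟩
    · exact absurd (hf.eq_of_notMem hz hzc _ _) hkl
  · exact hcorner hF hpF hpw hkl
  · exact hcorner hG hpG hpv hkl.symm
  · refine absurd ?_ hkl
    have h1 : |p.1 - v.1| + |p.2 - v.2| ≤ 2 * α := hpv
    have h2 : |p.1 - w.1| + |p.2 - w.2| ≤ 2 * α := hpw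
    rw [eq_of_dist_lt (v := v) (w := w) (p := p) (by linarith)]

theorem centre_notMem (h : IsTrack κ t c) (hα' : α < 1 / 4) {F : ℤ × ℤ} (hF : IsFace F) :
    centre F ∉ smoothCurve α t c := by
  have e1 : 2 * (centre F).1 - F.1 = 0 := by simp only [centre]; ring
  have e2 : 2 * (centre F).2 - F.2 = 0 := by simp only [centre]; ring
  refine notMem_of_mem_interior hα' h.isDir hF ?_ ?_ ?_ <;> simp only [e1, e2] <;> norm_num
  linarith

theorem latticePoint_notMem (h : IsTrack κ t c) (hα : 0 < α) (hα' : α < 1 / 4) (P : ℤ × ℤ) :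
    latticePoint P ∉ smoothCurve α t c :=
  notMem_of_dist_lt (v := P) hα' h.isDir (by simp [latticePoint, hα])

/-- The two coloured regions are closed, cover the plane and meet only on the curve, so a connected
set off the curve lies in one of them. -/
theorem color_eq_of_linked (h : IsTrack κ t c) (hα : 0 < α) (hα' : α < 1 / 4)
    (hf : IsColoring κ (Set.range c) f) {F G : ℤ × ℤ} (hF : IsFace F) (hG : IsFace G)
    (hFG : Linked (smoothCurve α t c) (centre F) (centre G)) : f F = f G := by
  by_contra hne
  have hcentre : ∀ {F : ℤ × ℤ}, IsFace F → centre F ∈ region α f (vertexColor κ t f) (f F) := by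
    intro F hF
    refine .inl (Set.mem_biUnion (x := F) ⟨hF, rfl⟩ ?_)
    have e1 : 2 * (centre F).1 - F.1 = 0 := by simp only [centre]; ring
    have e2 : 2 * (centre F).2 - F.2 = 0 := by simp only [centre]; ring
    refine ⟨?_, ?_, ?_⟩ <;> simp only [e1, e2] <;> norm_num
    linarith
  set K := connectedComponentIn (smoothCurve α t c)ᶜ (centre F) with hK
  have hKF : centre F ∈ K := mem_connectedComponentIn (h.centre_notMem hα' hF)
  have hKG : centre G ∈ K := by
    rw [hK, hFG]; exact mem_connectedComponentIn (h.centre_notMem hα' hG)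
  have hKS : ∀ p ∈ K, p ∉ smoothCurve α t c := fun p hp => connectedComponentIn_subset _ _ hp
  have hcov : K ⊆ region α f (vertexColor κ t f) (f F) ∪ region α f (vertexColor κ t f) (f G) := by
    intro p _
    have hcol : ∀ k : ZMod 2, k = f F ∨ k = f G := by
      generalize f F = k₁ at hne
      generalize f G = k₂ at hne
      revert k₁ k₂; decide
    have hmem : ∃ k, p ∈ region α f (vertexColor κ t f) k := by
      rcases exists_mem_octagon_or_diamond α p with ⟨H, hH, hpH⟩ | ⟨v, hpv⟩
      · exact ⟨_, .inl (Set.mem_biUnion (x := H) ⟨hH, rfl⟩ hpH)⟩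
      · exact ⟨_, .inr (Set.mem_biUnion (x := v) rfl hpv)⟩
    obtain ⟨k, hk⟩ := hmem
    rcases hcol k with rfl | rfl
    · exact .inl hk
    · exact .inr hk
  have hpre : IsPreconnected K := isPreconnected_connectedComponentIn
  rcases isPreconnected_iff_subset_of_disjoint_closed.1 hpre _ _ (isClosed_region hα' _ _ _)
    (isClosed_region hα' _ _ _) hcov (by
      ext p
      simp only [Set.mem_inter_iff, Set.mem_empty_iff_false, iff_false]
      rintro ⟨hp, h1, h2⟩
      exact hKS p hp (h.mem_smoothCurve_of_mem_region hα hα' hf hne h1 h2)) with hs | hs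
  · exact hKS _ hKG (h.mem_smoothCurve_of_mem_region hα hα' hf hne (hs hKG) (hcentre hG))
  · exact hKS _ hKF (h.mem_smoothCurve_of_mem_region hα hα' hf hne (hcentre hF) (hs hKF))

/-- The two sides of the curve belong to different components of its complement. -/
theorem side_eq_of_linked (h : IsTrack κ t c) (hα : 0 < α) (hα' : α < 1 / 4) {s s' : ℤˣ} {i j : ℤ}
    (hl : Linked (smoothCurve α t c) (centre (face s (c i))) (centre (face s' (c j)))) :
    s = s' := by
  obtain ⟨f, hf⟩ := h.isBalanced.exists_coloring
  have he := h.color_eq_of_linked hα hα' hf (isFace_face (h.isDir i) s)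
    (isFace_face (h.isDir j) s') hl
  rcases Int.units_eq_or_eq_neg s s' with e | e
  · exact e.symm
  · rw [e] at he
    exact absurd he (h.color_ne hf s i j)

end IsTrack

/-! ### Lattice components -/

theorem Conn.mem {E : Set (ℤ × ℤ)} {P Q : ℤ × ℤ} (h : Conn E P Q) (hP : P ∈ E) : Q ∈ E := by
  induction h with
  | refl => exact hP
  | tail _ hadj _ => exact hadj.2.1

theorem IsPathConnectedLattice.conn {E L : Set (ℤ × ℤ)} (hL : IsPathConnectedLattice L)
    (hLE : L ⊆ E) {P Q : ℤ × ℤ} (hP : P ∈ L) (hQ : Q ∈ L) : Conn E P Q := by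
  obtain ⟨n, X, rfl, rfl, hadj, hmem⟩ := hL P hP Q hQ
  have key : ∀ i ≤ n, Conn E (X 0) (X i) := by
    intro i hi
    induction i with
    | zero => exact Conn.refl _ _
    | succ i ih =>
      exact Relation.ReflTransGen.tail (ih (by omega))
        ⟨hLE (hmem i (by omega)), hLE (hmem (i + 1) hi), hadj i (by omega)⟩
  exact key n le_rfl

theorem Conn.exists_path {E : Set (ℤ × ℤ)} {P Q : ℤ × ℤ} (h : Conn E P Q) :
    ∃ (n : ℕ) (X : ℕ → ℤ × ℤ), X 0 = P ∧ X n = Q ∧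
      (∀ i < n, ((X (i + 1)).1 - (X i).1) ^ 2 + ((X (i + 1)).2 - (X i).2) ^ 2 = 1) ∧
      ∀ i ≤ n, Conn E P (X i) := by
  induction h with
  | refl => exact ⟨0, fun _ => P, rfl, rfl, by simp, fun _ _ => Conn.refl _ _⟩
  | @tail Q R hPQ hQR ih =>
    obtain ⟨n, X, h0, hn, hadj, hconn⟩ := ih
    refine ⟨n + 1, fun i => if i ≤ n then X i else R, by simpa using h0, by simp, ?_, ?_⟩
    · intro i hi
      rcases (Nat.lt_succ_iff.1 hi).lt_or_eq with hlt | rfl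
      · simpa [hlt.le, Nat.succ_le_of_lt hlt] using hadj i hlt
      · simpa [hn] using hQR.2.2
    · intro i _
      by_cases hi : i ≤ n
      · simpa [hi] using hconn i hi
      · simpa [hi] using Conn.trans hPQ (.single hQR)

theorem latticeComponents_eq (E : Set (ℤ × ℤ)) :
    latticeComponents E = {K | ∃ P ∈ E, K = {Q | Conn E P Q}} := by
  have hclass : ∀ P ∈ E, {Q | Conn E P Q} ⊆ E ∧ IsPathConnectedLattice {Q | Conn E P Q} := by
    refine fun P hP => ⟨fun Q hQ => Conn.mem hQ hP, fun Q hQ R hR => ?_⟩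
    obtain ⟨n, X, h0, hn, hadj, hconn⟩ := (Conn.trans (Conn.symm hQ) hR).exists_path
    exact ⟨n, X, h0, hn, hadj, fun i hi => Conn.trans hQ (hconn i hi)⟩
  ext K
  constructor
  · rintro ⟨⟨P, hP⟩, ⟨hKE, hK⟩, hmax⟩
    have hsub : K ⊆ {Q | Conn E P Q} := fun Q hQ => hK.conn hKE hP hQ
    exact ⟨P, hKE hP, hsub.antisymm (hmax (hclass P (hKE hP)) hsub)⟩
  · rintro ⟨P, hP, rfl⟩
    exact ⟨⟨P, Conn.refl _ _⟩, hclass P hP, fun L ⟨hLE, hL⟩ hsub Q hQ =>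
      hL.conn hLE (hsub (Conn.refl E P)) hQ⟩

namespace IsTrack

variable {α : ℝ} {κ : ℤ} {t : ℤ × ℤ → ℤˣ} {c : ℤ → Dart}

/-- A component of the exterior consists of the exterior lattice points on one side of the curve. -/
theorem conn_eq (h : IsTrack κ t c) (hα : 0 < α) (hα' : α < 1 / 4) {P : ℤ × ℤ}
    (hP : P ∈ exterior c) : ∃ s, {Q | Conn (exterior c) P Q} = exterior c ∩ latticePoint ⁻¹'
      connectedComponentIn (smoothCurve α t c)ᶜ (centre (face s (c 0))) := by
  have hside : ∀ {Q : ℤ × ℤ} {s : ℤˣ} {i : ℤ}, SideLeadsTo κ t c s (face s (c i)) Q →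
      Linked (smoothCurve α t c) (centre (face s (c 0))) (latticePoint Q) := fun hQ =>
    (h.linked_side hα hα' _ _ _).trans (h.linked_of_sideLeadsTo hα hα' hQ)
  obtain ⟨s, i, hs⟩ := h.exists_side hP
  refine ⟨s, ?_⟩
  ext Q
  constructor
  · intro hQ
    refine ⟨Conn.mem hQ hP, ?_⟩
    have hl : Linked (smoothCurve α t c) (latticePoint P) (latticePoint Q) := by
      induction hQ with
      | refl => rfl
      | tail _ hadj ih => exact ih.trans (h.linked_of_latticeAdj hα hα' hadj)
    rw [Set.mem_preimage, (hside hs).trans hl]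
    exact mem_connectedComponentIn (h.latticePoint_notMem hα hα' Q)
  · rintro ⟨hQ, hQc⟩
    obtain ⟨s', j, hs'⟩ := h.exists_side hQ
    have := h.side_eq_of_linked hα hα'
      (.trans (connectedComponentIn_eq hQc) (hside hs').symm)
    subst this
    exact h.conn_of_side hs hs'

theorem planeComponents_eq (h : IsTrack κ t c) (hα : 0 < α) (hα' : α < 1 / 4) :
    planeComponents (smoothCurve α t c)ᶜ =
      {connectedComponentIn (smoothCurve α t c)ᶜ (centre (face 1 (c 0))),
        connectedComponentIn (smoothCurve α t c)ᶜ (centre (face (-1) (c 0)))} := by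
  ext U
  constructor
  · rintro ⟨p, hp, rfl⟩
    obtain ⟨s, hs⟩ := h.exists_linked_side hα hα' hp
    rw [hs]
    rcases Int.units_eq_one_or s with rfl | rfl <;> simp
  · rintro (rfl | rfl) <;>
      exact ⟨_, h.centre_notMem hα' (isFace_face (h.isDir 0) _), rfl⟩

end IsTrack

/-! ### Complete curves as sequences of darts -/

namespace OrientedSegment

/-- The oriented support of a segment of curve. -/
def dart (s : OrientedSegment) : Dart := (s.initialPoint, s.terminalPoint - s.initialPoint)

theorem head_dart (s : OrientedSegment) : head s.dart = s.terminalPoint := by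
  simp [dart, head]

theorem isDir_dart (s : OrientedSegment) : IsDir s.dart.2 := by
  obtain ⟨h, p, x, y, ζ, η⟩ := s
  cases h <;> cases p <;>
    simp [IsDir, dart, initialPoint, terminalPoint, lowVertex, highVertex]

theorem dist_beginning {α : ℝ} (hα : 0 < α) (s : OrientedSegment) :
    |(s.beginning α).1 - s.initialPoint.1| + |(s.beginning α).2 - s.initialPoint.2| = 2 * α := by
  obtain ⟨h, p, x, y, ζ, η⟩ := s
  cases h <;> cases p <;> rcases Int.units_eq_one_or ζ with rfl | rfl <;>
    rcases Int.units_eq_one_or η with rfl | rfl <;>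
    simp [beginning, initialPoint, lowEnd, highEnd, lowVertex, highVertex, sgn, abs_of_pos hα,
      sub_sub_cancel_left] <;> ring

theorem dist_ending {α : ℝ} (hα : 0 < α) (s : OrientedSegment) :
    |(s.ending α).1 - s.terminalPoint.1| + |(s.ending α).2 - s.terminalPoint.2| = 2 * α := by
  obtain ⟨h, p, x, y, ζ, η⟩ := s
  cases h <;> cases p <;> rcases Int.units_eq_one_or ζ with rfl | rfl <;>
    rcases Int.units_eq_one_or η with rfl | rfl <;>
    simp [ending, terminalPoint, lowEnd, highEnd, lowVertex, highVertex, sgn, abs_of_pos hα,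
      sub_sub_cancel_left] <;> ring

/-- The common end is at ℓ¹-distance `2 * α` from both lattice points, and `4 * α < 1`. -/
theorem terminalPoint_eq_initialPoint {α : ℝ} (hα : 0 < α) (hα' : α < 1 / 4) {s t : OrientedSegment}
    (h : s.ending α = t.beginning α) : s.terminalPoint = t.initialPoint := by
  have h1 := dist_ending hα s
  have h2 := dist_beginning hα t
  rw [← h] at h2
  exact eq_of_dist_lt (p := s.ending α) (by linarith)

theorem dart_eq_turnStep {s t : OrientedSegment} (h : s.terminalPoint = t.initialPoint) {a : ℤˣ}
    (ha : (a : ℤ) = s.turn t) : t.dart = turnStep a s.dart := by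
  refine Prod.ext ?_ ?_
  · rw [turnStep_fst, head_dart, h]; rfl
  · have hs := s.isDir_dart
    have ht := t.isDir_dart
    change (a : ℤ) = s.dart.2.1 * t.dart.2.2 - s.dart.2.2 * t.dart.2.1 at ha
    simp only [turnStep]
    generalize s.dart.2 = d at *
    generalize t.dart.2 = e at *
    rcases hs with rfl | rfl | rfl | rfl <;> rcases ht with rfl | rfl | rfl | rfl <;>
      simp at ha <;> simp [ha]

/-- The segments end halfway on the cut corners. -/
theorem ending_eq {α : ℝ} {s t : OrientedSegment}
    (h : s.ending α = t.beginning α) (h' : s.terminalPoint = t.initialPoint) {a : ℤˣ}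
    (ha : (a : ℤ) = s.turn t) :
    s.ending α = ((s.terminalPoint.1 - α * s.dart.2.1 + α * t.dart.2.1,
      s.terminalPoint.2 - α * s.dart.2.2 + α * t.dart.2.2) : ℝ × ℝ) := by
  -- A nonzero determinant rules out parallel segments; for the others the common end fixes the
  -- signs `ζ`, `η` involved.
  have ha0 : s.turn t ≠ 0 := by rw [← ha]; exact a.ne_zero
  clear ha
  obtain ⟨h₁, p₁, x, y, ζ, η⟩ := s
  obtain ⟨h₂, p₂, x', y', ζ', η'⟩ := t
  cases h₁ <;> cases p₁ <;> cases h₂ <;> cases p₂ <;>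
    simp [turn, ending, beginning, initialPoint, terminalPoint, lowEnd, highEnd, lowVertex,
      highVertex, dart] at h h' ha0 ⊢ <;>
    obtain ⟨rfl, rfl⟩ := h' <;> push_cast at h ⊢ <;> obtain ⟨h₁, h₂⟩ := h <;> linarith

theorem support_eq (s : OrientedSegment) :
    s.support = segment ℝ (latticePoint s.initialPoint) (latticePoint s.terminalPoint) := by
  unfold support initialPoint terminalPoint
  cases s.positive
  · exact segment_symm _ _ _
  · rfl

theorem carrier_eq (α : ℝ) (s : OrientedSegment) : s.carrier α =
    segment ℝ (s.beginning α) (s.initialPoint.1 + 2 * α * s.dart.2.1,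
      s.initialPoint.2 + 2 * α * s.dart.2.2) ∪
    segment ℝ (s.initialPoint.1 + 2 * α * s.dart.2.1, s.initialPoint.2 + 2 * α * s.dart.2.2)
      (s.terminalPoint.1 - 2 * α * s.dart.2.1, s.terminalPoint.2 - 2 * α * s.dart.2.2) ∪
    segment ℝ (s.terminalPoint.1 - 2 * α * s.dart.2.1, s.terminalPoint.2 - 2 * α * s.dart.2.2)
      (s.ending α) := by
  obtain ⟨h, p, x, y, ζ, η⟩ := s
  have hpos : ∀ A B D E A' B' D' E' : ℝ × ℝ, A = A' → B = B' → D = D' → E = E' →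
      segment ℝ A B ∪ segment ℝ B D ∪ segment ℝ D E =
        segment ℝ A' B' ∪ segment ℝ B' D' ∪ segment ℝ D' E' := by
    rintro A B D E _ _ _ _ rfl rfl rfl rfl; rfl
  have hneg : ∀ A B D E A' B' D' E' : ℝ × ℝ, A = E' → B = D' → D = B' → E = A' →
      segment ℝ A B ∪ segment ℝ B D ∪ segment ℝ D E =
        segment ℝ A' B' ∪ segment ℝ B' D' ∪ segment ℝ D' E' := by
    rintro A B D E _ _ _ _ rfl rfl rfl rfl
    rw [segment_symm ℝ A B, segment_symm ℝ B D, segment_symm ℝ D E, Set.union_comm,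
      Set.union_comm (segment ℝ B A), Set.union_assoc]
  cases p <;> cases h
  · refine hneg _ _ _ _ _ _ _ _ rfl ?_ ?_ rfl <;>
      simp [lowBend, highBend, initialPoint, terminalPoint, lowVertex, highVertex, dart] <;> ring
  · refine hneg _ _ _ _ _ _ _ _ rfl ?_ ?_ rfl <;>
      simp [lowBend, highBend, initialPoint, terminalPoint, lowVertex, highVertex, dart] <;> ring
  · refine hpos _ _ _ _ _ _ _ _ rfl ?_ ?_ rfl <;>
      simp [lowBend, highBend, initialPoint, terminalPoint, lowVertex, highVertex, dart]
  · refine hpos _ _ _ _ _ _ _ _ rfl ?_ ?_ rfl <;>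
      simp [lowBend, highBend, initialPoint, terminalPoint, lowVertex, highVertex, dart]

end OrientedSegment

theorem mem_segment_iff_coord {p x y : ℝ × ℝ} : p ∈ segment ℝ x y ↔
    ∃ r : ℝ, 0 ≤ r ∧ r ≤ 1 ∧ p.1 = x.1 + r * (y.1 - x.1) ∧ p.2 = x.2 + r * (y.2 - x.2) := by
  rw [segment_eq_image']
  constructor
  · rintro ⟨r, ⟨h0, h1⟩, rfl⟩
    exact ⟨r, h0, h1, by simp, by simp⟩
  · rintro ⟨r, h0, h1, h2, h3⟩
    exact ⟨r, ⟨h0, h1⟩, Prod.ext (by simp [h2]) (by simp [h3])⟩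

/-- Segments stop at the midpoints of corners, so each corner of `smoothCurve` is the last piece of
one segment followed by the first piece of the next. -/
theorem curveSet_eq_smoothCurve {α : ℝ} (hα : 0 < α) (hα' : α < 1 / 4) {C : ℤ → OrientedSegment}
    {t : ℤ × ℤ → ℤˣ} (hnext : ∀ i, (C (i + 1)).dart = step t (C i).dart)
    (hend : ∀ i, (C i).ending α = (C (i + 1)).beginning α)
    (hmid : ∀ i, (C i).ending α = (((C i).terminalPoint.1 - α * (C i).dart.2.1 +
        α * (C (i + 1)).dart.2.1, (C i).terminalPoint.2 - α * (C i).dart.2.2 +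
        α * (C (i + 1)).dart.2.2) : ℝ × ℝ)) :
    curveSet α C = smoothCurve α t fun i => (C i).dart := by
  have hcor : ∀ i p, OnCorner α (t (head (C i).dart)) (C i).dart p ↔ ∃ b : ℝ, 0 ≤ b ∧ b ≤ 2 * α ∧
      p.1 = (C i).terminalPoint.1 - (2 * α - b) * (C i).dart.2.1 + b * (C (i + 1)).dart.2.1 ∧
      p.2 = (C i).terminalPoint.2 - (2 * α - b) * (C i).dart.2.2 + b * (C (i + 1)).dart.2.2 := by
    intro i p
    have e1 : ((C i).terminalPoint.1 : ℝ) = (C i).dart.1.1 + (C i).dart.2.1 := by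
      rw [← OrientedSegment.head_dart]; simp [head]
    have e2 : ((C i).terminalPoint.2 : ℝ) = (C i).dart.1.2 + (C i).dart.2.2 := by
      rw [← OrientedSegment.head_dart]; simp [head]
    rw [hnext i, e1, e2]
    simp only [OnCorner, step, turnStep]
    push_cast
    simp only [mul_neg, ← sub_eq_add_neg]
  have hinit : ∀ i, (C i).terminalPoint = (C (i + 1)).initialPoint := fun i =>
    OrientedSegment.terminalPoint_eq_initialPoint hα hα' (hend i)
  have hedge : ∀ i p, OnEdge α (C i).dart p ↔ p ∈ segment ℝ
      (((C i).initialPoint.1 + 2 * α * (C i).dart.2.1,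
        (C i).initialPoint.2 + 2 * α * (C i).dart.2.2) : ℝ × ℝ)
      ((C i).terminalPoint.1 - 2 * α * (C i).dart.2.1,
        (C i).terminalPoint.2 - 2 * α * (C i).dart.2.2) := by
    intro i p
    have e1 : ((C i).terminalPoint.1 : ℝ) = (C i).initialPoint.1 + (C i).dart.2.1 := by
      simp [OrientedSegment.dart]
    have e2 : ((C i).terminalPoint.2 : ℝ) = (C i).initialPoint.2 + (C i).dart.2.2 := by
      simp [OrientedSegment.dart]
    rw [mem_segment_iff_coord, e1, e2]
    have hpos : 0 < 1 - 4 * α := by linarith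
    constructor
    · rintro ⟨u, h1, h2, h3, h4⟩
      have hu : u = 2 * α + (u - 2 * α) / (1 - 4 * α) * (1 - 4 * α) := by
        rw [div_mul_cancel₀ _ hpos.ne']; ring
      refine ⟨(u - 2 * α) / (1 - 4 * α), div_nonneg (by linarith) hpos.le,
        (div_le_one hpos).2 (by linarith), ?_, ?_⟩
      · rw [h3]; nth_rw 1 [hu]; simp only [OrientedSegment.dart]; ring
      · rw [h4]; nth_rw 1 [hu]; simp only [OrientedSegment.dart]; ring
    · rintro ⟨r, h1, h2, h3, h4⟩
      refine ⟨2 * α + r * (1 - 4 * α), by nlinarith, by nlinarith, ?_, ?_⟩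
      · rw [h3]; simp only [OrientedSegment.dart]; ring
      · rw [h4]; simp only [OrientedSegment.dart]; ring
  ext p
  simp only [curveSet, smoothCurve, Set.mem_iUnion, Set.mem_ofPred_eq, OrientedSegment.carrier_eq,
    Set.mem_union, hcor, hedge]
  constructor
  · rintro ⟨i, (hp | hp) | hp⟩
    · obtain ⟨j, rfl⟩ : ∃ j, i = j + 1 := ⟨i - 1, by ring⟩
      refine ⟨j, .inr ?_⟩
      rw [mem_segment_iff_coord, ← hend, hmid, ← hinit] at hp
      obtain ⟨r, h0, h1, h2, h3⟩ := hp
      refine ⟨α + r * α, by nlinarith, by nlinarith, ?_, ?_⟩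
      · rw [h2]; ring
      · rw [h3]; ring
    · exact ⟨i, .inl hp⟩
    · refine ⟨i, .inr ?_⟩
      rw [mem_segment_iff_coord, hmid] at hp
      obtain ⟨r, h0, h1, h2, h3⟩ := hp
      refine ⟨r * α, by nlinarith, by nlinarith, ?_, ?_⟩
      · rw [h2]; ring
      · rw [h3]; ring
  · rintro ⟨i, hp | ⟨b, h0, h1, h2, h3⟩⟩
    · exact ⟨i, .inl (.inr hp)⟩
    · have hb : b = b / α * α := by rw [div_mul_cancel₀ _ hα.ne']
      rcases le_total b α with hle | hle
      · refine ⟨i, .inr ?_⟩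
        rw [mem_segment_iff_coord, hmid]
        refine ⟨b / α, by positivity, (div_le_one hα).2 hle, ?_, ?_⟩
        · rw [h2]; simp only; linear_combination
            ((C i).dart.2.1 + (C (i + 1)).dart.2.1 : ℝ) * hb
        · rw [h3]; simp only; linear_combination
            ((C i).dart.2.2 + (C (i + 1)).dart.2.2 : ℝ) * hb
      · refine ⟨i + 1, .inl (.inl ?_)⟩
        rw [mem_segment_iff_coord, ← hend, hmid, ← hinit]
        refine ⟨b / α - 1, by rw [sub_nonneg, one_le_div hα]; exact hle,
          by rw [sub_le_iff_le_add, div_le_iff₀ hα]; linarith, ?_, ?_⟩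
        · rw [h2]; simp only; linear_combination
            ((C i).dart.2.1 + (C (i + 1)).dart.2.1 : ℝ) * hb
        · rw [h3]; simp only; linear_combination
            ((C i).dart.2.2 + (C (i + 1)).dart.2.2 : ℝ) * hb

/-- A complete folding curve follows a turning rule. -/
theorem IsCompleteFoldingCurve.exists_isTrack {α : ℝ} (hα : 0 < α) (hα' : α < 1 / 4)
    {C : ℤ → OrientedSegment} (hC : IsCompleteFoldingCurve α C) :
    ∃ κ t, IsTrack κ t (fun i => (C i).dart) ∧
      curveSet α C = smoothCurve α t (fun i => (C i).dart) ∧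
      latticeExt C = exterior fun i => (C i).dart := by
  obtain ⟨⟨hcon, hsupp⟩, a, ha, hturn⟩ := hC
  have hend : ∀ i, (C i).ending α = (C (i + 1)).beginning α := fun i => (hcon i).2
  have hinit : ∀ i, (C i).terminalPoint = (C (i + 1)).initialPoint := fun i =>
    OrientedSegment.terminalPoint_eq_initialPoint hα hα' (hend i)
  have hdart : ∀ i, (C (i + 1)).dart = turnStep (a i) (C i).dart := fun i =>
    OrientedSegment.dart_eq_turnStep (hinit i) (hturn i)
  have hdir : ∀ i, IsDir (C i).dart.2 := fun i => (C i).isDir_dart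
  have hinj : Function.Injective fun i => (C i).dart := by
    intro i j hij
    refine hsupp ?_
    have h1 : (C i).initialPoint = (C j).initialPoint := congrArg Prod.fst hij
    have h2 : (C i).terminalPoint = (C j).terminalPoint := by
      rw [← OrientedSegment.head_dart, ← OrientedSegment.head_dart]; exact congrArg head hij
    simp only [OrientedSegment.support_eq, h1, h2]
  obtain ⟨κ, hκ⟩ : ∃ κ, Oriented κ (C 0).dart :=
    ⟨-((C 0).dart.1.1 + (C 0).dart.1.2 + (C 0).dart.2.1), hdir 0, by simp⟩
  have hor : ∀ i, Oriented κ (C i).dart := by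
    intro i
    refine (Int.eq_of_forall_eq_pred (g := fun i => Oriented κ (C i).dart) (fun i => ?_) i 0).mpr hκ
    have e := hdart (i - 1)
    rw [sub_add_cancel] at e
    refine propext ⟨fun h => ?_, fun h => ?_⟩
    · rw [← turnStep_four (a (i - 1)) (C (i - 1)).dart, ← e]
      exact ((h.turn _).turn _).turn _
    · rw [e]; exact h.turn _
  -- Distinct visits of a point arrive by opposite darts; with opposite turns they would leave by
  -- the same dart.
  have hcons : ∀ i j, head (C i).dart = head (C j).dart → a i = a j := by
    intro i j hij
    rcases (hor i).eq_or_eq_opp (hor j) hij with e | e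
    · rw [hinj e]
    · rcases Int.units_eq_or_eq_neg (a j) (a i) with e' | e'
      · exact e'
      · have : (C (i + 1)).dart = (C (j + 1)).dart := by
          rw [hdart, hdart, e, turnStep_opp, e']
        rw [add_right_cancel (hinj this)]
  obtain ⟨t, hflips, hnext, haper⟩ := exists_aperiodic_rule ha hdart hdir hcons
  refine ⟨κ, t, ⟨hnext, hor, hinj, hflips, haper⟩, curveSet_eq_smoothCurve hα hα' hnext hend
    fun i => OrientedSegment.ending_eq (hend i) (hinit i) (hturn i), ?_⟩
  ext P
  simp only [latticeExt, curveVertices, exterior, Visited, Set.mem_compl_iff, Set.mem_ofPred_eq,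
    OrientedSegment.head_dart]
  refine not_congr ⟨?_, fun ⟨i, hi⟩ => ⟨i, .inr hi.symm⟩⟩
  rintro ⟨i, rfl | rfl⟩
  · exact ⟨i - 1, by rw [hinit, sub_add_cancel]⟩
  · exact ⟨i, rfl⟩

theorem theorem2p4 (α : ℝ) (hα : 0 < α) (hα' : α < 1 / 4) (C : ℤ → OrientedSegment)
    (hC : IsCompleteFoldingCurve α C) :
    (latticeComponents (latticeExt C)).encard ≤ 2 ∧
    ⋃₀ latticeComponents (latticeExt C) = latticeExt C ∧
    (∀ K ∈ latticeComponents (latticeExt C), K.Infinite) ∧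
    (planeComponents (curveSet α C)ᶜ).encard = 2 ∧
    ∀ K ∈ latticeComponents (latticeExt C), ∃ U ∈ planeComponents (curveSet α C)ᶜ,
      K = latticeExt C ∩ latticePoint ⁻¹' U := by
  obtain ⟨κ, t, h, hcurve, hext⟩ := hC.exists_isTrack hα hα'
  rw [hcurve, hext]
  generalize (fun i => (C i).dart) = c at h
  clear hcurve hext
  rw [latticeComponents_eq, h.planeComponents_eq hα hα']
  refine ⟨?_, ?_, ?_, ?_, ?_⟩
  · refine (Set.encard_le_encard (t := {exterior c ∩ latticePoint ⁻¹'
      connectedComponentIn (smoothCurve α t c)ᶜ (centre (face 1 (c 0))),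
      exterior c ∩ latticePoint ⁻¹'
        connectedComponentIn (smoothCurve α t c)ᶜ (centre (face (-1) (c 0)))}) ?_).trans
      ((Set.encard_insert_le _ _).trans (by rw [Set.encard_singleton]; norm_num))
    rintro _ ⟨P, hP, rfl⟩
    obtain ⟨s, hs⟩ := h.conn_eq hα hα' hP
    rw [hs]
    rcases Int.units_eq_one_or s with rfl | rfl <;> simp
  · ext P
    constructor
    · rintro ⟨_, ⟨Q, hQ, rfl⟩, hPQ⟩
      exact Conn.mem hPQ hQ
    · intro hP
      exact ⟨_, ⟨P, hP, rfl⟩, Conn.refl _ _⟩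
  · rintro _ ⟨P, hP, rfl⟩
    exact h.infinite_conn hP
  · refine Set.encard_pair fun e => ?_
    have := h.side_eq_of_linked hα hα' (s := 1) (s' := -1) e
    exact absurd this (by decide)
  · rintro _ ⟨P, hP, rfl⟩
    obtain ⟨s, hs⟩ := h.conn_eq hα hα' hP
    refine ⟨_, ?_, hs⟩
    rcases Int.units_eq_one_or s with rfl | rfl <;> simp
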